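/- Let $M=(M,\eta,\xi,\varphi,g)$ be a $3$-dimensional regular Sasaki manifold: $g$ is a Riemannian metric with $\varphi^2=-I+\eta\otimes\xi$, $\eta(\xi)=1$, $g(\varphi X,\varphi Y)=g(X,Y)-\eta(X)\eta(Y)$, $g(\xi,\cdot)=\eta$, $d\eta(X,Y)=2g(X,\varphi Y)$, $(\nabla_X\varphi)Y=g(X,Y)\xi-\eta(Y)X$, where $\eta$ is a contact form, and $\xi$ generates a one-parameter group $K$ of isometries acting simply transitively on each of its orbits. Let $\pi:M\to\bar M=M/K$ be its Boothby-Wang fibering onto the orbit surface $\bar M$, which carries the metric that makes $\pi$ a Riemannian submersion and the almost complex structure $J\bar X=\pi_*(\varphi\bar X^*)$ ($\bar X^*$ the horizontal lift of $\bar X$). Let $\bar\gamma:I\to\bar M$ be a smooth curve parametrised by arc length $s$ on an open interval $I$, with signed curvature $\bar\kappa$, that is, $\bar\nabla_{\bar\gamma'}\bar\gamma'=\bar\kappa\,J\bar\gamma'$. Let $S=S_{\bar\gamma}=\pi^{-1}(\bar\gamma)$ be the Hopf cylinder over $\bar\gamma$ (an immersed surface if $\bar\gamma$ has self-intersections), $\mathbb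 H$ its mean curvature vector field (half the trace of the second fundamental form) and $\Delta^\perp=-\mathrm{tr}\,(\nabla^\perp)^2$ its normal Laplacian. Let $\mathbb H_{\bar\gamma}=\bar\nabla_{\bar\gamma'}\bar\gamma'$ and $\Delta^\perp_{\bar\gamma}=-\nabla^\perp_{\bar\gamma'}\nabla^\perp_{\bar\gamma'}$ be the mean curvature vector field and the normal Laplacian of $\bar\gamma$ in $\bar M$. Let $\lambda\in\mathbb R$. Then $\bar\kappa$ is smooth and the following are equivalent: (a) $S_{\bar\gamma}$ satisfies $\Delta^\perp\mathbb H=\lambda\mathbb H$; (b) $\bar\gamma$ satisfies $\Delta^\perp_{\bar\gamma}\mathbb H_{\bar\gamma}=\lambda\mathbb H_{\bar\gamma}$; (c) $\bar\kappa''+\lambda\bar\kappa=0$ on $I$; (d) there are $a,b\in\mathbb R$ such that on $I$: $\bar\kappa(s)=as+b$ if $\lambda=0$; $\bar\kappa(s)=a\cos(\sqrt\lambda\,s)+b\sin(\sqrt\lambda\,s)$ if $\lambda>0$; $\bar\kappa(s)=a\exp(\sqrt{-\lambda}\,s)+b\exp(-\sqrt{-\lambda}\,s)$ if $\lambda<0$.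 -/

import Mathlib

open Set Bundle Manifold
open scoped ContDiff Manifold

noncomputable section

namespace HopfCylinder

/-! ## The Levi-Civita connection along a map, in charts -/

section Connection

variable {E : Type*} [NormedAddCommGroup E] [NormedSpace ℝ E]
  {H : Type*} [TopologicalSpace H] (I : ModelWithCorners ℝ E H)
  {M : Type*} [TopologicalSpace M] [ChartedSpace H M] [IsManifold I ∞ M]

/-- The components of a tangent vector at `q` in the preferred chart around `p`
(meaningful for `q` in the domain of that chart). -/
def chartCoord (p : M) {q : M} (v : TangentSpace I q) : E :=
  (trivializationAt E (TangentSpace I : M → Type _) p ⟨q, v⟩).2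

/-- The vector field, on the domain of the preferred chart around `p`, whose components in that
chart are constantly equal to `e`. For `e` a basis vector this is a coordinate vector field. -/
def chartField (p : M) (e : E) (q : M) : TangentSpace I q :=
  (trivializationAt E (TangentSpace I : M → Type _) p).symm q e

variable [RiemannianBundle (fun x : M ↦ TangentSpace I x)]

/-- The right-hand side of the Koszul formula at `p`, for the (commuting) vector fields `V, W, Z`
with constant components in the chart around `p` and values `v, w, z` at `p`: this is
`(V⟨W, Z⟩ + W⟨V, Z⟩ - Z⟨V, W⟩) / 2`, i.e. the Christoffel symbol of the first kind. -/
def christoffelFirst (p : M) (v w z : TangentSpace I p) : ℝ :=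
  let V := chartField I p (chartCoord I p v)
  let W := chartField I p (chartCoord I p w)
  let Z := chartField I p (chartCoord I p z)
  (mvfderiv I (fun q ↦ (inner ℝ (W q) (Z q) : ℝ)) p v
    + mvfderiv I (fun q ↦ (inner ℝ (V q) (Z q) : ℝ)) p w
    - mvfderiv I (fun q ↦ (inner ℝ (V q) (W q) : ℝ)) p z) / 2

variable [FiniteDimensional ℝ E]

instance (p : M) : FiniteDimensional ℝ (TangentSpace I p) :=
  inferInstanceAs (FiniteDimensional ℝ E)

/-- The Christoffel symbol `Γ(v, w)` at `p` of the Levi-Civita connection, in the chart around `p`: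
the vector with `⟨Γ(v, w), z⟩ = christoffelFirst p v w z` for all `z`. -/
def christoffel (p : M) (v w : TangentSpace I p) : TangentSpace I p :=
  let b := stdOrthonormalBasis ℝ (TangentSpace I p)
  ∑ i, christoffelFirst I p v w (b i) • b i

variable {E' : Type*} [NormedAddCommGroup E'] [NormedSpace ℝ E']
  {H' : Type*} [TopologicalSpace H'] (I' : ModelWithCorners ℝ E' H')
  {N : Type*} [TopologicalSpace N] [ChartedSpace H' N]

/-- The covariant derivative `∇_u V` at `x`, in the direction `u ∈ T_x N`, of a vector field `V`
along `f : N → M`, for the Levi-Civita connection of `M`. With `f = id` this is the Levi-Civita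
connection itself; with `N = ℝ` it is the covariant derivative along a curve. -/
def covAlong (f : N → M) (V : ∀ x, TangentSpace I (f x)) (x : N) (u : TangentSpace I' x) :
    TangentSpace I (f x) :=
  chartField I (f x) (mvfderiv I' (fun y ↦ chartCoord I (f x) (V y)) x u) (f x)
    + christoffel I (f x) (mfderiv I' I f x u) (V x)

/-- The Levi-Civita connection: `∇_v Y` at `p`. -/
def leviCivita (Y : ∀ p : M, TangentSpace I p) (p : M) (v : TangentSpace I p) :
    TangentSpace I p :=
  covAlong I I (fun q : M ↦ q) Y p v

end Connection

/-! ## Curves in a Riemannian manifold -/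

section Curve

variable {E : Type*} [NormedAddCommGroup E] [NormedSpace ℝ E] [FiniteDimensional ℝ E]
  {H : Type*} [TopologicalSpace H] (I : ModelWithCorners ℝ E H)
  {M : Type*} [TopologicalSpace M] [ChartedSpace H M] [IsManifold I ∞ M]
  [RiemannianBundle (fun x : M ↦ TangentSpace I x)]

/-- The velocity of a curve. -/
def velocity (γ : ℝ → M) (s : ℝ) : TangentSpace I (γ s) :=
  mfderiv 𝓘(ℝ, ℝ) I γ s (1 : ℝ)

/-- A smooth curve parametrised by arc length on the open interval `J`. -/
structure IsUnitSpeedCurve (γ : ℝ → M) (J : Set ℝ) : Prop where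
  isOpen : IsOpen J
  ordConnected : J.OrdConnected
  smooth : ContMDiffOn 𝓘(ℝ, ℝ) I ∞ γ J
  unit_speed : ∀ s ∈ J, (inner ℝ (velocity I γ s) (velocity I γ s) : ℝ) = 1

/-- Covariant derivative along a curve, `∇_{γ'} V`. -/
def curveDeriv (γ : ℝ → M) (V : ∀ s, TangentSpace I (γ s)) (s : ℝ) : TangentSpace I (γ s) :=
  covAlong I 𝓘(ℝ, ℝ) γ V s (1 : ℝ)

/-- Normal covariant derivative along a unit speed curve,
`∇^⊥_{γ'} V = ∇_{γ'} V - ⟨∇_{γ'} V, γ'⟩ γ'`. -/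
def curveNormalDeriv (γ : ℝ → M) (V : ∀ s, TangentSpace I (γ s)) (s : ℝ) :
    TangentSpace I (γ s) :=
  curveDeriv I γ V s - (inner ℝ (curveDeriv I γ V s) (velocity I γ s) : ℝ) • velocity I γ s

/-- The mean curvature vector field `∇_{γ'} γ'` of a unit speed curve. -/
def curveMeanCurvature (γ : ℝ → M) (s : ℝ) : TangentSpace I (γ s) :=
  curveDeriv I γ (velocity I γ) s

/-- The normal Laplacian `Δ^⊥ V = -∇^⊥_{γ'} ∇^⊥_{γ'} V` of a unit speed curve. -/
def curveNormalLaplacian (γ : ℝ → M) (V : ∀ s, TangentSpace I (γ s)) (s : ℝ) :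
    TangentSpace I (γ s) :=
  -curveNormalDeriv I γ (curveNormalDeriv I γ V) s

end Curve

/-! ## Immersed surface patches in a Riemannian manifold -/

/-- The parameter plane of surface patches. -/
abbrev Plane := EuclideanSpace ℝ (Fin 2)

section Surface

variable {E : Type*} [NormedAddCommGroup E] [NormedSpace ℝ E] [FiniteDimensional ℝ E]
  {H : Type*} [TopologicalSpace H] (I : ModelWithCorners ℝ E H)
  {M : Type*} [TopologicalSpace M] [ChartedSpace H M] [IsManifold I ∞ M]
  [RiemannianBundle (fun x : M ↦ TangentSpace I x)]

/-- The coordinate vectors of the parameter plane. -/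
def coordVec (i : Fin 2) : Plane := EuclideanSpace.single i (1 : ℝ)

/-- The tangent vector `∂_i Φ` of a surface patch. -/
def partialVec (Φ : Plane → M) (i : Fin 2) (u : Plane) : TangentSpace I (Φ u) :=
  mfderiv 𝓘(ℝ, Plane) I Φ u (coordVec i)

/-- The first fundamental form (induced metric) `g_ij = ⟨∂_i Φ, ∂_j Φ⟩`. -/
def firstForm (Φ : Plane → M) (u : Plane) : Matrix (Fin 2) (Fin 2) ℝ :=
  Matrix.of fun i j ↦ (inner ℝ (partialVec I Φ i u) (partialVec I Φ j u) : ℝ)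

/-- The Christoffel symbols `Γ^k_ij` of the induced metric. -/
def inducedChristoffel (Φ : Plane → M) (k i j : Fin 2) (u : Plane) : ℝ :=
  ∑ l, (firstForm I Φ u)⁻¹ k l *
    (fderiv ℝ (fun x ↦ firstForm I Φ x j l) u (coordVec i)
      + fderiv ℝ (fun x ↦ firstForm I Φ x i l) u (coordVec j)
      - fderiv ℝ (fun x ↦ firstForm I Φ x i j) u (coordVec l)) / 2

/-- The component of a vector normal to the surface:
`w - g^{ij} ⟨w, ∂_i Φ⟩ ∂_j Φ`. -/
def normalPart (Φ : Plane → M) (u : Plane) (w : TangentSpace I (Φ u)) : TangentSpace I (Φ u) :=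
  w - ∑ i, ∑ j, ((firstForm I Φ u)⁻¹ i j * (inner ℝ w (partialVec I Φ i u) : ℝ)) •
    partialVec I Φ j u

/-- The ambient covariant derivative `∇_{∂_i} V` of a vector field along the patch. -/
def patchDeriv (Φ : Plane → M) (i : Fin 2) (V : ∀ u, TangentSpace I (Φ u)) (u : Plane) :
    TangentSpace I (Φ u) :=
  covAlong I 𝓘(ℝ, Plane) Φ V u (coordVec i)

/-- The normal connection `∇^⊥_{∂_i} V`. -/
def patchNormalDeriv (Φ : Plane → M) (i : Fin 2) (V : ∀ u, TangentSpace I (Φ u)) (u : Plane) :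
    TangentSpace I (Φ u) :=
  normalPart I Φ u (patchDeriv I Φ i V u)

/-- The mean curvature vector field of the patch: half the trace of the (vector valued) second
fundamental form `(∇_{∂_i} ∂_j Φ)^⊥` with respect to the induced metric. -/
def patchMeanCurvature (Φ : Plane → M) (u : Plane) : TangentSpace I (Φ u) :=
  (1 / 2 : ℝ) • ∑ i, ∑ j, (firstForm I Φ u)⁻¹ i j •
    patchNormalDeriv I Φ i (partialVec I Φ j) u

/-- The normal Laplacian of the patch,
`Δ^⊥ V = -g^{ij} (∇^⊥_{∂_i} ∇^⊥_{∂_j} V - Γ^k_ij ∇^⊥_{∂_k} V)`. -/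
def patchNormalLaplacian (Φ : Plane → M) (V : ∀ u, TangentSpace I (Φ u)) (u : Plane) :
    TangentSpace I (Φ u) :=
  -∑ i, ∑ j, (firstForm I Φ u)⁻¹ i j •
    (patchNormalDeriv I Φ i (patchNormalDeriv I Φ j V) u
      - ∑ k, inducedChristoffel I Φ k i j u • patchNormalDeriv I Φ k V u)

end Surface

/-! ## Sasaki 3-manifolds -/

section Sasaki

/-- The model space of 3-manifolds. -/
abbrev R3 := EuclideanSpace ℝ (Fin 3)

/-- The model space of surfaces. -/
abbrev R2 := EuclideanSpace ℝ (Fin 2)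

variable {M : Type*} [TopologicalSpace M] [ChartedSpace R3 M] [IsManifold (𝓡 3) ∞ M]

/-- The exterior derivative of a 1-form on two vector fields,
`dη(X, Y) = X η(Y) - Y η(X) - η([X, Y])`. -/
def oneFormDeriv (η : ∀ p : M, TangentSpace (𝓡 3) p →L[ℝ] ℝ)
    (X Y : ∀ p : M, TangentSpace (𝓡 3) p) (p : M) : ℝ :=
  mvfderiv (𝓡 3) (fun q ↦ η q (Y q)) p (X p)
    - mvfderiv (𝓡 3) (fun q ↦ η q (X q)) p (Y p)
    - η p (VectorField.mlieBracket (𝓡 3) X Y p)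

variable [RiemannianBundle (fun x : M ↦ TangentSpace (𝓡 3) x)]

variable (M) in
/-- The structure tensors of a contact Riemannian 3-manifold, the Riemannian metric being that of
the tangent bundle of `M`. The condition `contact` is `dη ∧ η ≠ 0`. -/
structure ContactMetricStructure where
  /-- the contact form -/
  η : ∀ p : M, TangentSpace (𝓡 3) p →L[ℝ] ℝ
  /-- the Reeb vector field -/
  ξ : ∀ p : M, TangentSpace (𝓡 3) p
  /-- the endomorphism field -/
  φ : ∀ p : M, TangentSpace (𝓡 3) p →L[ℝ] TangentSpace (𝓡 3) p
  smooth_η : ContMDiff (𝓡 3) ((𝓡 3).prod 𝓘(ℝ, R3 →L[ℝ] ℝ)) ∞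
    (fun p ↦ TotalSpace.mk' (R3 →L[ℝ] ℝ) (E := fun q : M ↦ TangentSpace (𝓡 3) q →L[ℝ] ℝ) p (η p))
  smooth_ξ : ContMDiff (𝓡 3) ((𝓡 3).prod 𝓘(ℝ, R3)) ∞
    (fun p ↦ TotalSpace.mk' R3 (E := fun q : M ↦ TangentSpace (𝓡 3) q) p (ξ p))
  smooth_φ : ContMDiff (𝓡 3) ((𝓡 3).prod 𝓘(ℝ, R3 →L[ℝ] R3)) ∞
    (fun p ↦ TotalSpace.mk' (R3 →L[ℝ] R3)
      (E := fun q : M ↦ TangentSpace (𝓡 3) q →L[ℝ] TangentSpace (𝓡 3) q) p (φ p))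
  contact : ∀ p : M, ∃ X Y Z : ∀ q : M, TangentSpace (𝓡 3) q,
    MDifferentiableAt (𝓡 3) ((𝓡 3).prod 𝓘(ℝ, R3))
      (fun q ↦ (⟨q, X q⟩ : TotalSpace R3 (TangentSpace (𝓡 3) : M → Type _))) p ∧
    MDifferentiableAt (𝓡 3) ((𝓡 3).prod 𝓘(ℝ, R3))
      (fun q ↦ (⟨q, Y q⟩ : TotalSpace R3 (TangentSpace (𝓡 3) : M → Type _))) p ∧
    MDifferentiableAt (𝓡 3) ((𝓡 3).prod 𝓘(ℝ, R3))
      (fun q ↦ (⟨q, Z q⟩ : TotalSpace R3 (TangentSpace (𝓡 3) : M → Type _))) p ∧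
    oneFormDeriv η X Y p * η p (Z p) + oneFormDeriv η Y Z p * η p (X p)
      + oneFormDeriv η Z X p * η p (Y p) ≠ 0
  η_ξ : ∀ p, η p (ξ p) = 1
  φ_sq : ∀ p v, φ p (φ p v) = -v + η p v • ξ p
  inner_φ_φ : ∀ p v w,
    (inner ℝ (φ p v) (φ p w) : ℝ) = (inner ℝ v w : ℝ) - η p v * η p w
  inner_ξ : ∀ p v, (inner ℝ (ξ p) v : ℝ) = η p v
  dη : ∀ (p : M) (X Y : ∀ q : M, TangentSpace (𝓡 3) q),
    MDifferentiableAt (𝓡 3) ((𝓡 3).prod 𝓘(ℝ, R3))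
      (fun q ↦ (⟨q, X q⟩ : TotalSpace R3 (TangentSpace (𝓡 3) : M → Type _))) p →
    MDifferentiableAt (𝓡 3) ((𝓡 3).prod 𝓘(ℝ, R3))
      (fun q ↦ (⟨q, Y q⟩ : TotalSpace R3 (TangentSpace (𝓡 3) : M → Type _))) p →
    oneFormDeriv η X Y p = 2 * (inner ℝ (X p) (φ p (Y p)) : ℝ)

/-- The Sasaki condition `(∇_v φ) Y = g(v, Y) ξ - η(Y) v`, where
`(∇_v φ) Y = ∇_v (φ Y) - φ (∇_v Y)`. -/
def ContactMetricStructure.IsSasaki (S : ContactMetricStructure M) : Prop :=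
  ∀ (p : M) (v : TangentSpace (𝓡 3) p) (Y : ∀ q : M, TangentSpace (𝓡 3) q),
    MDifferentiableAt (𝓡 3) ((𝓡 3).prod 𝓘(ℝ, R3))
      (fun q ↦ (⟨q, Y q⟩ : TotalSpace R3 (TangentSpace (𝓡 3) : M → Type _))) p →
    leviCivita (𝓡 3) (fun q ↦ S.φ q (Y q)) p v - S.φ p (leviCivita (𝓡 3) Y p v)
      = (inner ℝ v (Y p) : ℝ) • S.ξ p - S.η p (Y p) • v

/-- `θ` is the flow of the Reeb vector field, it is complete and consists of isometries, and the
one-parameter group `K = {θ_t}` acts freely, i.e. simply transitively on each of its orbits. -/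
structure ContactMetricStructure.IsRegularFlow (S : ContactMetricStructure M)
    (θ : ℝ → M → M) : Prop where
  smooth : ContMDiff (𝓘(ℝ, ℝ).prod (𝓡 3)) (𝓡 3) ∞ (fun x : ℝ × M ↦ θ x.1 x.2)
  zero : ∀ p, θ 0 p = p
  add : ∀ s t p, θ (s + t) p = θ s (θ t p)
  generates : ∀ p, IsMIntegralCurve (I := 𝓡 3) (fun t ↦ θ t p) S.ξ
  isometry : ∀ t p (v w : TangentSpace (𝓡 3) p),
    (inner ℝ (mfderiv (𝓡 3) (𝓡 3) (θ t) p v) (mfderiv (𝓡 3) (𝓡 3) (θ t) p w) : ℝ)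
      = (inner ℝ v w : ℝ)
  free : ∀ t p, θ t p = p → ∀ q, θ t q = q

variable {B : Type*} [TopologicalSpace B] [ChartedSpace R2 B] [IsManifold (𝓡 2) ∞ B]
  [RiemannianBundle (fun x : B ↦ TangentSpace (𝓡 2) x)]

/-- `pr : M → B` is the Boothby-Wang fibering: `B` is the orbit space of the Reeb flow `θ`
(a smooth surjective submersion onto `B` whose fibres are the orbits), with the metric that makes
`pr` a Riemannian submersion. -/
structure ContactMetricStructure.IsBoothbyWangFibering (S : ContactMetricStructure M)
    (θ : ℝ → M → M) (pr : M → B) : Prop where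
  smooth : ContMDiff (𝓡 3) (𝓡 2) ∞ pr
  surjective : Function.Surjective pr
  submersion : ∀ p, Function.Surjective (mfderiv (𝓡 3) (𝓡 2) pr p)
  fibre_iff : ∀ p q, pr p = pr q ↔ ∃ t, θ t p = q
  isometry : ∀ p (v w : TangentSpace (𝓡 3) p), S.η p v = 0 → S.η p w = 0 →
    (inner ℝ (mfderiv (𝓡 3) (𝓡 2) pr p v) (mfderiv (𝓡 3) (𝓡 2) pr p w) : ℝ) = (inner ℝ v w : ℝ)

open Classical in
/-- The horizontal lift to `p` of a vector `X` tangent to the base at `pr p`: the vector orthogonal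
to `ξ` that `pr` maps to `X`. -/
def ContactMetricStructure.horizontalLift (S : ContactMetricStructure M) (pr : M → B) (p : M)
    (X : TangentSpace (𝓡 2) (pr p)) : TangentSpace (𝓡 3) p :=
  if h : ∃ v : TangentSpace (𝓡 3) p, S.η p v = 0 ∧ mfderiv (𝓡 3) (𝓡 2) pr p v = X then h.choose
  else 0

open Classical in
/-- The almost complex structure `J X = pr_* (φ X^*)` of the base, at a point `b` (computed at
some point of the fibre over `b`; it does not depend on that point). -/
def ContactMetricStructure.baseJ (S : ContactMetricStructure M) (pr : M → B) (b : B)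
    (X : TangentSpace (𝓡 2) b) : TangentSpace (𝓡 2) b :=
  if h : ∃ p, pr p = b then
    h.choose_spec ▸ (mfderiv (𝓡 3) (𝓡 2) pr h.choose
      (S.φ h.choose (S.horizontalLift pr h.choose (h.choose_spec.symm ▸ X))) :
        TangentSpace (𝓡 2) (pr h.choose))
  else 0

/-- The signed curvature of a unit speed curve in the base: the function `κ` with
`∇_{γ'} γ' = κ J γ'`. -/
def ContactMetricStructure.signedCurvature (S : ContactMetricStructure M) (pr : M → B)
    (γ : ℝ → B) (s : ℝ) : ℝ :=
  inner ℝ (curveDeriv (𝓡 2) γ (velocity (𝓡 2) γ) s) (S.baseJ pr (γ s) (velocity (𝓡 2) γ s))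

/-- The Hopf cylinder over the curve `γ : J → B`: the inverse image of `γ` under `pr`, the points
being labelled by the parameter of `γ` (so that it is an immersed surface even if `γ` has
self-intersections). -/
def hopfCylinder (pr : M → B) (γ : ℝ → B) (J : Set ℝ) : Set (ℝ × M) :=
  {x | x.1 ∈ J ∧ pr x.2 = γ x.1}

/-- A local parametrisation of the Hopf cylinder by an open set `U` of the plane: a smooth map
`(σ, Φ)` from `U` to the Hopf cylinder with `Φ : U → M` an immersion. -/
structure IsHopfPatch (pr : M → B) (γ : ℝ → B) (J : Set ℝ) (U : Set Plane) (σ : Plane → ℝ)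
    (Φ : Plane → M) : Prop where
  isOpen : IsOpen U
  smooth_param : ContDiffOn ℝ ∞ σ U
  smooth : ContMDiffOn 𝓘(ℝ, Plane) (𝓡 3) ∞ Φ U
  mapsTo : ∀ u ∈ U, (σ u, Φ u) ∈ hopfCylinder pr γ J
  immersion : ∀ u ∈ U, Function.Injective (mfderiv 𝓘(ℝ, Plane) (𝓡 3) Φ u)

/-- The Hopf cylinder over `γ` satisfies `Δ^⊥ ℍ = lam ℍ` (tested in all its local
parametrisations). -/
def HopfCylinderSatisfies (pr : M → B) (γ : ℝ → B) (J : Set ℝ) (lam : ℝ) : Prop :=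
  ∀ (U : Set Plane) (σ : Plane → ℝ) (Φ : Plane → M), IsHopfPatch pr γ J U σ Φ →
    ∀ u ∈ U, patchNormalLaplacian (𝓡 3) Φ (patchMeanCurvature (𝓡 3) Φ) u
      = lam • patchMeanCurvature (𝓡 3) Φ u

/-- The curve `γ : J → B` satisfies `Δ^⊥ ℍ = lam ℍ` in the base. -/
def CurveSatisfies (γ : ℝ → B) (J : Set ℝ) (lam : ℝ) : Prop :=
  ∀ s ∈ J, curveNormalLaplacian (𝓡 2) γ (curveMeanCurvature (𝓡 2) γ) s
    = lam • curveMeanCurvature (𝓡 2) γ s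

end Sasaki

end HopfCylinder

end

open Set Bundle Manifold
open scoped ContDiff Manifold

namespace HopfCylinder

open Filter Topology

set_option linter.unusedSectionVars false

/-! ## Vector fields along maps -/

section Along

variable {E : Type*} [NormedAddCommGroup E] [NormedSpace ℝ E]
  {H : Type*} [TopologicalSpace H] {I : ModelWithCorners ℝ E H}
  {M : Type*} [TopologicalSpace M] [ChartedSpace H M] [IsManifold I ∞ M]
  {E' : Type*} [NormedAddCommGroup E'] [NormedSpace ℝ E']
  {H' : Type*} [TopologicalSpace H'] {I' : ModelWithCorners ℝ E' H'}
  {N : Type*} [TopologicalSpace N] [ChartedSpace H' N]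

variable (I I') in
/-- The vector field `V` along `f` is smooth at `x`. -/
def SmoothAlong (f : N → M) (V : ∀ y, TangentSpace I (f y)) (x : N) : Prop :=
  ContMDiffAt I' I.tangent ∞ (fun y ↦ (⟨f y, V y⟩ : TangentBundle I M)) x

variable (I I') in
/-- The vector field `V` along `f` is differentiable at `x`. -/
def DiffAlong (f : N → M) (V : ∀ y, TangentSpace I (f y)) (x : N) : Prop :=
  MDifferentiableAt I' I.tangent (fun y ↦ (⟨f y, V y⟩ : TangentBundle I M)) x

theorem chartCoord_eq {p q : M} (hq : q ∈ (chartAt H p).source) (v : TangentSpace I q) :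
    chartCoord I p v =
      (trivializationAt E (TangentSpace I : M → Type _) p).continuousLinearMapAt ℝ q v := by
  have hq' : q ∈ (trivializationAt E (TangentSpace I : M → Type _) p).baseSet := by simpa using hq
  rw [Trivialization.continuousLinearMapAt_apply, Trivialization.linearMapAt_apply, if_pos hq']
  rfl

theorem chartField_eq {p q : M} (hq : q ∈ (chartAt H p).source) (e : E) :
    chartField I p e q = (trivializationAt E (TangentSpace I : M → Type _) p).symmL ℝ q e := by
  have hq' : q ∈ (trivializationAt E (TangentSpace I : M → Type _) p).baseSet := by simpa using hq
  rw [Trivialization.symmL_apply _ hq']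
  rfl

theorem chartField_chartCoord {p q : M} (hq : q ∈ (chartAt H p).source) (v : TangentSpace I q) :
    chartField I p (chartCoord I p v) q = v := by
  have hq' : q ∈ (trivializationAt E (TangentSpace I : M → Type _) p).baseSet := by simpa using hq
  rw [chartField_eq hq, chartCoord_eq hq]
  exact Trivialization.symmL_continuousLinearMapAt _ hq' v

theorem chartCoord_chartField {p q : M} (hq : q ∈ (chartAt H p).source) (e : E) :
    chartCoord I p (chartField I p e q) = e := by
  have hq' : q ∈ (trivializationAt E (TangentSpace I : M → Type _) p).baseSet := by simpa using hq
  rw [chartCoord_eq hq, chartField_eq hq]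
  exact Trivialization.continuousLinearMapAt_symmL _ hq' e

theorem chartCoord_add {p q : M} (hq : q ∈ (chartAt H p).source) (v w : TangentSpace I q) :
    chartCoord I p (v + w) = chartCoord I p v + chartCoord I p w := by
  simp only [chartCoord_eq hq, map_add]

theorem chartCoord_smul {p q : M} (hq : q ∈ (chartAt H p).source) (c : ℝ) (v : TangentSpace I q) :
    chartCoord I p (c • v) = c • chartCoord I p v := by
  simp only [chartCoord_eq hq, map_smul]

theorem chartField_add {p q : M} (hq : q ∈ (chartAt H p).source) (e e' : E) :
    chartField I p (e + e') q = chartField I p e q + chartField I p e' q := by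
  simp only [chartField_eq hq, map_add]

theorem chartField_smul {p q : M} (hq : q ∈ (chartAt H p).source) (c : ℝ) (e : E) :
    chartField I p (c • e) q = c • chartField I p e q := by
  simp only [chartField_eq hq, map_smul]

theorem chartCoord_eq_mfderiv {p q : M} (hq : q ∈ (chartAt H p).source) (v : TangentSpace I q) :
    chartCoord I p v = mfderiv I 𝓘(ℝ, E) (extChartAt I p) q v := by
  rw [chartCoord_eq hq, TangentBundle.continuousLinearMapAt_trivializationAt hq]
  rfl

theorem smoothAlong_iff {f : N → M} {V : ∀ y, TangentSpace I (f y)} {x : N} :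
    SmoothAlong I I' f V x ↔
      ContMDiffAt I' I ∞ f x ∧
        ContMDiffAt I' 𝓘(ℝ, E) ∞ (fun y ↦ chartCoord I (f x) (V y)) x := by
  unfold SmoothAlong
  exact contMDiffAt_totalSpace

theorem diffAlong_iff {f : N → M} {V : ∀ y, TangentSpace I (f y)} {x : N} :
    DiffAlong I I' f V x ↔
      MDifferentiableAt I' I f x ∧
        MDifferentiableAt I' 𝓘(ℝ, E) (fun y ↦ chartCoord I (f x) (V y)) x := by
  unfold DiffAlong
  exact mdifferentiableAt_totalSpace _ _

theorem SmoothAlong.diffAlong {f : N → M} {V : ∀ y, TangentSpace I (f y)} {x : N}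
    (h : SmoothAlong I I' f V x) : DiffAlong I I' f V x :=
  ContMDiffAt.mdifferentiableAt h (by simp)

theorem SmoothAlong.base {f : N → M} {V : ∀ y, TangentSpace I (f y)} {x : N}
    (h : SmoothAlong I I' f V x) : ContMDiffAt I' I ∞ f x := (smoothAlong_iff.1 h).1

theorem eventually_mem_chart {f : N → M} {x : N} (hf : ContinuousAt f x) :
    ∀ᶠ y in 𝓝 x, f y ∈ (chartAt H (f x)).source :=
  hf.preimage_mem_nhds (chart_source_mem_nhds H (f x))

theorem SmoothAlong.add {f : N → M} {V W : ∀ y, TangentSpace I (f y)} {x : N}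
    (hV : SmoothAlong I I' f V x) (hW : SmoothAlong I I' f W x) :
    SmoothAlong I I' f (fun y ↦ V y + W y) x := by
  rw [smoothAlong_iff] at *
  refine ⟨hV.1, (hV.2.add hW.2).congr_of_eventuallyEq ?_⟩
  filter_upwards [eventually_mem_chart (H := H) hV.1.continuousAt] with y hy
  exact chartCoord_add hy _ _

theorem SmoothAlong.smul {f : N → M} {V : ∀ y, TangentSpace I (f y)} {x : N} {a : N → ℝ}
    (ha : ContMDiffAt I' 𝓘(ℝ, ℝ) ∞ a x) (hV : SmoothAlong I I' f V x) :
    SmoothAlong I I' f (fun y ↦ a y • V y) x := by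
  rw [smoothAlong_iff] at *
  refine ⟨hV.1, (ha.smul hV.2).congr_of_eventuallyEq ?_⟩
  filter_upwards [eventually_mem_chart (H := H) hV.1.continuousAt] with y hy
  exact chartCoord_smul hy _ _

theorem smoothAlong_chartField (p : M) (e : E) :
    SmoothAlong I I (fun q : M ↦ q) (fun q ↦ chartField I p e q) p := by
  rw [smoothAlong_iff]
  refine ⟨contMDiffAt_id, contMDiffAt_const (c := e) |>.congr_of_eventuallyEq ?_⟩
  filter_upwards [eventually_mem_chart (H := H) (f := fun q : M ↦ q) (x := p) continuousAt_id]
    with y hy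
  exact chartCoord_chartField hy _

theorem totalSpace_mk_congr {b b' : M} (h : b = b') {v : TangentSpace I b} {v' : TangentSpace I b'}
    (hv : (v : E) = v') : (⟨b, v⟩ : TangentBundle I M) = ⟨b', v'⟩ := by
  subst h; cases hv; rfl

theorem SmoothAlong.congr {f f' : N → M} {V : ∀ y, TangentSpace I (f y)}
    {V' : ∀ y, TangentSpace I (f' y)} {x : N} (hV : SmoothAlong I I' f V x)
    (h : ∀ᶠ y in 𝓝 x, f' y = f y ∧ (V' y : E) = V y) : SmoothAlong I I' f' V' x := by
  refine ContMDiffAt.congr_of_eventuallyEq hV ?_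
  filter_upwards [h] with y hy
  exact totalSpace_mk_congr hy.1 hy.2

/-- The differential of `f` applied to a smooth vector field along `g` is smooth along `f ∘ g`. -/
theorem SmoothAlong.map {E₂ : Type*} [NormedAddCommGroup E₂] [NormedSpace ℝ E₂]
    {H₂ : Type*} [TopologicalSpace H₂] {I₂ : ModelWithCorners ℝ E₂ H₂}
    {M₂ : Type*} [TopologicalSpace M₂] [ChartedSpace H₂ M₂] [IsManifold I₂ ∞ M₂]
    {f : N → M} {V : ∀ y, TangentSpace I (f y)} {x : N} {g : M → M₂} (hg : ContMDiff I I₂ ∞ g)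
    (hV : SmoothAlong I I' f V x) :
    SmoothAlong I₂ I' (fun y ↦ g (f y)) (fun y ↦ mfderiv I I₂ g (f y) (V y)) x :=
  ((hg.contMDiff_tangentMap (m := ∞) (by simp)).contMDiffAt).comp x hV

end Along

/-! ## The derivative of a map defined on a vector space -/

section Flat

variable {E : Type*} [NormedAddCommGroup E] [NormedSpace ℝ E]
  {H : Type*} [TopologicalSpace H] {I : ModelWithCorners ℝ E H}
  {M : Type*} [TopologicalSpace M] [ChartedSpace H M] [IsManifold I ∞ M]
  {E' : Type*} [NormedAddCommGroup E'] [NormedSpace ℝ E']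

theorem chartCoord_mfderiv {F : E' → M} {p : M} {y : E'}
    (hF : MDifferentiableAt 𝓘(ℝ, E') I F y) (hy : F y ∈ (chartAt H p).source) (v : E') :
    chartCoord I p (mfderiv 𝓘(ℝ, E') I F y v) = fderiv ℝ (extChartAt I p ∘ F) y v := by
  rw [chartCoord_eq_mfderiv hy, ← mfderiv_eq_fderiv,
    mfderiv_comp y (mdifferentiableAt_extChartAt hy) hF]
  rfl

theorem contDiffAt_extChartAt_comp {F : E' → M} {x : E'} (hF : ContMDiffAt 𝓘(ℝ, E') I ∞ F x)
    {p : M} (hp : F x ∈ (chartAt H p).source) :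
    ContDiffAt ℝ ∞ (extChartAt I p ∘ F) x :=
  ((contMDiffAt_extChartAt' hp).comp x hF).contDiffAt

theorem eventually_chartCoord_mfderiv {F : E' → M} {x : E'}
    (hF : ContMDiffAt 𝓘(ℝ, E') I ∞ F x) (v : E') :
    ∀ᶠ y in 𝓝 x, chartCoord I (F x) (mfderiv 𝓘(ℝ, E') I F y v) =
      fderiv ℝ (extChartAt I (F x) ∘ F) y v := by
  have h1 : ∀ᶠ y in 𝓝 x, ContMDiffAt 𝓘(ℝ, E') I 1 F y :=
    (contMDiffAt_iff_contMDiffAt_nhds (by simp)).1 (hF.of_le (by simp))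
  filter_upwards [eventually_mem_chart (H := H) hF.continuousAt, h1] with y hy hy1
  exact chartCoord_mfderiv (hy1.mdifferentiableAt (by simp)) hy v

theorem smoothAlong_mfderiv {F : E' → M} {x : E'} (hF : ContMDiffAt 𝓘(ℝ, E') I ∞ F x) (v : E') :
    SmoothAlong I 𝓘(ℝ, E') F (fun y ↦ mfderiv 𝓘(ℝ, E') I F y v) x := by
  rw [smoothAlong_iff]
  refine ⟨hF, ContMDiffAt.congr_of_eventuallyEq ?_ (eventually_chartCoord_mfderiv hF v)⟩
  rw [contMDiffAt_iff_contDiffAt]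
  have := contDiffAt_extChartAt_comp hF (mem_chart_source H (F x))
  exact (this.fderiv_right (m := ∞) (by simp)).clm_apply contDiffAt_const

end Flat

/-! ## Properties of the covariant derivative along a map -/

section Covariant

variable {E : Type*} [NormedAddCommGroup E] [NormedSpace ℝ E]
  {H : Type*} [TopologicalSpace H] {I : ModelWithCorners ℝ E H}
  {M : Type*} [TopologicalSpace M] [ChartedSpace H M] [IsManifold I ∞ M]
  [RiemannianBundle (fun x : M ↦ TangentSpace I x)]
  {E' : Type*} [NormedAddCommGroup E'] [NormedSpace ℝ E']
  {H' : Type*} [TopologicalSpace H'] {I' : ModelWithCorners ℝ E' H'}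
  {N : Type*} [TopologicalSpace N] [ChartedSpace H' N]

variable (I) in
/-- The coefficients of the metric in the chart around `p`. -/
noncomputable def metricCoord (p : M) (a b : E) (q : M) : ℝ :=
  inner ℝ (chartField I p a q) (chartField I p b q)

theorem inner_eq_metricCoord {p q : M} (hq : q ∈ (chartAt H p).source) (v w : TangentSpace I q) :
    (inner ℝ v w : ℝ) = metricCoord I p (chartCoord I p v) (chartCoord I p w) q := by
  rw [metricCoord, chartField_chartCoord hq, chartField_chartCoord hq]

theorem metricCoord_add_left {p q : M} (hq : q ∈ (chartAt H p).source) (a a' b : E) :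
    metricCoord I p (a + a') b q = metricCoord I p a b q + metricCoord I p a' b q := by
  rw [metricCoord, chartField_add hq, inner_add_left]; rfl

theorem metricCoord_smul_left {p q : M} (hq : q ∈ (chartAt H p).source) (c : ℝ) (a b : E) :
    metricCoord I p (c • a) b q = c * metricCoord I p a b q := by
  rw [metricCoord, chartField_smul hq, real_inner_smul_left]; rfl

theorem metricCoord_comm (p : M) (a b : E) : metricCoord I p a b = metricCoord I p b a := by
  funext q; exact real_inner_comm _ _

variable [IsContMDiffRiemannianBundle I ∞ E (fun x : M ↦ TangentSpace I x)]

theorem SmoothAlong.inner {f : N → M} {V W : ∀ y, TangentSpace I (f y)} {x : N}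
    (hV : SmoothAlong I I' f V x) (hW : SmoothAlong I I' f W x) :
    ContMDiffAt I' 𝓘(ℝ, ℝ) ∞ (fun y ↦ (inner ℝ (V y) (W y) : ℝ)) x :=
  ContMDiffAt.inner_bundle (F := E) (E := fun x : M ↦ TangentSpace I x) hV hW

theorem mdifferentiableAt_metricCoord (p : M) (a b : E) :
    MDifferentiableAt I 𝓘(ℝ, ℝ) (metricCoord I p a b) p :=
  ((smoothAlong_chartField p a).inner (smoothAlong_chartField p b)).mdifferentiableAt (by simp)

variable (I) in
/-- The derivatives at `p` of the coefficients of the metric in the chart around `p`. -/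
noncomputable def metricDeriv (p : M) (v : TangentSpace I p) (a b : E) : ℝ :=
  mvfderiv I (metricCoord I p a b) p v

theorem metricDeriv_comm (p : M) (v : TangentSpace I p) (a b : E) :
    metricDeriv I p v a b = metricDeriv I p v b a := by
  rw [metricDeriv, metricCoord_comm]; rfl

theorem mvfderiv_congr_of_eventuallyEq {G : Type*} [NormedAddCommGroup G] [NormedSpace ℝ G]
    {f g : N → G} {x : N} (h : f =ᶠ[𝓝 x] g) (u : TangentSpace I' x) :
    mvfderiv I' f x u = mvfderiv I' g x u := by
  change mfderiv I' 𝓘(ℝ, G) f x u = mfderiv I' 𝓘(ℝ, G) g x u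
  rw [h.mfderiv_eq]
  rfl

theorem eventually_mem_chart_self (p : M) : ∀ᶠ q in 𝓝 p, q ∈ (chartAt H p).source :=
  chart_source_mem_nhds H p

theorem metricDeriv_add_left (p : M) (v : TangentSpace I p) (a a' b : E) :
    metricDeriv I p v (a + a') b = metricDeriv I p v a b + metricDeriv I p v a' b := by
  have : metricCoord I p (a + a') b =ᶠ[𝓝 p]
      fun q ↦ metricCoord I p a b q + metricCoord I p a' b q := by
    filter_upwards [eventually_mem_chart_self (H := H) p] with q hq
    exact metricCoord_add_left hq _ _ _
  rw [metricDeriv, mvfderiv_congr_of_eventuallyEq this,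
    mvfderiv_fun_add (mdifferentiableAt_metricCoord p a b) (mdifferentiableAt_metricCoord p a' b)]
  rfl

theorem metricDeriv_smul_left (p : M) (v : TangentSpace I p) (c : ℝ) (a b : E) :
    metricDeriv I p v (c • a) b = c * metricDeriv I p v a b := by
  have : metricCoord I p (c • a) b =ᶠ[𝓝 p] fun q ↦ c * metricCoord I p a b q := by
    filter_upwards [eventually_mem_chart_self (H := H) p] with q hq
    exact metricCoord_smul_left hq _ _ _
  rw [metricDeriv, mvfderiv_congr_of_eventuallyEq this,
    mvfderiv_fun_mul mdifferentiableAt_const (mdifferentiableAt_metricCoord p a b), mvfderiv_const]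
  simp [metricDeriv]

theorem metricDeriv_add_right (p : M) (v : TangentSpace I p) (a b b' : E) :
    metricDeriv I p v a (b + b') = metricDeriv I p v a b + metricDeriv I p v a b' := by
  simp only [metricDeriv_comm p v a, metricDeriv_add_left]

theorem metricDeriv_smul_right (p : M) (v : TangentSpace I p) (c : ℝ) (a b : E) :
    metricDeriv I p v a (c • b) = c * metricDeriv I p v a b := by
  simp only [metricDeriv_comm p v a, metricDeriv_smul_left]

theorem metricDeriv_add (p : M) (v v' : TangentSpace I p) (a b : E) :
    metricDeriv I p (v + v') a b = metricDeriv I p v a b + metricDeriv I p v' a b := map_add _ _ _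

theorem metricDeriv_smul (p : M) (c : ℝ) (v : TangentSpace I p) (a b : E) :
    metricDeriv I p (c • v) a b = c * metricDeriv I p v a b := map_smul _ _ _

theorem christoffelFirst_eq (p : M) (v w z : TangentSpace I p) :
    christoffelFirst I p v w z =
      (metricDeriv I p v (chartCoord I p w) (chartCoord I p z)
        + metricDeriv I p w (chartCoord I p v) (chartCoord I p z)
        - metricDeriv I p z (chartCoord I p v) (chartCoord I p w)) / 2 := rfl

theorem christoffelFirst_comm (p : M) (v w z : TangentSpace I p) :
    christoffelFirst I p v w z = christoffelFirst I p w v z := by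
  rw [christoffelFirst_eq, christoffelFirst_eq, metricDeriv_comm p z]; ring

theorem christoffelFirst_add_right (p : M) (v w z z' : TangentSpace I p) :
    christoffelFirst I p v w (z + z') =
      christoffelFirst I p v w z + christoffelFirst I p v w z' := by
  simp only [christoffelFirst_eq, chartCoord_add (mem_chart_source H p), metricDeriv_add_right,
    metricDeriv_add]
  ring

theorem christoffelFirst_smul_right (p : M) (c : ℝ) (v w z : TangentSpace I p) :
    christoffelFirst I p v w (c • z) = c * christoffelFirst I p v w z := by
  simp only [christoffelFirst_eq, chartCoord_smul (mem_chart_source H p), metricDeriv_smul_right,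
    metricDeriv_smul]
  ring

theorem christoffelFirst_smul_left (p : M) (c : ℝ) (v w z : TangentSpace I p) :
    christoffelFirst I p (c • v) w z = c * christoffelFirst I p v w z := by
  simp only [christoffelFirst_eq, chartCoord_smul (mem_chart_source H p), metricDeriv_smul_left,
    metricDeriv_smul]
  ring

theorem christoffelFirst_add_christoffelFirst (p : M) (v w z : TangentSpace I p) :
    christoffelFirst I p v w z + christoffelFirst I p v z w =
      metricDeriv I p v (chartCoord I p w) (chartCoord I p z) := by
  rw [christoffelFirst_eq, christoffelFirst_eq, metricDeriv_comm p v (chartCoord I p z)]; ring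

variable [FiniteDimensional ℝ E]

theorem inner_christoffel (p : M) (v w z : TangentSpace I p) :
    (inner ℝ (christoffel I p v w) z : ℝ) = christoffelFirst I p v w z := by
  let L : TangentSpace I p →ₗ[ℝ] ℝ :=
    { toFun := christoffelFirst I p v w
      map_add' := christoffelFirst_add_right p v w
      map_smul' := fun c z ↦ christoffelFirst_smul_right p c v w z }
  change _ = L z
  rw [christoffel, sum_inner]
  conv_rhs => rw [← (stdOrthonormalBasis ℝ (TangentSpace I p)).sum_repr' z, map_sum]
  refine Finset.sum_congr rfl fun i _ ↦ ?_
  rw [real_inner_smul_left, map_smul, smul_eq_mul, mul_comm]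
  rfl

theorem eq_of_inner_eq {p : M} {v w : TangentSpace I p}
    (h : ∀ z : TangentSpace I p, (inner ℝ v z : ℝ) = inner ℝ w z) : v = w :=
  ext_inner_right ℝ h

theorem christoffel_comm (p : M) (v w : TangentSpace I p) :
    christoffel I p v w = christoffel I p w v :=
  eq_of_inner_eq fun z ↦ by rw [inner_christoffel, inner_christoffel, christoffelFirst_comm]

theorem christoffel_smul_left (p : M) (c : ℝ) (v w : TangentSpace I p) :
    christoffel I p (c • v) w = c • christoffel I p v w :=
  eq_of_inner_eq fun z ↦ by
    simp only [real_inner_smul_left, inner_christoffel, christoffelFirst_smul_left]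

theorem christoffel_smul_right (p : M) (c : ℝ) (v w : TangentSpace I p) :
    christoffel I p v (c • w) = c • christoffel I p v w := by
  rw [christoffel_comm, christoffel_smul_left, christoffel_comm]

theorem covAlong_smul_left (f : N → M) (V : ∀ y, TangentSpace I (f y)) (x : N)
    (c : ℝ) (u : TangentSpace I' x) :
    covAlong I I' f V x (c • u) = c • covAlong I I' f V x u := by
  rw [covAlong, map_smul, map_smul, christoffel_smul_left, chartField_smul (mem_chart_source H _),
    covAlong, smul_add]

/-- The covariant derivative only depends on the germs of the map and of the vector field. -/
theorem covAlong_congr {f f' : N → M} {V : ∀ y, TangentSpace I (f y)}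
    {V' : ∀ y, TangentSpace I (f' y)} {x : N}
    (h : ∀ᶠ y in 𝓝 x, f y = f' y ∧ (V y : E) = V' y) (u : TangentSpace I' x) :
    (covAlong I I' f V x u : E) = covAlong I I' f' V' x u := by
  have hf : f =ᶠ[𝓝 x] f' := h.mono fun y hy ↦ hy.1
  have key : ∀ (p : M) (hp : f x = p) (hp' : f' x = p) (w w' : TangentSpace I p)
      (d d' : TangentSpace I p) (e e' : E), w = w' → d = d' → e = e' →
      (chartField I p e p + christoffel I p d w : TangentSpace I p) =
        chartField I p e' p + christoffel I p d' w' := by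
    rintro p - - w w' d d' e e' rfl rfl rfl; rfl
  have hx := h.self_of_nhds
  have h1 : (fun y ↦ chartCoord I (f x) (V y)) =ᶠ[𝓝 x] fun y ↦ chartCoord I (f' x) (V' y) := by
    filter_upwards [h] with y hy
    rw [hx.1]
    unfold chartCoord
    rw [totalSpace_mk_congr hy.1 hy.2]
  have h2 : (mfderiv I' I f x u : E) = mfderiv I' I f' x u := by rw [hf.mfderiv_eq]; rfl
  unfold covAlong
  rw [mvfderiv_congr_of_eventuallyEq h1]
  have := hx.1
  generalize mvfderiv I' (fun y ↦ chartCoord I (f' x) (V' y)) x u = e at *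
  have hV := hx.2
  revert h2 hV
  generalize mfderiv I' I f x u = d
  generalize mfderiv I' I f' x u = d'
  generalize V x = w
  generalize V' x = w'
  revert d d' w w'
  rw [hx.1]
  intro d d' w w' h2 hV
  exact key _ hx.1 rfl w w' d d' e e hV h2 rfl

theorem covAlong_smul {f : N → M} {V : ∀ y, TangentSpace I (f y)} {x : N} {a : N → ℝ}
    (ha : MDifferentiableAt I' 𝓘(ℝ, ℝ) a x) (hV : DiffAlong I I' f V x) (u : TangentSpace I' x) :
    covAlong I I' f (fun y ↦ a y • V y) x u =
      mvfderiv I' a x u • V x + a x • covAlong I I' f V x u := by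
  rw [diffAlong_iff] at hV
  have h1 : (fun y ↦ chartCoord I (f x) (a y • V y)) =ᶠ[𝓝 x]
      fun y ↦ a y • chartCoord I (f x) (V y) := by
    filter_upwards [eventually_mem_chart (H := H) hV.1.continuousAt] with y hy
    exact chartCoord_smul hy _ _
  rw [covAlong, mvfderiv_congr_of_eventuallyEq h1, mvfderiv_fun_smul ha hV.2, covAlong,
    christoffel_smul_right]
  have hx := mem_chart_source H (f x)
  simp only [add_apply, smul_apply,
    ContinuousLinearMap.smulRight_apply, chartField_add hx, chartField_smul hx,
    chartField_chartCoord hx, smul_add]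
  abel

theorem covAlong_comp {E₂ : Type*} [NormedAddCommGroup E₂] [NormedSpace ℝ E₂]
    {H₂ : Type*} [TopologicalSpace H₂] {I₂ : ModelWithCorners ℝ E₂ H₂}
    {N₂ : Type*} [TopologicalSpace N₂] [ChartedSpace H₂ N₂]
    {f : N → M} {V : ∀ y, TangentSpace I (f y)} {i : N₂ → N} {x : N₂}
    (hV : DiffAlong I I' f V (i x)) (hi : MDifferentiableAt I₂ I' i x) (u : TangentSpace I₂ x) :
    covAlong I I₂ (fun y ↦ f (i y)) (fun y ↦ V (i y)) x u =
      covAlong I I' f V (i x) (mfderiv I₂ I' i x u) := by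
  rw [diffAlong_iff] at hV
  unfold covAlong
  have h1 : mvfderiv I₂ (fun y ↦ chartCoord I (f (i x)) (V (i y))) x u =
      mvfderiv I' (fun y ↦ chartCoord I (f (i x)) (V y)) (i x) (mfderiv I₂ I' i x u) := by
    change mfderiv I₂ 𝓘(ℝ, E) ((fun y ↦ chartCoord I (f (i x)) (V y)) ∘ i) x u = _
    rw [mfderiv_comp x hV.2 hi]; rfl
  have h2 : mfderiv I₂ I (fun y ↦ f (i y)) x u = mfderiv I' I f (i x) (mfderiv I₂ I' i x u) := by
    change mfderiv I₂ I (f ∘ i) x u = _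
    rw [mfderiv_comp x hV.1 hi]; rfl
  rw [h1, h2]

end Covariant

/-! ## Compatibility with the metric, symmetry, and the Koszul formula -/

section Koszul

variable {E : Type*} [NormedAddCommGroup E] [NormedSpace ℝ E] [FiniteDimensional ℝ E]
  {H : Type*} [TopologicalSpace H] {I : ModelWithCorners ℝ E H}
  {M : Type*} [TopologicalSpace M] [ChartedSpace H M] [IsManifold I ∞ M]
  [RiemannianBundle (fun x : M ↦ TangentSpace I x)]
  [IsContMDiffRiemannianBundle I ∞ E (fun x : M ↦ TangentSpace I x)]
  {E' : Type*} [NormedAddCommGroup E'] [NormedSpace ℝ E']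
  {H' : Type*} [TopologicalSpace H'] {I' : ModelWithCorners ℝ E' H'}
  {N : Type*} [TopologicalSpace N] [ChartedSpace H' N]

theorem mdifferentiableAt_sum_and_mvfderiv_sum {ι : Type*} (s : Finset ι) {g : ι → N → ℝ} {x : N}
    (hg : ∀ i ∈ s, MDifferentiableAt I' 𝓘(ℝ, ℝ) (g i) x) (u : TangentSpace I' x) :
    MDifferentiableAt I' 𝓘(ℝ, ℝ) (fun y ↦ ∑ i ∈ s, g i y) x ∧
      mvfderiv I' (fun y ↦ ∑ i ∈ s, g i y) x u = ∑ i ∈ s, mvfderiv I' (g i) x u := by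
  classical
  induction s using Finset.induction_on with
  | empty =>
    simp only [Finset.sum_empty]
    exact ⟨mdifferentiableAt_const, by rw [mvfderiv_const]; rfl⟩
  | insert a s ha ih =>
    obtain ⟨h1, h2⟩ := ih fun i hi ↦ hg i (Finset.mem_insert_of_mem hi)
    have h3 := hg a (Finset.mem_insert_self a s)
    simp only [Finset.sum_insert ha]
    refine ⟨h3.add h1, ?_⟩
    rw [mvfderiv_fun_add h3 h1, add_apply, h2]

variable (I) in
/-- The metric in the chart around `p` as a bilinear form. -/
noncomputable def metricForm (p : M) {q : M} (hq : q ∈ (chartAt H p).source) : E →ₗ[ℝ] E →ₗ[ℝ] ℝ :=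
  LinearMap.mk₂ ℝ (fun a b ↦ metricCoord I p a b q) (metricCoord_add_left hq)
    (metricCoord_smul_left hq)
    (fun a b b' ↦ by simp only [metricCoord_comm p a, metricCoord_add_left hq])
    (fun c a b ↦ by simp only [metricCoord_comm p a, metricCoord_smul_left hq, smul_eq_mul])

variable (I) in
/-- The derivative of the metric in the chart around `p` as a bilinear form. -/
noncomputable def metricDerivForm (p : M) (v : TangentSpace I p) : E →ₗ[ℝ] E →ₗ[ℝ] ℝ :=
  LinearMap.mk₂ ℝ (fun a b ↦ metricDeriv I p v a b) (metricDeriv_add_left p v)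
    (metricDeriv_smul_left p v) (metricDeriv_add_right p v) (metricDeriv_smul_right p v)

theorem bilin_eq_sum {ι : Type*} [Fintype ι] (b : Module.Basis ι ℝ E) (B : E →ₗ[ℝ] E →ₗ[ℝ] ℝ)
    (x y : E) : B x y = ∑ i, ∑ j, b.repr x i * (b.repr y j * B (b i) (b j)) := by
  conv_lhs => rw [← b.sum_repr x, ← b.sum_repr y]
  simp only [map_sum, LinearMap.sum_apply, map_smul, LinearMap.smul_apply, smul_eq_mul,
    Finset.mul_sum]
  rw [Finset.sum_comm]
  refine Finset.sum_congr rfl fun i _ ↦ Finset.sum_congr rfl fun j _ ↦ by ring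

/-- The covariant derivative along a map is compatible with the metric. -/
theorem mvfderiv_inner {f : N → M} {V W : ∀ y, TangentSpace I (f y)} {x : N}
    (hV : DiffAlong I I' f V x) (hW : DiffAlong I I' f W x) (u : TangentSpace I' x) :
    mvfderiv I' (fun y ↦ (inner ℝ (V y) (W y) : ℝ)) x u =
      inner ℝ (covAlong I I' f V x u) (W x) + inner ℝ (V x) (covAlong I I' f W x u) := by
  rw [diffAlong_iff] at hV hW
  have hp := mem_chart_source H (f x)
  let b := Module.finBasis ℝ E
  let v : N → E := fun y ↦ chartCoord I (f x) (V y)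
  let w : N → E := fun y ↦ chartCoord I (f x) (W y)
  have hv (i) : MDifferentiableAt I' 𝓘(ℝ, ℝ) (fun y ↦ b.repr (v y) i) x :=
    (b.coord i).toContinuousLinearMap.differentiableAt.mdifferentiableAt.comp x hV.2
  have hw (i) : MDifferentiableAt I' 𝓘(ℝ, ℝ) (fun y ↦ b.repr (w y) i) x :=
    (b.coord i).toContinuousLinearMap.differentiableAt.mdifferentiableAt.comp x hW.2
  have hdv (i) : mvfderiv I' (fun y ↦ b.repr (v y) i) x u = b.repr (mvfderiv I' v x u) i := by
    change mfderiv I' 𝓘(ℝ, ℝ) ((b.coord i).toContinuousLinearMap ∘ v) x u = _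
    rw [mfderiv_comp x (b.coord i).toContinuousLinearMap.differentiableAt.mdifferentiableAt hV.2,
      mfderiv_eq_fderiv, ContinuousLinearMap.fderiv]
    rfl
  have hdw (i) : mvfderiv I' (fun y ↦ b.repr (w y) i) x u = b.repr (mvfderiv I' w x u) i := by
    change mfderiv I' 𝓘(ℝ, ℝ) ((b.coord i).toContinuousLinearMap ∘ w) x u = _
    rw [mfderiv_comp x (b.coord i).toContinuousLinearMap.differentiableAt.mdifferentiableAt hW.2,
      mfderiv_eq_fderiv, ContinuousLinearMap.fderiv]
    rfl
  have hg (i j) : MDifferentiableAt I' 𝓘(ℝ, ℝ) (fun y ↦ metricCoord I (f x) (b i) (b j) (f y)) x :=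
    (mdifferentiableAt_metricCoord (f x) (b i) (b j)).comp x hV.1
  have hdg (i j) : mvfderiv I' (fun y ↦ metricCoord I (f x) (b i) (b j) (f y)) x u =
      metricDeriv I (f x) (mfderiv I' I f x u) (b i) (b j) := by
    change mfderiv I' 𝓘(ℝ, ℝ) (metricCoord I (f x) (b i) (b j) ∘ f) x u = _
    rw [mfderiv_comp x (mdifferentiableAt_metricCoord (f x) (b i) (b j)) hV.1]
    rfl
  have h1 : (fun y ↦ (inner ℝ (V y) (W y) : ℝ)) =ᶠ[𝓝 x] fun y ↦ ∑ i, ∑ j,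
      b.repr (v y) i * (b.repr (w y) j * metricCoord I (f x) (b i) (b j) (f y)) := by
    filter_upwards [eventually_mem_chart (H := H) hV.1.continuousAt] with y hy
    rw [inner_eq_metricCoord hy]
    exact bilin_eq_sum b (metricForm I (f x) hy) (v y) (w y)
  have hterm (i j) : MDifferentiableAt I' 𝓘(ℝ, ℝ) (fun y ↦
      b.repr (v y) i * (b.repr (w y) j * metricCoord I (f x) (b i) (b j) (f y))) x :=
    (hv i).mul ((hw j).mul (hg i j))
  have h2 : mvfderiv I' (fun y ↦ (inner ℝ (V y) (W y) : ℝ)) x u = ∑ i, ∑ j,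
      (b.repr (mvfderiv I' v x u) i * (b.repr (w x) j * metricCoord I (f x) (b i) (b j) (f x))
        + b.repr (v x) i * (b.repr (mvfderiv I' w x u) j *
            metricCoord I (f x) (b i) (b j) (f x))
        + b.repr (v x) i * (b.repr (w x) j *
            metricDeriv I (f x) (mfderiv I' I f x u) (b i) (b j))) := by
    rw [mvfderiv_congr_of_eventuallyEq h1, (mdifferentiableAt_sum_and_mvfderiv_sum _
      (fun i _ ↦ (mdifferentiableAt_sum_and_mvfderiv_sum _ (fun j _ ↦ hterm i j) u).1) u).2]
    refine Finset.sum_congr rfl fun i _ ↦ ?_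
    refine ((mdifferentiableAt_sum_and_mvfderiv_sum _ (fun j _ ↦ hterm i j) u).2).trans ?_
    refine Finset.sum_congr rfl fun j _ ↦ ?_
    refine (DFunLike.congr_fun (mvfderiv_fun_mul (hv i) ((hw j).mul (hg i j))) u).trans ?_
    have h3 := DFunLike.congr_fun (mvfderiv_fun_mul (hw j) (hg i j)) u
    simp only [add_apply, smul_apply, smul_eq_mul, hdv, hdw, hdg] at h3 ⊢
    erw [h3]
    simp only [Pi.mul_apply]
    ring
  have e1 := bilin_eq_sum b (metricForm I (f x) hp) (mvfderiv I' v x u) (w x)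
  have e2 := bilin_eq_sum b (metricForm I (f x) hp) (v x) (mvfderiv I' w x u)
  have e3 := bilin_eq_sum b (metricDerivForm I (f x) (mfderiv I' I f x u)) (v x) (w x)
  have e4 : (inner ℝ (covAlong I I' f V x u) (W x) : ℝ) =
      metricForm I (f x) hp (mvfderiv I' v x u) (w x)
        + christoffelFirst I (f x) (mfderiv I' I f x u) (V x) (W x) := by
    rw [covAlong, inner_add_left, inner_christoffel, inner_eq_metricCoord hp,
      chartCoord_chartField hp]
    rfl
  have e5 : (inner ℝ (V x) (covAlong I I' f W x u) : ℝ) =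
      metricForm I (f x) hp (v x) (mvfderiv I' w x u)
        + christoffelFirst I (f x) (mfderiv I' I f x u) (W x) (V x) := by
    rw [real_inner_comm, covAlong, inner_add_left, inner_christoffel, inner_eq_metricCoord hp,
      chartCoord_chartField hp, metricCoord_comm]
    rfl
  have e6 : christoffelFirst I (f x) (mfderiv I' I f x u) (V x) (W x)
      + christoffelFirst I (f x) (mfderiv I' I f x u) (W x) (V x) =
        metricDerivForm I (f x) (mfderiv I' I f x u) (v x) (w x) :=
    christoffelFirst_add_christoffelFirst _ _ _ _
  rw [e4, e5, h2]
  calc _ = metricForm I (f x) hp (mvfderiv I' v x u) (w x)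
        + metricForm I (f x) hp (v x) (mvfderiv I' w x u)
        + metricDerivForm I (f x) (mfderiv I' I f x u) (v x) (w x) := by
        rw [e1, e2, e3]
        simp only [Finset.sum_add_distrib]
        rfl
    _ = _ := by rw [← e6]; ring

theorem mvfderiv_eq_fderiv {G : Type*} [NormedAddCommGroup G] [NormedSpace ℝ G] (g : E' → G)
    (x u : E') : mvfderiv 𝓘(ℝ, E') g x u = fderiv ℝ g x u := by
  rw [← mfderiv_eq_fderiv]; rfl

theorem fderiv_inner {f : E' → M} {V W : ∀ y, TangentSpace I (f y)} {x : E'}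
    (hV : DiffAlong I 𝓘(ℝ, E') f V x) (hW : DiffAlong I 𝓘(ℝ, E') f W x) (u : E') :
    fderiv ℝ (fun y ↦ (inner ℝ (V y) (W y) : ℝ)) x u =
      inner ℝ (covAlong I 𝓘(ℝ, E') f V x u) (W x)
        + inner ℝ (V x) (covAlong I 𝓘(ℝ, E') f W x u) := by
  rw [← mvfderiv_eq_fderiv]
  exact mvfderiv_inner hV hW u

/-- The Levi-Civita connection is symmetric: second covariant derivatives of a map commute. -/
theorem covAlong_mfderiv_comm {F : E' → M} {x : E'} (hF : ContMDiffAt 𝓘(ℝ, E') I ∞ F x)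
    (u v : E') :
    covAlong I 𝓘(ℝ, E') F (fun y ↦ mfderiv 𝓘(ℝ, E') I F y v) x u =
      covAlong I 𝓘(ℝ, E') F (fun y ↦ mfderiv 𝓘(ℝ, E') I F y u) x v := by
  have hc := contDiffAt_extChartAt_comp hF (mem_chart_source H (F x))
  have hd : DifferentiableAt ℝ (fderiv ℝ (extChartAt I (F x) ∘ F)) x :=
    (hc.fderiv_right (m := 1) (by norm_cast)).differentiableAt (by simp)
  have key (u v : E') : mvfderiv 𝓘(ℝ, E')
      (fun y ↦ chartCoord I (F x) (mfderiv 𝓘(ℝ, E') I F y v)) x u =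
        fderiv ℝ (fderiv ℝ (extChartAt I (F x) ∘ F)) x u v := by
    refine (mvfderiv_congr_of_eventuallyEq (eventually_chartCoord_mfderiv hF v) _).trans ?_
    refine (mvfderiv_eq_fderiv _ _ _).trans ?_
    rw [fderiv_clm_apply hd (differentiableAt_const v)]
    simp
  have hs : IsSymmSndFDerivAt ℝ (extChartAt I (F x) ∘ F) x :=
    hc.isSymmSndFDerivAt (by simp only [minSmoothness_of_isRCLikeNormedField]; norm_cast)
  unfold covAlong
  rw [christoffel_comm]
  congr 2
  exact (key u v).trans ((hs u v).trans (key v u).symm)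

variable (I) in
/-- The pull-back of the metric under a map from a vector space. -/
noncomputable def pullMetric (F : E' → M) (u v : E') (x : E') : ℝ :=
  inner ℝ (mfderiv 𝓘(ℝ, E') I F x u) (mfderiv 𝓘(ℝ, E') I F x v)

theorem contDiffAt_pullMetric {F : E' → M} {x : E'} (hF : ContMDiffAt 𝓘(ℝ, E') I ∞ F x)
    (u v : E') : ContDiffAt ℝ ∞ (pullMetric I F u v) x :=
  ((smoothAlong_mfderiv hF u).inner (smoothAlong_mfderiv hF v)).contDiffAt

/-- The Koszul formula along a map. -/
theorem inner_covAlong_mfderiv {F : E' → M} {x : E'} (hF : ContMDiffAt 𝓘(ℝ, E') I ∞ F x)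
    (u v w : E') :
    (inner ℝ (covAlong I 𝓘(ℝ, E') F (fun y ↦ mfderiv 𝓘(ℝ, E') I F y v) x u)
      (mfderiv 𝓘(ℝ, E') I F x w) : ℝ) =
      (fderiv ℝ (pullMetric I F v w) x u + fderiv ℝ (pullMetric I F u w) x v
        - fderiv ℝ (pullMetric I F u v) x w) / 2 := by
  have hs (a : E') := (smoothAlong_mfderiv hF a).diffAlong
  have key (a b c : E') : fderiv ℝ (pullMetric I F a b) x c =
      inner ℝ (covAlong I 𝓘(ℝ, E') F (fun y ↦ mfderiv 𝓘(ℝ, E') I F y a) x c)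
        (mfderiv 𝓘(ℝ, E') I F x b) +
      inner ℝ (covAlong I 𝓘(ℝ, E') F (fun y ↦ mfderiv 𝓘(ℝ, E') I F y b) x c)
        (mfderiv 𝓘(ℝ, E') I F x a) := by
    rw [real_inner_comm (mfderiv 𝓘(ℝ, E') I F x a)]
    exact fderiv_inner (hs a) (hs b) c
  rw [key, key, key, covAlong_mfderiv_comm hF v u, covAlong_mfderiv_comm hF w u,
    covAlong_mfderiv_comm hF w v]
  ring

end Koszul

/-! ## Extending a map in the direction of a vector field along it -/

section Variation

variable {E : Type*} [NormedAddCommGroup E] [NormedSpace ℝ E]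
  {H : Type*} [TopologicalSpace H] {I : ModelWithCorners ℝ E H}
  {M : Type*} [TopologicalSpace M] [ChartedSpace H M] [IsManifold I ∞ M]
  {E' : Type*} [NormedAddCommGroup E'] [NormedSpace ℝ E']
  {H' : Type*} [TopologicalSpace H'] {I' : ModelWithCorners ℝ E' H'}
  {N : Type*} [TopologicalSpace N] [ChartedSpace H' N]

theorem SmoothAlong.chartCoord {f : N → M} {V : ∀ y, TangentSpace I (f y)} {x : N}
    (hV : SmoothAlong I I' f V x) {p : M} (hp : f x ∈ (chartAt H p).source) :
    ContMDiffAt I' 𝓘(ℝ, E) ∞ (fun y ↦ chartCoord I p (V y)) x :=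
  ((Trivialization.contMDiffAt_iff (n := ∞) (IB := I) (IM := I')
    (e := trivializationAt E (TangentSpace I : M → Type _) p)
    (f := fun y ↦ (⟨f y, V y⟩ : TangentBundle I M))
    (by rw [Trivialization.mem_source]; simpa using hp)).1 hV).2

theorem eq_of_chartCoord_eq {p b b' : M} (hb : b = b') (hp : b ∈ (chartAt H p).source)
    {v : TangentSpace I b} {v' : TangentSpace I b'}
    (h : HopfCylinder.chartCoord I p v = HopfCylinder.chartCoord I p v') : (v : E) = v' := by
  subst hb
  have := congrArg (fun e ↦ chartField I p e b) h
  simpa only [chartField_chartCoord hp] using this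

theorem mfderiv_comp_inl {G : E' × ℝ → M} {y : E'}
    (hG : MDifferentiableAt 𝓘(ℝ, E' × ℝ) I G (y, 0)) (u : E') :
    (mfderiv 𝓘(ℝ, E') I (fun z ↦ G (z, 0)) y u : E) = mfderiv 𝓘(ℝ, E' × ℝ) I G (y, 0) (u, 0) := by
  have hi : HasFDerivAt (fun z : E' ↦ (z, (0 : ℝ))) (ContinuousLinearMap.inl ℝ E' ℝ) y :=
    (ContinuousLinearMap.inl ℝ E' ℝ).hasFDerivAt
  change (mfderiv 𝓘(ℝ, E') I (G ∘ fun z ↦ (z, (0 : ℝ))) y u : E) = _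
  rw [mfderiv_comp y hG hi.differentiableAt.mdifferentiableAt, mfderiv_eq_fderiv, hi.fderiv]
  rfl

theorem exists_variation [I.Boundaryless] {F : E' → M} {W : ∀ y, TangentSpace I (F y)} {x : E'}
    (hW : ∀ᶠ y in 𝓝 x, SmoothAlong I 𝓘(ℝ, E') F W y) :
    ∃ G : E' × ℝ → M, ∀ᶠ y in 𝓝 x, ContMDiffAt 𝓘(ℝ, E' × ℝ) I ∞ G (y, 0) ∧ G (y, 0) = F y ∧
      (∀ u, (mfderiv 𝓘(ℝ, E' × ℝ) I G (y, 0) (u, 0) : E) = mfderiv 𝓘(ℝ, E') I F y u) ∧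
      (mfderiv 𝓘(ℝ, E' × ℝ) I G (y, 0) (0, 1) : E) = W y := by
  set p := F x with hp
  let a : E' → E := fun y ↦ extChartAt I p (F y)
  let c : E' → E := fun y ↦ chartCoord I p (W y)
  let G : E' × ℝ → M := fun z ↦ (extChartAt I p).symm (a z.1 + z.2 • c z.1)
  have hmem : ∀ᶠ y in 𝓝 x, F y ∈ (chartAt H p).source :=
    eventually_mem_chart (hW.self_of_nhds.base.continuousAt)
  have hGF (y : E') (hy : F y ∈ (chartAt H p).source) : G (y, 0) = F y := by
    simp only [G, a, zero_smul, add_zero]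
    exact (extChartAt I p).left_inv (by simpa using hy)
  refine ⟨G, ?_⟩
  filter_upwards [hW, hmem, hmem.eventually_nhds] with y hy hys hyn
  have ha : ContDiffAt ℝ ∞ a y := contDiffAt_extChartAt_comp hy.base hys
  have hc : ContDiffAt ℝ ∞ c y := (hy.chartCoord hys).contDiffAt
  have hK : ContDiffAt ℝ ∞ (fun z : E' × ℝ ↦ a z.1 + z.2 • c z.1) (y, 0) :=
    (ha.comp (y, (0 : ℝ)) contDiffAt_fst).add
      (contDiffAt_snd.smul (hc.comp (y, (0 : ℝ)) contDiffAt_fst))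
  have hyt : a y ∈ (extChartAt I p).target := (extChartAt I p).map_source (by simpa using hys)
  have hG : ContMDiffAt 𝓘(ℝ, E' × ℝ) I ∞ G (y, 0) := by
    refine ContMDiffAt.comp (I' := 𝓘(ℝ, E)) (y, (0 : ℝ)) ?_ hK.contMDiffAt
    have : a (y, (0 : ℝ)).1 + (y, (0 : ℝ)).2 • c (y, (0 : ℝ)).1 = a y := by simp
    rw [this]
    exact (contMDiffOn_extChartAt_symm p).contMDiffAt
      ((isOpen_extChartAt_target p).mem_nhds hyt)
  have hGd : MDifferentiableAt 𝓘(ℝ, E' × ℝ) I G (y, 0) := hG.mdifferentiableAt (by simp)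
  refine ⟨hG, hGF y hys, fun u ↦ ?_, ?_⟩
  · rw [← mfderiv_comp_inl hGd]
    have : (fun z ↦ G (z, 0)) =ᶠ[𝓝 y] F := hyn.mono hGF
    rw [this.mfderiv_eq]
    rfl
  · refine eq_of_chartCoord_eq (hGF y hys) ((hGF y hys).symm ▸ hys) ?_
    rw [chartCoord_mfderiv hGd ((hGF y hys).symm ▸ hys)]
    have hev : extChartAt I p ∘ G =ᶠ[𝓝 (y, 0)] fun z : E' × ℝ ↦ a z.1 + z.2 • c z.1 := by
      have : ∀ᶠ z in 𝓝 (y, (0 : ℝ)), a z.1 + z.2 • c z.1 ∈ (extChartAt I p).target :=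
        hK.continuousAt.preimage_mem_nhds
          ((isOpen_extChartAt_target p).mem_nhds (by simpa using hyt))
      filter_upwards [this] with z hz
      exact (extChartAt I p).right_inv hz
    rw [hev.fderiv_eq]
    have h1 : HasFDerivAt (fun z : E' × ℝ ↦ a z.1 + z.2 • c z.1) _ (y, (0 : ℝ)) :=
      (hK.differentiableAt (by simp)).hasFDerivAt
    have h2 : HasDerivAt (fun r : ℝ ↦ (y, r)) ((0 : E'), (1 : ℝ)) 0 :=
      (hasDerivAt_const _ _).prodMk (hasDerivAt_id _)
    have h3 := h1.comp_hasDerivAt (0 : ℝ) h2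
    have h4 : HasDerivAt (fun r : ℝ ↦ a y + r • c y) (c y) 0 := by
      simpa using ((hasDerivAt_id (0 : ℝ)).smul_const (c y)).const_add (a y)
    exact h3.unique h4

variable [RiemannianBundle (fun x : M ↦ TangentSpace I x)]

theorem inner_congr {b b' : M} (h : b = b') {v w : TangentSpace I b} {v' w' : TangentSpace I b'}
    (hv : (v : E) = v') (hw : (w : E) = w') : (inner ℝ v w : ℝ) = inner ℝ v' w' := by
  subst h; cases hv; cases hw; rfl

variable [FiniteDimensional ℝ E]
  [IsContMDiffRiemannianBundle I ∞ E (fun x : M ↦ TangentSpace I x)]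

theorem covAlong_variation {F : E' → M} {G : E' × ℝ → M} {y : E'}
    (hGs : ContMDiffAt 𝓘(ℝ, E' × ℝ) I ∞ G (y, 0))
    (hGF : ∀ᶠ z in 𝓝 y, G (z, 0) = F z ∧
      ∀ u, (mfderiv 𝓘(ℝ, E' × ℝ) I G (z, 0) (u, 0) : E) = mfderiv 𝓘(ℝ, E') I F z u) (u v : E') :
    (covAlong I 𝓘(ℝ, E') F (fun z ↦ mfderiv 𝓘(ℝ, E') I F z v) y u : E) =
      covAlong I 𝓘(ℝ, E' × ℝ) G (fun z ↦ mfderiv 𝓘(ℝ, E' × ℝ) I G z (v, 0)) (y, 0) (u, 0) := by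
  have hi : HasFDerivAt (fun z : E' ↦ (z, (0 : ℝ))) (ContinuousLinearMap.inl ℝ E' ℝ) y :=
    (ContinuousLinearMap.inl ℝ E' ℝ).hasFDerivAt
  have h1 := covAlong_congr (I := I) (I' := 𝓘(ℝ, E')) (f := F)
    (f' := fun z ↦ G (z, 0)) (V := fun z ↦ mfderiv 𝓘(ℝ, E') I F z v)
    (V' := fun z ↦ mfderiv 𝓘(ℝ, E' × ℝ) I G (z, 0) (v, 0))
    (hGF.mono fun z hz ↦ ⟨hz.1.symm, (hz.2 v).symm⟩) u
  have h2 := covAlong_comp (I := I) (I' := 𝓘(ℝ, E' × ℝ)) (I₂ := 𝓘(ℝ, E')) (f := G)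
    (V := fun z ↦ mfderiv 𝓘(ℝ, E' × ℝ) I G z (v, 0)) (i := fun z : E' ↦ (z, (0 : ℝ))) (x := y)
    (smoothAlong_mfderiv hGs _).diffAlong hi.differentiableAt.mdifferentiableAt u
  rw [mfderiv_eq_fderiv, hi.fderiv] at h2
  exact h1.trans h2

/-- For a smooth map `F` and a smooth vector field `W` along `F`, the function `⟨∇_u (∂_v F), W⟩`
is smooth. -/
theorem contDiffAt_inner_covAlong [I.Boundaryless] {F : E' → M} {W : ∀ y, TangentSpace I (F y)}
    {x : E'} (hW : ∀ᶠ y in 𝓝 x, SmoothAlong I 𝓘(ℝ, E') F W y) (u v : E') :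
    ContDiffAt ℝ ∞ (fun y ↦ (inner ℝ
      (covAlong I 𝓘(ℝ, E') F (fun z ↦ mfderiv 𝓘(ℝ, E') I F z v) y u) (W y) : ℝ)) x := by
  obtain ⟨G, hG⟩ := exists_variation hW
  have hx := hG.self_of_nhds.1
  have hpm (a b c : E' × ℝ) :
      ContDiffAt ℝ ∞ (fun y : E' ↦ fderiv ℝ (pullMetric I G a b) (y, 0) c) x := by
    have h1 : ContDiffAt ℝ ∞ (fun z ↦ fderiv ℝ (pullMetric I G a b) z c) (x, 0) :=
      ((contDiffAt_pullMetric hx a b).fderiv_right (m := ∞) (by simp)).clm_apply contDiffAt_const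
    exact h1.comp x (contDiffAt_id.prodMk contDiffAt_const)
  refine (((hpm (v, 0) (0, 1) (u, 0)).add (hpm (u, 0) (0, 1) (v, 0))).sub
    (hpm (u, 0) (v, 0) (0, 1))).div_const 2 |>.congr_of_eventuallyEq ?_
  filter_upwards [hG.eventually_nhds] with y hy
  have hy' := hy.self_of_nhds
  rw [inner_congr hy'.2.1.symm (covAlong_variation hy'.1
    (hy.mono fun z hz ↦ ⟨hz.2.1, hz.2.2.1⟩) u v) hy'.2.2.2.symm]
  exact inner_covAlong_mfderiv hy'.1 (u, 0) (v, 0) (0, 1)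

end Variation

/-! ## Sasaki structures -/

section Sasaki

variable {M : Type*} [TopologicalSpace M] [ChartedSpace R3 M] [IsManifold (𝓡 3) ∞ M]
  [RiemannianBundle (fun x : M ↦ TangentSpace (𝓡 3) x)]
  [IsContMDiffRiemannianBundle (𝓡 3) ∞ R3 (fun x : M ↦ TangentSpace (𝓡 3) x)]
  {E' : Type*} [NormedAddCommGroup E'] [NormedSpace ℝ E']

namespace ContactMetricStructure

variable (S : ContactMetricStructure M)

theorem inner_ξ_ξ (p : M) : (inner ℝ (S.ξ p) (S.ξ p) : ℝ) = 1 := by rw [S.inner_ξ, S.η_ξ]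

theorem φ_ξ (p : M) : S.φ p (S.ξ p) = 0 := by
  have := S.inner_φ_φ p (S.ξ p) (S.ξ p)
  rw [S.inner_ξ_ξ, S.η_ξ, mul_one, sub_self] at this
  exact inner_self_eq_zero.1 this

theorem η_φ (p : M) (v : TangentSpace (𝓡 3) p) : S.η p (S.φ p v) = 0 := by
  have h1 := S.φ_sq p (S.φ p v)
  have h2 : S.φ p (S.φ p (S.φ p v)) = -S.φ p v := by
    rw [S.φ_sq p v, map_add, map_neg, map_smul, S.φ_ξ, smul_zero, add_zero]
  rw [h2] at h1
  have h3 : S.η p (S.φ p v) • S.ξ p = 0 := by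
    have := congrArg (fun w ↦ S.φ p v + w) h1
    simpa using this.symm
  have h4 := congrArg (S.η p) h3
  rwa [map_smul, S.η_ξ, smul_eq_mul, mul_one, map_zero] at h4

theorem inner_φ_left (p : M) (v w : TangentSpace (𝓡 3) p) :
    (inner ℝ (S.φ p v) w : ℝ) = -inner ℝ v (S.φ p w) := by
  have h := S.inner_φ_φ p v (S.φ p w)
  rw [S.φ_sq p w, S.η_φ, mul_zero, sub_zero, inner_add_right, inner_neg_right,
    real_inner_smul_right, real_inner_comm (S.ξ p), S.inner_ξ, S.η_φ, mul_zero, add_zero] at h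
  linarith

theorem inner_φ_self (p : M) (v : TangentSpace (𝓡 3) p) :
    (inner ℝ v (S.φ p v) : ℝ) = 0 := by
  have := S.inner_φ_left p v v
  rw [real_inner_comm] at this
  linarith

theorem inner_ξ_right (p : M) (v : TangentSpace (𝓡 3) p) :
    (inner ℝ v (S.ξ p) : ℝ) = S.η p v := by rw [real_inner_comm, S.inner_ξ]

theorem smoothAlong_ξ {F : E' → M} {x : E'} (hF : ContMDiffAt 𝓘(ℝ, E') (𝓡 3) ∞ F x) :
    SmoothAlong (𝓡 3) 𝓘(ℝ, E') F (fun y ↦ S.ξ (F y)) x :=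
  S.smooth_ξ.contMDiffAt.comp x hF

theorem smoothAlong_φ {F : E' → M} {V : ∀ y, TangentSpace (𝓡 3) (F y)} {x : E'}
    (hV : SmoothAlong (𝓡 3) 𝓘(ℝ, E') F V x) :
    SmoothAlong (𝓡 3) 𝓘(ℝ, E') F (fun y ↦ S.φ (F y) (V y)) x :=
  ContMDiffAt.clm_bundle_apply (F₁ := R3) (F₂ := R3) (E₁ := fun q : M ↦ TangentSpace (𝓡 3) q)
    (E₂ := fun q : M ↦ TangentSpace (𝓡 3) q) (S.smooth_φ.contMDiffAt.comp x hV.base) hV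

theorem leviCivita_ξ (hS : S.IsSasaki) (p : M) (v : TangentSpace (𝓡 3) p) :
    leviCivita (𝓡 3) S.ξ p v = -S.φ p v := by
  have hd : DiffAlong (𝓡 3) (𝓡 3) (fun q : M ↦ q) S.ξ p :=
    S.smooth_ξ.contMDiffAt.mdifferentiableAt (by simp)
  have h := hS p v S.ξ hd
  have h0 : leviCivita (𝓡 3) (fun q ↦ S.φ q (S.ξ q)) p v = 0 := by
    have h1 : (fun q ↦ S.φ q (S.ξ q)) = fun q ↦ (0 : ℝ) • S.ξ q := by
      funext q; rw [S.φ_ξ, zero_smul]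
    have h2 := covAlong_smul (a := fun _ : M ↦ (0 : ℝ)) mdifferentiableAt_const hd v
    rw [mvfderiv_const, zero_smul, add_zero] at h2
    rw [h1]
    exact h2.trans (by simp)
  have h3 : (inner ℝ (S.ξ p) (leviCivita (𝓡 3) S.ξ p v) : ℝ) = 0 := by
    have h4 := mvfderiv_inner hd hd v
    have h5 : (fun q ↦ (inner ℝ (S.ξ q) (S.ξ q) : ℝ)) = fun _ ↦ 1 := by
      funext q; exact S.inner_ξ_ξ q
    have h6 : (inner ℝ (covAlong (𝓡 3) (𝓡 3) (fun q : M ↦ q) S.ξ p v) (S.ξ p) : ℝ) =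
      inner ℝ (S.ξ p) (covAlong (𝓡 3) (𝓡 3) (fun q : M ↦ q) S.ξ p v) := real_inner_comm _ _
    have h7 : mvfderiv (𝓡 3) (fun q ↦ (inner ℝ (S.ξ q) (S.ξ q) : ℝ)) p v = 0 := by
      rw [h5, mvfderiv_const]; rfl
    have h8 := h7.symm.trans h4
    rw [h6] at h8
    change (inner ℝ (S.ξ p) (covAlong (𝓡 3) (𝓡 3) (fun q : M ↦ q) S.ξ p v) : ℝ) = 0
    linarith
  rw [h0, zero_sub, S.η_ξ, one_smul, S.inner_ξ_right] at h
  have h9 := congrArg (S.φ p) h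
  rw [map_neg, S.φ_sq, map_sub, map_smul, S.φ_ξ, smul_zero, zero_sub, ← S.inner_ξ, h3, zero_smul,
    add_zero, neg_neg] at h9
  exact h9

theorem covAlong_ξ (hS : S.IsSasaki) {F : E' → M} {x : E'}
    (hF : MDifferentiableAt 𝓘(ℝ, E') (𝓡 3) F x) (u : E') :
    covAlong (𝓡 3) 𝓘(ℝ, E') F (fun y ↦ S.ξ (F y)) x u =
      -S.φ (F x) (mfderiv 𝓘(ℝ, E') (𝓡 3) F x u) := by
  have hd : DiffAlong (𝓡 3) (𝓡 3) (fun q : M ↦ q) S.ξ (F x) :=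
    S.smooth_ξ.contMDiffAt.mdifferentiableAt (by simp)
  rw [← S.leviCivita_ξ hS]
  exact covAlong_comp hd hF u

/-- The value of the contact form on a partial derivative of a map. -/
noncomputable def ηComp (F : E' → M) (u : E') (y : E') : ℝ := S.η (F y) (mfderiv 𝓘(ℝ, E') (𝓡 3) F y u)

theorem ηComp_eq_inner (F : E' → M) (u : E') :
    S.ηComp F u = fun y ↦ (inner ℝ (S.ξ (F y)) (mfderiv 𝓘(ℝ, E') (𝓡 3) F y u) : ℝ) := by
  funext y; exact (S.inner_ξ _ _).symm

theorem contDiffAt_ηComp {F : E' → M} {x : E'} (hF : ContMDiffAt 𝓘(ℝ, E') (𝓡 3) ∞ F x) (u : E') :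
    ContDiffAt ℝ ∞ (S.ηComp F u) x := by
  rw [ηComp_eq_inner]
  exact ((S.smoothAlong_ξ hF).inner (smoothAlong_mfderiv hF u)).contDiffAt

/-- The formula for the exterior derivative of the contact form, along a map. -/
theorem fderiv_ηComp_sub (hS : S.IsSasaki) {F : E' → M} {x : E'}
    (hF : ContMDiffAt 𝓘(ℝ, E') (𝓡 3) ∞ F x) (u v : E') :
    fderiv ℝ (S.ηComp F v) x u - fderiv ℝ (S.ηComp F u) x v =
      2 * inner ℝ (mfderiv 𝓘(ℝ, E') (𝓡 3) F x u)
        (S.φ (F x) (mfderiv 𝓘(ℝ, E') (𝓡 3) F x v)) := by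
  have key (a b : E') : fderiv ℝ (S.ηComp F a) x b =
      inner ℝ (-S.φ (F x) (mfderiv 𝓘(ℝ, E') (𝓡 3) F x b)) (mfderiv 𝓘(ℝ, E') (𝓡 3) F x a)
      + inner ℝ (S.ξ (F x))
        (covAlong (𝓡 3) 𝓘(ℝ, E') F (fun y ↦ mfderiv 𝓘(ℝ, E') (𝓡 3) F y a) x b) := by
    rw [ηComp_eq_inner, ← S.covAlong_ξ hS (hF.mdifferentiableAt (by simp))]
    exact fderiv_inner (S.smoothAlong_ξ hF).diffAlong (smoothAlong_mfderiv hF a).diffAlong b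
  rw [key, key, covAlong_mfderiv_comm hF v u, inner_neg_left, inner_neg_left, S.inner_φ_left,
    real_inner_comm (mfderiv 𝓘(ℝ, E') (𝓡 3) F x u)]
  ring

theorem eq_frame_sum {p : M} {v : TangentSpace (𝓡 3) p} (h0 : S.η p v = 0)
    (h1 : (inner ℝ v v : ℝ) = 1) (w : TangentSpace (𝓡 3) p) :
    w = (inner ℝ w v : ℝ) • v + (inner ℝ w (S.φ p v) : ℝ) • S.φ p v + S.η p w • S.ξ p := by
  have hφ : (inner ℝ (S.φ p v) (S.φ p v) : ℝ) = 1 := by rw [S.inner_φ_φ, h1, h0]; simp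
  have hon : Orthonormal ℝ ![v, S.φ p v, S.ξ p] := by
    rw [orthonormal_iff_ite]
    intro i j
    fin_cases i <;> fin_cases j <;>
      simp [h0, h1, hφ, S.inner_φ_self, S.inner_φ_left, S.inner_ξ, S.inner_ξ_right, S.η_φ, S.η_ξ,
        -inner_self_eq_norm_sq_to_K, S.φ_ξ]
  have hcard : Fintype.card (Fin 3) = Module.finrank ℝ (TangentSpace (𝓡 3) p) := by
    change _ = Module.finrank ℝ R3
    simp
  have hsp : ⊤ ≤ Submodule.span ℝ (Set.range ![v, S.φ p v, S.ξ p]) :=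
    (hon.linearIndependent.span_eq_top_of_card_eq_finrank' hcard).ge
  have h := (OrthonormalBasis.mk hon hsp).sum_repr' w
  rw [Fin.sum_univ_three] at h
  simp only [OrthonormalBasis.coe_mk, Matrix.cons_val_zero, Matrix.cons_val_one,
    Matrix.cons_val] at h
  rw [real_inner_comm v w, real_inner_comm (S.φ p v) w, ← S.inner_ξ]
  exact h.symm

end ContactMetricStructure

theorem eq_frame_sum₂ {B : Type*} [TopologicalSpace B] [ChartedSpace R2 B] [IsManifold (𝓡 2) ∞ B]
    [RiemannianBundle (fun x : B ↦ TangentSpace (𝓡 2) x)] {b : B} {v n : TangentSpace (𝓡 2) b}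
    (hv : (inner ℝ v v : ℝ) = 1) (hn : (inner ℝ n n : ℝ) = 1) (hvn : (inner ℝ v n : ℝ) = 0)
    (w : TangentSpace (𝓡 2) b) :
    w = (inner ℝ w v : ℝ) • v + (inner ℝ w n : ℝ) • n := by
  have hnv : (inner ℝ n v : ℝ) = 0 := by rw [real_inner_comm, hvn]
  have hon : Orthonormal ℝ ![v, n] := by
    rw [orthonormal_iff_ite]
    intro i j
    fin_cases i <;> fin_cases j <;>
      simp [hv, hn, hvn, hnv, -inner_self_eq_norm_sq_to_K]
  have hcard : Fintype.card (Fin 2) = Module.finrank ℝ (TangentSpace (𝓡 2) b) := by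
    change _ = Module.finrank ℝ R2
    simp
  have hsp : ⊤ ≤ Submodule.span ℝ (Set.range ![v, n]) :=
    (hon.linearIndependent.span_eq_top_of_card_eq_finrank' hcard).ge
  have h := (OrthonormalBasis.mk hon hsp).sum_repr' w
  rw [Fin.sum_univ_two] at h
  simp only [OrthonormalBasis.coe_mk, Matrix.cons_val_zero, Matrix.cons_val_one] at h
  rw [real_inner_comm v w, real_inner_comm n w]
  exact h.symm

end Sasaki

/-! ## The Boothby-Wang fibering -/

section Fibering

variable {M : Type*} [TopologicalSpace M] [ChartedSpace R3 M] [IsManifold (𝓡 3) ∞ M]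
  [RiemannianBundle (fun x : M ↦ TangentSpace (𝓡 3) x)]
  [IsContMDiffRiemannianBundle (𝓡 3) ∞ R3 (fun x : M ↦ TangentSpace (𝓡 3) x)]
  {B : Type*} [TopologicalSpace B] [ChartedSpace R2 B] [IsManifold (𝓡 2) ∞ B]
  [RiemannianBundle (fun x : B ↦ TangentSpace (𝓡 2) x)]
  {E' : Type*} [NormedAddCommGroup E'] [NormedSpace ℝ E']

namespace ContactMetricStructure

variable {S : ContactMetricStructure M} {θ : ℝ → M → M} {pr : M → B}

theorem IsBoothbyWangFibering.pr_flow (hpr : S.IsBoothbyWangFibering θ pr) (t : ℝ) (p : M) :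
    pr (θ t p) = pr p := ((hpr.fibre_iff p (θ t p)).2 ⟨t, rfl⟩).symm

theorem IsBoothbyWangFibering.mdifferentiableAt (hpr : S.IsBoothbyWangFibering θ pr) (p : M) :
    MDifferentiableAt (𝓡 3) (𝓡 2) pr p := hpr.smooth.mdifferentiableAt (by simp)

theorem IsBoothbyWangFibering.mfderiv_ξ (hθ : S.IsRegularFlow θ)
    (hpr : S.IsBoothbyWangFibering θ pr) (p : M) : mfderiv (𝓡 3) (𝓡 2) pr p (S.ξ p) = 0 := by
  have key (t : ℝ) : mfderiv (𝓡 3) (𝓡 2) pr (θ t p) (S.ξ (θ t p)) = 0 := by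
    have h1 := (hpr.mdifferentiableAt (θ t p)).hasMFDerivAt.comp t (hθ.generates p t)
    have h2 : (pr ∘ fun t ↦ θ t p) = fun _ ↦ pr p := by
      funext s; exact hpr.pr_flow s p
    rw [h2] at h1
    have h3 := hasMFDerivAt_unique h1 (hasMFDerivAt_const (I := 𝓘(ℝ, ℝ)) (I' := 𝓡 2) (pr p) t)
    have h4 : mfderiv (𝓡 3) (𝓡 2) pr (θ t p) ((1 : ℝ) • S.ξ (θ t p)) = 0 :=
      DFunLike.congr_fun h3 (1 : ℝ)
    rwa [one_smul] at h4
  have h := key 0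
  rwa [hθ.zero p] at h

theorem IsBoothbyWangFibering.inner_eq (hθ : S.IsRegularFlow θ)
    (hpr : S.IsBoothbyWangFibering θ pr) (p : M) (v w : TangentSpace (𝓡 3) p) :
    (inner ℝ v w : ℝ) =
      inner ℝ (mfderiv (𝓡 3) (𝓡 2) pr p v) (mfderiv (𝓡 3) (𝓡 2) pr p w) + S.η p v * S.η p w := by
  have h := hpr.isometry p (v - S.η p v • S.ξ p) (w - S.η p w • S.ξ p)
    (by rw [map_sub, map_smul, S.η_ξ]; simp) (by rw [map_sub, map_smul, S.η_ξ]; simp)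
  rw [map_sub, map_sub, map_smul, map_smul, hpr.mfderiv_ξ hθ, smul_zero, smul_zero, sub_zero,
    sub_zero] at h
  rw [h]
  simp only [inner_sub_left, inner_sub_right, real_inner_smul_left, real_inner_smul_right,
    S.inner_ξ, S.inner_ξ_right, map_smul, smul_eq_mul, S.η_ξ]
  ring

theorem IsBoothbyWangFibering.eq_zero (hθ : S.IsRegularFlow θ)
    (hpr : S.IsBoothbyWangFibering θ pr) {p : M} {v : TangentSpace (𝓡 3) p}
    (h : mfderiv (𝓡 3) (𝓡 2) pr p v = 0) (hη : S.η p v = 0) : v = 0 := by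
  have h1 := hpr.inner_eq hθ p v v
  rw [h, hη, inner_zero_left, mul_zero, add_zero] at h1
  exact inner_self_eq_zero.1 h1

theorem IsBoothbyWangFibering.eq_of_mfderiv_eq (hθ : S.IsRegularFlow θ)
    (hpr : S.IsBoothbyWangFibering θ pr) {p : M} {v w : TangentSpace (𝓡 3) p}
    (h : mfderiv (𝓡 3) (𝓡 2) pr p v = mfderiv (𝓡 3) (𝓡 2) pr p w) (hη : S.η p v = S.η p w) :
    v = w :=
  sub_eq_zero.1 (hpr.eq_zero hθ (by rw [map_sub, h, sub_self]) (by rw [map_sub, hη, sub_self]))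

theorem IsBoothbyWangFibering.exists_lift (hθ : S.IsRegularFlow θ)
    (hpr : S.IsBoothbyWangFibering θ pr) (p : M) (X : TangentSpace (𝓡 2) (pr p)) :
    ∃ v : TangentSpace (𝓡 3) p, S.η p v = 0 ∧ mfderiv (𝓡 3) (𝓡 2) pr p v = X := by
  obtain ⟨v, hv⟩ := hpr.submersion p X
  refine ⟨v - S.η p v • S.ξ p, by rw [map_sub, map_smul, S.η_ξ]; simp, ?_⟩
  rw [map_sub, map_smul, hpr.mfderiv_ξ hθ, smul_zero, sub_zero, hv]

theorem IsBoothbyWangFibering.mfderiv_comp (hpr : S.IsBoothbyWangFibering θ pr) {F : E' → M}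
    {x : E'} (hF : MDifferentiableAt 𝓘(ℝ, E') (𝓡 3) F x) (u : E') :
    mfderiv 𝓘(ℝ, E') (𝓡 2) (fun y ↦ pr (F y)) x u =
      mfderiv (𝓡 3) (𝓡 2) pr (F x) (mfderiv 𝓘(ℝ, E') (𝓡 3) F x u) := by
  have := _root_.mfderiv_comp x (hpr.mdifferentiableAt (F x)) hF
  exact DFunLike.congr_fun this u

/-- The second derivative of a map into the total space compared with that of its projection. -/
theorem IsBoothbyWangFibering.inner_covAlong_mfderiv
    [IsContMDiffRiemannianBundle (𝓡 2) ∞ R2 (fun x : B ↦ TangentSpace (𝓡 2) x)]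
    (hS : S.IsSasaki) (hθ : S.IsRegularFlow θ)
    (hpr : S.IsBoothbyWangFibering θ pr) {F : E' → M} {x : E'}
    (hF : ContMDiffAt 𝓘(ℝ, E') (𝓡 3) ∞ F x) (u v w : E')
    (hw : S.η (F x) (mfderiv 𝓘(ℝ, E') (𝓡 3) F x w) = 0) :
    (inner ℝ (covAlong (𝓡 3) 𝓘(ℝ, E') F (fun y ↦ mfderiv 𝓘(ℝ, E') (𝓡 3) F y v) x u)
      (mfderiv 𝓘(ℝ, E') (𝓡 3) F x w) : ℝ) =
      inner ℝ (covAlong (𝓡 2) 𝓘(ℝ, E') (fun y ↦ pr (F y))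
          (fun y ↦ mfderiv 𝓘(ℝ, E') (𝓡 2) (fun y ↦ pr (F y)) y v) x u)
        (mfderiv 𝓘(ℝ, E') (𝓡 2) (fun y ↦ pr (F y)) x w)
      + S.ηComp F v x * inner ℝ (mfderiv 𝓘(ℝ, E') (𝓡 3) F x u)
          (S.φ (F x) (mfderiv 𝓘(ℝ, E') (𝓡 3) F x w))
      + S.ηComp F u x * inner ℝ (mfderiv 𝓘(ℝ, E') (𝓡 3) F x v)
          (S.φ (F x) (mfderiv 𝓘(ℝ, E') (𝓡 3) F x w)) := by
  have hf : ContMDiffAt 𝓘(ℝ, E') (𝓡 2) ∞ (fun y ↦ pr (F y)) x :=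
    hpr.smooth.contMDiffAt.comp x hF
  have hηd (a : E') : DifferentiableAt ℝ (S.ηComp F a) x :=
    (S.contDiffAt_ηComp hF a).differentiableAt (by simp)
  have hF1 : ∀ᶠ y in 𝓝 x, ContMDiffAt 𝓘(ℝ, E') (𝓡 3) 1 F y :=
    (contMDiffAt_iff_contMDiffAt_nhds (by simp)).1 (hF.of_le (by simp))
  have key (a b c : E') : fderiv ℝ (pullMetric (𝓡 3) F a b) x c =
      fderiv ℝ (pullMetric (𝓡 2) (fun y ↦ pr (F y)) a b) x c
        + (S.ηComp F a x * fderiv ℝ (S.ηComp F b) x c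
          + S.ηComp F b x * fderiv ℝ (S.ηComp F a) x c) := by
    have h1 : pullMetric (𝓡 3) F a b =ᶠ[𝓝 x] fun y ↦
        pullMetric (𝓡 2) (fun y ↦ pr (F y)) a b y + S.ηComp F a y * S.ηComp F b y := by
      filter_upwards [hF1] with y hy
      have hy' := hy.mdifferentiableAt (by simp)
      rw [pullMetric, hpr.inner_eq hθ, pullMetric, hpr.mfderiv_comp hy', hpr.mfderiv_comp hy']
      rfl
    have hm : DifferentiableAt ℝ (fun y ↦ S.ηComp F a y * S.ηComp F b y) x := (hηd a).mul (hηd b)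
    rw [h1.fderiv_eq, fderiv_fun_add ((contDiffAt_pullMetric hf a b).differentiableAt (by simp))
      hm, fderiv_fun_mul (hηd a) (hηd b)]
    rfl
  have hw' : S.ηComp F w x = 0 := hw
  have e1 := S.fderiv_ηComp_sub hS hF u w
  have e2 := S.fderiv_ηComp_sub hS hF v w
  rw [HopfCylinder.inner_covAlong_mfderiv hF, HopfCylinder.inner_covAlong_mfderiv hf, key, key,
    key, hw']
  linear_combination (S.ηComp F v x / 2) * e1 + (S.ηComp F u x / 2) * e2

/-! ### The complex structure of the base -/

theorem IsRegularFlow.smoothAlong_mfderiv (hθ : S.IsRegularFlow θ) (p : M)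
    (v : TangentSpace (𝓡 3) p) (t : ℝ) :
    SmoothAlong (𝓡 3) 𝓘(ℝ, ℝ) (fun t ↦ θ t p) (fun t ↦ mfderiv (𝓡 3) (𝓡 3) (θ t) p v) t := by
  have h0 : ContMDiff 𝓘(ℝ, ℝ) 𝓘(ℝ, ℝ).tangent ∞
      (fun t : ℝ ↦ (⟨t, 0⟩ : TangentBundle 𝓘(ℝ, ℝ) ℝ)) :=
    Bundle.contMDiff_zeroSection ℝ (TangentSpace 𝓘(ℝ, ℝ) : ℝ → Type _)
  have h1 : ContMDiff 𝓘(ℝ, ℝ) (𝓘(ℝ, ℝ).prod (𝓡 3)).tangent ∞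
      (fun t ↦ (⟨(t, p), (0, v)⟩ : TangentBundle (𝓘(ℝ, ℝ).prod (𝓡 3)) (ℝ × M))) :=
    (contMDiff_equivTangentBundleProd_symm (n := ∞) (I := 𝓘(ℝ, ℝ)) (M := ℝ) (I' := 𝓡 3)
      (M' := M)).comp (h0.prodMk (contMDiff_const (c := (⟨p, v⟩ : TangentBundle (𝓡 3) M))))
  have h2 := (hθ.smooth.contMDiff_tangentMap (m := ∞) (by simp)).comp h1
  refine SmoothAlong.congr (f := fun t ↦ θ t p)
    (V := fun t ↦ mfderiv (𝓘(ℝ, ℝ).prod (𝓡 3)) (𝓡 3) (fun x : ℝ × M ↦ θ x.1 x.2) (t, p) (0, v))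
    (h2 t) (Eventually.of_forall fun s ↦ ⟨rfl, ?_⟩)
  have hd : MDifferentiableAt (𝓘(ℝ, ℝ).prod (𝓡 3)) (𝓡 3) (fun x : ℝ × M ↦ θ x.1 x.2) (s, p) :=
    hθ.smooth.mdifferentiableAt (by simp)
  have h3 : HasMFDerivAt (𝓡 3) (𝓘(ℝ, ℝ).prod (𝓡 3)) (fun q : M ↦ (s, q)) p
      (ContinuousLinearMap.inr ℝ ℝ R3) :=
    (hasMFDerivAt_const (I := 𝓡 3) (I' := 𝓘(ℝ, ℝ)) s p).prodMk (hasMFDerivAt_id p)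
  have h4 := (hd.hasMFDerivAt.comp p h3).mfderiv
  exact DFunLike.congr_fun h4 v

theorem phi_congr {p q : M} (h : p = q) {v : TangentSpace (𝓡 3) p} {w : TangentSpace (𝓡 3) q}
    (hv : (v : R3) = w) : (S.φ p v : R3) = S.φ q w := by
  subst h; cases hv; rfl

theorem η_congr {p q : M} (h : p = q) {v : TangentSpace (𝓡 3) p} {w : TangentSpace (𝓡 3) q}
    (hv : (v : R3) = w) : S.η p v = S.η q w := by
  subst h; cases hv; rfl

theorem IsBoothbyWangFibering.mfderiv_flow (hθ : S.IsRegularFlow θ)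
    (hpr : S.IsBoothbyWangFibering θ pr) (t : ℝ) (p : M) (v : TangentSpace (𝓡 3) p) :
    (mfderiv (𝓡 3) (𝓡 2) pr (θ t p) (mfderiv (𝓡 3) (𝓡 3) (θ t) p v) : R2) =
      mfderiv (𝓡 3) (𝓡 2) pr p v := by
  have hd : MDifferentiableAt (𝓡 3) (𝓡 3) (θ t) p :=
    (hθ.smooth.comp (contMDiff_const.prodMk contMDiff_id)).mdifferentiableAt (by simp)
  have h1 := _root_.mfderiv_comp p (hpr.mdifferentiableAt (θ t p)) hd
  have h2 : pr ∘ θ t = pr := by funext q; exact hpr.pr_flow t q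
  rw [h2] at h1
  exact (DFunLike.congr_fun h1 v).symm

theorem IsBoothbyWangFibering.mfderiv_φ_eq (hθ : S.IsRegularFlow θ)
    (hpr : S.IsBoothbyWangFibering θ pr) {p q : M} (hpq : pr p = pr q)
    {v : TangentSpace (𝓡 3) p} {w : TangentSpace (𝓡 3) q} (hv : S.η p v = 0) (hw : S.η q w = 0)
    (h1 : (inner ℝ v v : ℝ) = 1)
    (hvw : (mfderiv (𝓡 3) (𝓡 2) pr p v : R2) = mfderiv (𝓡 3) (𝓡 2) pr q w) :
    (mfderiv (𝓡 3) (𝓡 2) pr p (S.φ p v) : R2) = mfderiv (𝓡 3) (𝓡 2) pr q (S.φ q w) := by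
  obtain ⟨t, rfl⟩ := (hpr.fibre_iff p q).1 hpq
  -- the horizontal part of the transported vector
  let X : ∀ (_ : TangentSpace (𝓡 3) p) (t : ℝ), TangentSpace (𝓡 3) (θ t p) := fun v t ↦
    mfderiv (𝓡 3) (𝓡 3) (θ t) p v
      + (-S.η (θ t p) (mfderiv (𝓡 3) (𝓡 3) (θ t) p v)) • S.ξ (θ t p)
  have hXη (v t) : S.η (θ t p) (X v t) = 0 := by
    simp only [X]
    rw [map_add, map_smul, S.η_ξ]; simp
  have hXpr (v : TangentSpace (𝓡 3) p) (t) :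
      (mfderiv (𝓡 3) (𝓡 2) pr (θ t p) (X v t) : R2) = mfderiv (𝓡 3) (𝓡 2) pr p v := by
    rw [← hpr.mfderiv_flow hθ t p v]
    simp only [X]
    rw [map_add, map_smul, hpr.mfderiv_ξ hθ, smul_zero, add_zero]
  have hflow (t : ℝ) : ContMDiffAt 𝓘(ℝ, ℝ) (𝓡 3) ∞ (fun t ↦ θ t p) t :=
    (hθ.smoothAlong_mfderiv p v t).base
  have hXs (v t) : SmoothAlong (𝓡 3) 𝓘(ℝ, ℝ) (fun t ↦ θ t p) (X v) t := by
    have h2 := hθ.smoothAlong_mfderiv p v t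
    refine h2.add (SmoothAlong.smul ?_ (S.smoothAlong_ξ (hflow t)))
    refine ContMDiffAt.neg ?_
    refine ((S.smoothAlong_ξ (hflow t)).inner h2).congr_of_eventuallyEq ?_
    exact Eventually.of_forall fun s ↦ (S.inner_ξ _ _).symm
  have hXin (a b : TangentSpace (𝓡 3) p) (ha : S.η p a = 0) (t) :
      (inner ℝ (X a t) (X b t) : ℝ) = inner ℝ a b := by
    rw [hpr.inner_eq hθ, hpr.inner_eq hθ p a b, hXη, ha, zero_mul, zero_mul, add_zero, add_zero]
    exact inner_congr (hpr.pr_flow t p) (hXpr a t) (hXpr b t)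
  let c : ℝ → ℝ := fun t ↦ inner ℝ (S.φ (θ t p) (X v t)) (X (S.φ p v) t)
  have hcc : Continuous c := continuous_iff_continuousAt.2 fun t ↦
    ((S.smoothAlong_φ (hXs v t)).inner (hXs (S.φ p v) t)).continuousAt
  have hv1 (t) : (inner ℝ (X v t) (X v t) : ℝ) = 1 := by rw [hXin v v hv, h1]
  have hφ1 : (inner ℝ (S.φ p v) (S.φ p v) : ℝ) = 1 := by rw [S.inner_φ_φ, h1, hv]; simp
  have hXc (t) : X (S.φ p v) t = c t • S.φ (θ t p) (X v t) := by
    have h2 := S.eq_frame_sum (hXη v t) (hv1 t) (X (S.φ p v) t)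
    rw [hXη, zero_smul, add_zero, real_inner_comm, hXin v _ hv, S.inner_φ_self, zero_smul,
      zero_add, real_inner_comm] at h2
    exact h2
  have hsq (t) : c t ^ 2 = 1 := by
    have h2 := hXin (S.φ p v) (S.φ p v) (S.η_φ p v) t
    rw [hφ1, hXc, real_inner_smul_left, real_inner_smul_right, S.inner_φ_φ, hv1, hXη] at h2
    nlinarith
  have hc0 : c 0 = 1 := by
    have hid : θ 0 = id := funext hθ.zero
    have hX0 (a : TangentSpace (𝓡 3) p) (ha : S.η p a = 0) : (X a 0 : R3) = a := by
      have h3 : (mfderiv (𝓡 3) (𝓡 3) (θ 0) p a : R3) = a := by rw [hid, mfderiv_id]; rfl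
      have h4 : S.η (θ 0 p) (mfderiv (𝓡 3) (𝓡 3) (θ 0) p a) = 0 :=
        (η_congr (S := S) (hθ.zero p) h3).trans ha
      simp only [X]
      rw [h4, neg_zero, zero_smul, add_zero]
      exact h3
    rw [← hφ1]
    exact inner_congr (hθ.zero p) (phi_congr (hθ.zero p) (hX0 v hv)) (hX0 _ (S.η_φ p v))
  have hc1 (t) : c t = 1 := by
    rcases isPreconnected_univ.eq_one_or_eq_neg_one_of_sq_eq hcc.continuousOn
      (fun t _ ↦ hsq t) with h2 | h2
    · exact h2 (mem_univ t)
    · have h3 : c 0 = -1 := h2 (mem_univ 0)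
      rw [hc0] at h3; norm_num at h3
  have hwX : w = X v t := by
    refine hpr.eq_of_mfderiv_eq hθ ?_ (hw.trans (hXη v t).symm)
    exact hvw.symm.trans (hXpr v t).symm
  have h5 := hXc t
  rw [hc1, one_smul] at h5
  rw [hwX, ← h5]
  exact (hXpr _ t).symm

theorem cast_tangent {b b' : B} (h : b = b') (X : TangentSpace (𝓡 2) b) :
    ((h ▸ X : TangentSpace (𝓡 2) b') : R2) = X := by
  subst h; rfl

theorem IsBoothbyWangFibering.baseJ_eq (hθ : S.IsRegularFlow θ)
    (hpr : S.IsBoothbyWangFibering θ pr) {p : M} {b : B} (hb : pr p = b)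
    {v : TangentSpace (𝓡 3) p} (hv : S.η p v = 0) (h1 : (inner ℝ v v : ℝ) = 1)
    {X : TangentSpace (𝓡 2) b} (hX : (mfderiv (𝓡 3) (𝓡 2) pr p v : R2) = X) :
    (S.baseJ pr b X : R2) = mfderiv (𝓡 3) (𝓡 2) pr p (S.φ p v) := by
  have h : ∃ p, pr p = b := ⟨p, hb⟩
  unfold baseJ
  rw [dif_pos h]
  refine (cast_tangent (B := B) h.choose_spec _).trans ?_
  have hex := hpr.exists_lift hθ h.choose (h.choose_spec.symm ▸ X)
  have hl : S.horizontalLift pr h.choose (h.choose_spec.symm ▸ X) = hex.choose := by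
    unfold horizontalLift
    rw [dif_pos hex]
  rw [hl]
  refine (hpr.mfderiv_φ_eq hθ (hb.trans h.choose_spec.symm) hv hex.choose_spec.1 h1 ?_).symm
  exact hX.trans ((congrArg (fun Z ↦ (Z : R2)) hex.choose_spec.2).trans
    (cast_tangent (B := B) h.choose_spec.symm X)).symm

end ContactMetricStructure

end Fibering

/-! ## The geometry of a Hopf cylinder -/

section Patch

variable {M : Type*} [TopologicalSpace M] [ChartedSpace R3 M] [IsManifold (𝓡 3) ∞ M]
  [RiemannianBundle (fun x : M ↦ TangentSpace (𝓡 3) x)]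
  [IsContMDiffRiemannianBundle (𝓡 3) ∞ R3 (fun x : M ↦ TangentSpace (𝓡 3) x)]
  {B : Type*} [TopologicalSpace B] [ChartedSpace R2 B] [IsManifold (𝓡 2) ∞ B]
  [RiemannianBundle (fun x : B ↦ TangentSpace (𝓡 2) x)]
  [IsContMDiffRiemannianBundle (𝓡 2) ∞ R2 (fun x : B ↦ TangentSpace (𝓡 2) x)]
  {S : ContactMetricStructure M} {θ : ℝ → M → M} {pr : M → B} {γ : ℝ → B} {J : Set ℝ}
  {U : Set Plane} {σ : Plane → ℝ} {Φ : Plane → M} {u : Plane}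

/-- The partial derivatives of a function on the plane. -/
noncomputable def partialDeriv (f : Plane → ℝ) (i : Fin 2) (u : Plane) : ℝ :=
  fderiv ℝ f u (coordVec i)

variable (S) in
/-- The components of the contact form on a surface patch. -/
noncomputable def ηPartial (Φ : Plane → M) (i : Fin 2) (u : Plane) : ℝ :=
  S.ηComp Φ (coordVec i) u

variable (S) in
/-- The Jacobian of the change of frame from `(T, ξ)` to the coordinate frame. -/
noncomputable def frameDet (σ : Plane → ℝ) (Φ : Plane → M) (u : Plane) : ℝ :=
  partialDeriv σ 0 u * ηPartial S Φ 1 u - partialDeriv σ 1 u * ηPartial S Φ 0 u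

variable (S) in
/-- The horizontal unit tangent field of a Hopf cylinder. -/
noncomputable def patchTangent (σ : Plane → ℝ) (Φ : Plane → M) (u : Plane) :
    TangentSpace (𝓡 3) (Φ u) :=
  (ηPartial S Φ 1 u / frameDet S σ Φ u) • partialVec (𝓡 3) Φ 0 u
    + (-ηPartial S Φ 0 u / frameDet S σ Φ u) • partialVec (𝓡 3) Φ 1 u

variable (S) in
/-- The unit normal field of a Hopf cylinder. -/
noncomputable def patchNormal (σ : Plane → ℝ) (Φ : Plane → M) (u : Plane) :
    TangentSpace (𝓡 3) (Φ u) := S.φ (Φ u) (patchTangent S σ Φ u)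

theorem mfderiv_cast {p q : M} (h : p = q) {v : TangentSpace (𝓡 3) p} {w : TangentSpace (𝓡 3) q}
    (hv : (v : R3) = w) :
    (mfderiv (𝓡 3) (𝓡 2) pr p v : R2) = mfderiv (𝓡 3) (𝓡 2) pr q w := by
  subst h; cases hv; rfl

theorem mfderiv_comp_real (hγ : MDifferentiableAt 𝓘(ℝ, ℝ) (𝓡 2) γ (σ u))
    (hσ : DifferentiableAt ℝ σ u) (c : Plane) :
    mfderiv 𝓘(ℝ, Plane) (𝓡 2) (fun z ↦ γ (σ z)) u c =
      (fderiv ℝ σ u c • velocity (𝓡 2) γ (σ u) : TangentSpace (𝓡 2) (γ (σ u))) := by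
  have h1 := mfderiv_comp u hγ hσ.mdifferentiableAt
  have h2 : mfderiv 𝓘(ℝ, Plane) (𝓡 2) (fun z ↦ γ (σ z)) u c =
      mfderiv 𝓘(ℝ, ℝ) (𝓡 2) γ (σ u) (fderiv ℝ σ u c) := by
    rw [← mfderiv_eq_fderiv]
    exact DFunLike.congr_fun h1 c
  rw [h2, velocity]
  have h3 := (mfderiv 𝓘(ℝ, ℝ) (𝓡 2) γ (σ u)).map_smul (fderiv ℝ σ u c) (1 : ℝ)
  rw [← h3]
  congr 1
  exact (mul_one (fderiv ℝ σ u c)).symm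

namespace IsHopfPatch

theorem contMDiffAt (hp : IsHopfPatch pr γ J U σ Φ) (hu : u ∈ U) :
    ContMDiffAt 𝓘(ℝ, Plane) (𝓡 3) ∞ Φ u := hp.smooth.contMDiffAt (hp.isOpen.mem_nhds hu)

theorem contDiffAt (hp : IsHopfPatch pr γ J U σ Φ) (hu : u ∈ U) : ContDiffAt ℝ ∞ σ u :=
  hp.smooth_param.contDiffAt (hp.isOpen.mem_nhds hu)

theorem eventually_mem (hp : IsHopfPatch pr γ J U σ Φ) (hu : u ∈ U) : ∀ᶠ z in 𝓝 u, z ∈ U :=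
  hp.isOpen.mem_nhds hu

theorem pr_eq (hp : IsHopfPatch pr γ J U σ Φ) (hu : u ∈ U) : pr (Φ u) = γ (σ u) :=
  (hp.mapsTo u hu).2

theorem curve_contMDiffAt (hp : IsHopfPatch pr γ J U σ Φ) (hγ : IsUnitSpeedCurve (𝓡 2) γ J)
    (hu : u ∈ U) : ContMDiffAt 𝓘(ℝ, ℝ) (𝓡 2) ∞ γ (σ u) :=
  hγ.smooth.contMDiffAt (hγ.isOpen.mem_nhds (hp.mapsTo u hu).1)

theorem mfderiv_curve_comp (hp : IsHopfPatch pr γ J U σ Φ) (hγ : IsUnitSpeedCurve (𝓡 2) γ J)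
    (hu : u ∈ U) (c : Plane) :
    mfderiv 𝓘(ℝ, Plane) (𝓡 2) (fun z ↦ γ (σ z)) u c =
      (fderiv ℝ σ u c • velocity (𝓡 2) γ (σ u) : TangentSpace (𝓡 2) (γ (σ u))) :=
  mfderiv_comp_real ((hp.curve_contMDiffAt hγ hu).mdifferentiableAt (by simp))
    ((hp.contDiffAt hu).differentiableAt (by simp)) c

theorem mfderiv_pr (hp : IsHopfPatch pr γ J U σ Φ) (hpr : S.IsBoothbyWangFibering θ pr)
    (hγ : IsUnitSpeedCurve (𝓡 2) γ J) (hu : u ∈ U) (c : Plane) :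
    (mfderiv (𝓡 3) (𝓡 2) pr (Φ u) (mfderiv 𝓘(ℝ, Plane) (𝓡 3) Φ u c) : R2) =
      (fderiv ℝ σ u c • velocity (𝓡 2) γ (σ u) : TangentSpace (𝓡 2) (γ (σ u))) := by
  rw [← hp.mfderiv_curve_comp hγ hu,
    ← hpr.mfderiv_comp ((hp.contMDiffAt hu).mdifferentiableAt (by simp))]
  have : (fun z ↦ pr (Φ z)) =ᶠ[𝓝 u] fun z ↦ γ (σ z) :=
    (hp.eventually_mem hu).mono fun z hz ↦ hp.pr_eq hz
  rw [this.mfderiv_eq]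
  rfl

theorem unit_speed (hp : IsHopfPatch pr γ J U σ Φ) (hγ : IsUnitSpeedCurve (𝓡 2) γ J) (hu : u ∈ U) :
    (inner ℝ (velocity (𝓡 2) γ (σ u)) (velocity (𝓡 2) γ (σ u)) : ℝ) = 1 :=
  hγ.unit_speed _ (hp.mapsTo u hu).1

theorem eq_zero_of_partial_eq_zero (hp : IsHopfPatch pr γ J U σ Φ) (hθ : S.IsRegularFlow θ)
    (hpr : S.IsBoothbyWangFibering θ pr) (hγ : IsUnitSpeedCurve (𝓡 2) γ J) (hu : u ∈ U)
    {a b : ℝ} (hs : a * partialDeriv σ 0 u + b * partialDeriv σ 1 u = 0)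
    (ht : a * ηPartial S Φ 0 u + b * ηPartial S Φ 1 u = 0) : a = 0 ∧ b = 0 := by
  let c : Plane := a • coordVec 0 + b • coordVec 1
  have h1 : fderiv ℝ σ u c = 0 := by
    simp only [c, map_add, map_smul, smul_eq_mul]; exact hs
  have h2 : mfderiv 𝓘(ℝ, Plane) (𝓡 3) Φ u c =
      a • partialVec (𝓡 3) Φ 0 u + b • partialVec (𝓡 3) Φ 1 u := by
    refine (map_add (mfderiv 𝓘(ℝ, Plane) (𝓡 3) Φ u) (a • coordVec 0) (b • coordVec 1)).trans ?_
    congr 1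
    · exact map_smul (mfderiv 𝓘(ℝ, Plane) (𝓡 3) Φ u) a (coordVec 0)
    · exact map_smul (mfderiv 𝓘(ℝ, Plane) (𝓡 3) Φ u) b (coordVec 1)
  have h3 : mfderiv 𝓘(ℝ, Plane) (𝓡 3) Φ u c = 0 := by
    refine hpr.eq_zero hθ ?_ ?_
    · have h4 := hp.mfderiv_pr hpr hγ hu c
      rw [h1, zero_smul] at h4
      exact h4
    · rw [h2, map_add, map_smul, map_smul]
      exact ht
  have h5 : c = 0 := hp.immersion u hu (h3.trans (map_zero (mfderiv 𝓘(ℝ, Plane) (𝓡 3) Φ u)).symm)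
  constructor
  · simpa [c, coordVec] using congrArg (fun z : Plane ↦ z 0) h5
  · simpa [c, coordVec] using congrArg (fun z : Plane ↦ z 1) h5

theorem frameDet_ne_zero (hp : IsHopfPatch pr γ J U σ Φ) (hθ : S.IsRegularFlow θ)
    (hpr : S.IsBoothbyWangFibering θ pr) (hγ : IsUnitSpeedCurve (𝓡 2) γ J) (hu : u ∈ U) :
    frameDet S σ Φ u ≠ 0 := by
  intro h
  unfold frameDet at h
  have key {a b : ℝ} := hp.eq_zero_of_partial_eq_zero (a := a) (b := b) hθ hpr hγ hu
  have h1 := key (a := ηPartial S Φ 1 u) (b := -ηPartial S Φ 0 u) (by linarith) (by ring)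
  have h2 := key (a := partialDeriv σ 1 u) (b := -partialDeriv σ 0 u) (by ring) (by linarith)
  have h3 := key (a := 1) (b := 0) (by linarith [h2.2]) (by linarith [h1.2])
  exact one_ne_zero h3.1

theorem η_patchTangent (hp : IsHopfPatch pr γ J U σ Φ) (hθ : S.IsRegularFlow θ)
    (hpr : S.IsBoothbyWangFibering θ pr) (hγ : IsUnitSpeedCurve (𝓡 2) γ J) (hu : u ∈ U) :
    S.η (Φ u) (patchTangent S σ Φ u) = 0 := by
  have hD := hp.frameDet_ne_zero hθ hpr hγ hu
  have h1 : S.η (Φ u) (patchTangent S σ Φ u) =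
      (ηPartial S Φ 1 u / frameDet S σ Φ u) * ηPartial S Φ 0 u
        + (-ηPartial S Φ 0 u / frameDet S σ Φ u) * ηPartial S Φ 1 u := by
    rw [patchTangent, map_add, map_smul, map_smul]; rfl
  rw [h1]; ring

theorem mfderiv_patchTangent (hp : IsHopfPatch pr γ J U σ Φ) (hθ : S.IsRegularFlow θ)
    (hpr : S.IsBoothbyWangFibering θ pr) (hγ : IsUnitSpeedCurve (𝓡 2) γ J) (hu : u ∈ U) :
    (mfderiv (𝓡 3) (𝓡 2) pr (Φ u) (patchTangent S σ Φ u) : R2) = velocity (𝓡 2) γ (σ u) := by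
  have hD := hp.frameDet_ne_zero hθ hpr hγ hu
  have key (v : R2) : ((ηPartial S Φ 1 u / frameDet S σ Φ u) • (partialDeriv σ 0 u • v)
        + (-ηPartial S Φ 0 u / frameDet S σ Φ u) • (partialDeriv σ 1 u • v) : R2) = v := by
    rw [smul_smul, smul_smul, ← add_smul]
    have : ηPartial S Φ 1 u / frameDet S σ Φ u * partialDeriv σ 0 u
        + -ηPartial S Φ 0 u / frameDet S σ Φ u * partialDeriv σ 1 u = 1 := by
      field_simp
      unfold frameDet; ring
    rw [this, one_smul]
  rw [patchTangent, map_add, map_smul, map_smul]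
  have h0 := hp.mfderiv_pr hpr hγ hu (coordVec 0)
  have h1 := hp.mfderiv_pr hpr hγ hu (coordVec 1)
  refine Eq.trans ?_ (key (velocity (𝓡 2) γ (σ u)))
  exact congrArg₂ (fun x y : R2 ↦ (ηPartial S Φ 1 u / frameDet S σ Φ u) • x
    + (-ηPartial S Φ 0 u / frameDet S σ Φ u) • y) h0 h1

theorem inner_patchTangent (hp : IsHopfPatch pr γ J U σ Φ) (hθ : S.IsRegularFlow θ)
    (hpr : S.IsBoothbyWangFibering θ pr) (hγ : IsUnitSpeedCurve (𝓡 2) γ J) (hu : u ∈ U) :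
    (inner ℝ (patchTangent S σ Φ u) (patchTangent S σ Φ u) : ℝ) = 1 := by
  have h := hp.mfderiv_patchTangent hθ hpr hγ hu
  rw [hpr.inner_eq hθ, hp.η_patchTangent hθ hpr hγ hu, mul_zero, add_zero,
    inner_congr (hp.pr_eq hu) h h, hp.unit_speed hγ hu]

theorem partialVec_eq (hp : IsHopfPatch pr γ J U σ Φ) (hθ : S.IsRegularFlow θ)
    (hpr : S.IsBoothbyWangFibering θ pr) (hγ : IsUnitSpeedCurve (𝓡 2) γ J) (hu : u ∈ U)
    (i : Fin 2) : partialVec (𝓡 3) Φ i u =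
      partialDeriv σ i u • patchTangent S σ Φ u + ηPartial S Φ i u • S.ξ (Φ u) := by
  refine hpr.eq_of_mfderiv_eq hθ ?_ ?_
  · rw [map_add, map_smul, map_smul, hpr.mfderiv_ξ hθ, smul_zero, add_zero]
    refine (hp.mfderiv_pr hpr hγ hu (coordVec i)).trans ?_
    exact congrArg (fun x : R2 ↦ partialDeriv σ i u • x) (hp.mfderiv_patchTangent hθ hpr hγ hu).symm
  · rw [map_add, map_smul, map_smul, hp.η_patchTangent hθ hpr hγ hu, S.η_ξ]
    simp [ηPartial, ContactMetricStructure.ηComp, partialVec]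

theorem contDiffAt_partialDeriv (hp : IsHopfPatch pr γ J U σ Φ) (hu : u ∈ U) (i : Fin 2) :
    ContDiffAt ℝ ∞ (partialDeriv σ i) u :=
  ((hp.contDiffAt hu).fderiv_right (m := ∞) (by simp)).clm_apply contDiffAt_const

theorem contDiffAt_ηPartial (hp : IsHopfPatch pr γ J U σ Φ) (hu : u ∈ U) (i : Fin 2) :
    ContDiffAt ℝ ∞ (ηPartial S Φ i) u := S.contDiffAt_ηComp (hp.contMDiffAt hu) _

theorem smoothAlong_patchTangent (hp : IsHopfPatch pr γ J U σ Φ) (hθ : S.IsRegularFlow θ)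
    (hpr : S.IsBoothbyWangFibering θ pr) (hγ : IsUnitSpeedCurve (𝓡 2) γ J) (hu : u ∈ U) :
    SmoothAlong (𝓡 3) 𝓘(ℝ, Plane) Φ (patchTangent S σ Φ) u := by
  have hD := hp.frameDet_ne_zero hθ hpr hγ hu
  have hs := hp.contDiffAt_partialDeriv hu
  have ht := hp.contDiffAt_ηPartial (S := S) hu
  have hDs : ContDiffAt ℝ ∞ (frameDet S σ Φ) u := ((hs 0).mul (ht 1)).sub ((hs 1).mul (ht 0))
  exact ((smoothAlong_mfderiv (hp.contMDiffAt hu) _).smul ((ht 1).div hDs hD).contMDiffAt).add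
    ((smoothAlong_mfderiv (hp.contMDiffAt hu) _).smul ((ht 0).neg.div hDs hD).contMDiffAt)

theorem smoothAlong_patchNormal (hp : IsHopfPatch pr γ J U σ Φ) (hθ : S.IsRegularFlow θ)
    (hpr : S.IsBoothbyWangFibering θ pr) (hγ : IsUnitSpeedCurve (𝓡 2) γ J) (hu : u ∈ U) :
    SmoothAlong (𝓡 3) 𝓘(ℝ, Plane) Φ (patchNormal S σ Φ) u :=
  S.smoothAlong_φ (hp.smoothAlong_patchTangent hθ hpr hγ hu)

theorem η_patchNormal : S.η (Φ u) (patchNormal S σ Φ u) = 0 := S.η_φ _ _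

theorem inner_patchNormal (hp : IsHopfPatch pr γ J U σ Φ) (hθ : S.IsRegularFlow θ)
    (hpr : S.IsBoothbyWangFibering θ pr) (hγ : IsUnitSpeedCurve (𝓡 2) γ J) (hu : u ∈ U) :
    (inner ℝ (patchNormal S σ Φ u) (patchNormal S σ Φ u) : ℝ) = 1 := by
  rw [patchNormal, S.inner_φ_φ, hp.inner_patchTangent hθ hpr hγ hu,
    hp.η_patchTangent hθ hpr hγ hu]
  simp

theorem inner_partialVec_patchNormal (hp : IsHopfPatch pr γ J U σ Φ) (hθ : S.IsRegularFlow θ)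
    (hpr : S.IsBoothbyWangFibering θ pr) (hγ : IsUnitSpeedCurve (𝓡 2) γ J) (hu : u ∈ U)
    (i : Fin 2) : (inner ℝ (partialVec (𝓡 3) Φ i u) (patchNormal S σ Φ u) : ℝ) = 0 := by
  rw [hp.partialVec_eq hθ hpr hγ hu, inner_add_left, real_inner_smul_left, real_inner_smul_left,
    S.inner_ξ, η_patchNormal, patchNormal, S.inner_φ_self]
  ring

theorem inner_partialVec_patchTangent (hp : IsHopfPatch pr γ J U σ Φ) (hθ : S.IsRegularFlow θ)
    (hpr : S.IsBoothbyWangFibering θ pr) (hγ : IsUnitSpeedCurve (𝓡 2) γ J) (hu : u ∈ U)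
    (i : Fin 2) :
    (inner ℝ (partialVec (𝓡 3) Φ i u) (patchTangent S σ Φ u) : ℝ) = partialDeriv σ i u := by
  rw [hp.partialVec_eq hθ hpr hγ hu, inner_add_left, real_inner_smul_left, real_inner_smul_left,
    S.inner_ξ, hp.η_patchTangent hθ hpr hγ hu, hp.inner_patchTangent hθ hpr hγ hu]
  ring

theorem φ_patchNormal (hp : IsHopfPatch pr γ J U σ Φ) (hθ : S.IsRegularFlow θ)
    (hpr : S.IsBoothbyWangFibering θ pr) (hγ : IsUnitSpeedCurve (𝓡 2) γ J) (hu : u ∈ U) :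
    S.φ (Φ u) (patchNormal S σ Φ u) = -patchTangent S σ Φ u := by
  rw [patchNormal, S.φ_sq, hp.η_patchTangent hθ hpr hγ hu, zero_smul, add_zero]

theorem φ_partialVec (hp : IsHopfPatch pr γ J U σ Φ) (hθ : S.IsRegularFlow θ)
    (hpr : S.IsBoothbyWangFibering θ pr) (hγ : IsUnitSpeedCurve (𝓡 2) γ J) (hu : u ∈ U)
    (i : Fin 2) :
    S.φ (Φ u) (partialVec (𝓡 3) Φ i u) = partialDeriv σ i u • patchNormal S σ Φ u := by
  rw [hp.partialVec_eq hθ hpr hγ hu, map_add, map_smul, map_smul, S.φ_ξ, smul_zero, add_zero]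
  rfl

theorem baseJ_velocity (hp : IsHopfPatch pr γ J U σ Φ) (hθ : S.IsRegularFlow θ)
    (hpr : S.IsBoothbyWangFibering θ pr) (hγ : IsUnitSpeedCurve (𝓡 2) γ J) (hu : u ∈ U) :
    (S.baseJ pr (γ (σ u)) (velocity (𝓡 2) γ (σ u)) : R2) =
      mfderiv (𝓡 3) (𝓡 2) pr (Φ u) (patchNormal S σ Φ u) :=
  hpr.baseJ_eq hθ (hp.pr_eq hu) (hp.η_patchTangent hθ hpr hγ hu)
    (hp.inner_patchTangent hθ hpr hγ hu) (hp.mfderiv_patchTangent hθ hpr hγ hu)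

theorem inner_velocity_baseJ (hp : IsHopfPatch pr γ J U σ Φ) (hθ : S.IsRegularFlow θ)
    (hpr : S.IsBoothbyWangFibering θ pr) (hγ : IsUnitSpeedCurve (𝓡 2) γ J) (hu : u ∈ U) :
    (inner ℝ (velocity (𝓡 2) γ (σ u)) (S.baseJ pr (γ (σ u)) (velocity (𝓡 2) γ (σ u))) : ℝ) = 0 := by
  have h := hpr.inner_eq hθ (Φ u) (patchTangent S σ Φ u) (patchNormal S σ Φ u)
  rw [η_patchNormal, mul_zero, add_zero, patchNormal, S.inner_φ_self] at h
  rw [h]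
  exact inner_congr (hp.pr_eq hu).symm (hp.mfderiv_patchTangent hθ hpr hγ hu).symm
    (hp.baseJ_velocity hθ hpr hγ hu)

theorem inner_baseJ_baseJ (hp : IsHopfPatch pr γ J U σ Φ) (hθ : S.IsRegularFlow θ)
    (hpr : S.IsBoothbyWangFibering θ pr) (hγ : IsUnitSpeedCurve (𝓡 2) γ J) (hu : u ∈ U) :
    (inner ℝ (S.baseJ pr (γ (σ u)) (velocity (𝓡 2) γ (σ u)))
      (S.baseJ pr (γ (σ u)) (velocity (𝓡 2) γ (σ u))) : ℝ) = 1 := by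
  have h := hpr.inner_eq hθ (Φ u) (patchNormal S σ Φ u) (patchNormal S σ Φ u)
  rw [η_patchNormal, mul_zero, add_zero, hp.inner_patchNormal hθ hpr hγ hu] at h
  rw [h]
  exact inner_congr (hp.pr_eq hu).symm (hp.baseJ_velocity hθ hpr hγ hu)
    (hp.baseJ_velocity hθ hpr hγ hu)

/-- Second derivatives of the curve, seen as a map from the patch. -/
theorem inner_covAlong_curve (hp : IsHopfPatch pr γ J U σ Φ) (hθ : S.IsRegularFlow θ)
    (hpr : S.IsBoothbyWangFibering θ pr) (hγ : IsUnitSpeedCurve (𝓡 2) γ J) (hu : u ∈ U)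
    (i j : Fin 2) :
    (inner ℝ (covAlong (𝓡 2) 𝓘(ℝ, Plane) (fun z ↦ γ (σ z))
        (fun z ↦ mfderiv 𝓘(ℝ, Plane) (𝓡 2) (fun z ↦ γ (σ z)) z (coordVec j)) u (coordVec i))
      (S.baseJ pr (γ (σ u)) (velocity (𝓡 2) γ (σ u))) : ℝ) =
      partialDeriv σ i u * partialDeriv σ j u * S.signedCurvature pr γ (σ u) := by
  have hσ : MDifferentiableAt 𝓘(ℝ, Plane) 𝓘(ℝ, ℝ) σ u :=
    ((hp.contDiffAt hu).differentiableAt (by simp)).mdifferentiableAt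
  have hvel : SmoothAlong (𝓡 2) 𝓘(ℝ, ℝ) γ (velocity (𝓡 2) γ) (σ u) :=
    smoothAlong_mfderiv (hp.curve_contMDiffAt hγ hu) 1
  have hvelσ : SmoothAlong (𝓡 2) 𝓘(ℝ, Plane) (fun z ↦ γ (σ z))
      (fun z ↦ velocity (𝓡 2) γ (σ z)) u :=
    ContMDiffAt.comp u hvel (hp.contDiffAt hu).contMDiffAt
  have h1 : covAlong (𝓡 2) 𝓘(ℝ, Plane) (fun z ↦ γ (σ z))
        (fun z ↦ mfderiv 𝓘(ℝ, Plane) (𝓡 2) (fun z ↦ γ (σ z)) z (coordVec j)) u (coordVec i) =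
      covAlong (𝓡 2) 𝓘(ℝ, Plane) (fun z ↦ γ (σ z))
        (fun z ↦ partialDeriv σ j z • velocity (𝓡 2) γ (σ z)) u (coordVec i) :=
    covAlong_congr ((hp.eventually_mem hu).mono fun z hz ↦ ⟨rfl, hp.mfderiv_curve_comp hγ hz _⟩) _
  have h2 := covAlong_smul (a := partialDeriv σ j)
    ((hp.contDiffAt_partialDeriv hu j).differentiableAt (by simp)).mdifferentiableAt
    hvelσ.diffAlong (coordVec i)
  have h3 : covAlong (𝓡 2) 𝓘(ℝ, Plane) (fun z ↦ γ (σ z)) (fun z ↦ velocity (𝓡 2) γ (σ z)) u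
      (coordVec i) = partialDeriv σ i u • curveDeriv (𝓡 2) γ (velocity (𝓡 2) γ) (σ u) := by
    refine (covAlong_comp hvel.diffAlong hσ (coordVec i)).trans ?_
    have h4 : mfderiv 𝓘(ℝ, Plane) 𝓘(ℝ, ℝ) σ u (coordVec i) = partialDeriv σ i u • (1 : ℝ) := by
      rw [mfderiv_eq_fderiv]; exact (mul_one (partialDeriv σ i u)).symm
    rw [h4]
    exact covAlong_smul_left γ _ (σ u) _ (1 : ℝ)
  rw [h1, h2, h3, inner_add_left, real_inner_smul_left, real_inner_smul_left,
    real_inner_smul_left, hp.inner_velocity_baseJ hθ hpr hγ hu]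
  unfold ContactMetricStructure.signedCurvature
  ring

/-- The second fundamental form of a Hopf cylinder. -/
theorem inner_patchDeriv_partialVec (hp : IsHopfPatch pr γ J U σ Φ) (hS : S.IsSasaki)
    (hθ : S.IsRegularFlow θ)
    (hpr : S.IsBoothbyWangFibering θ pr) (hγ : IsUnitSpeedCurve (𝓡 2) γ J) (hu : u ∈ U)
    (i j : Fin 2) :
    (inner ℝ (patchDeriv (𝓡 3) Φ i (partialVec (𝓡 3) Φ j) u) (patchNormal S σ Φ u) : ℝ) =
      partialDeriv σ i u * partialDeriv σ j u * S.signedCurvature pr γ (σ u)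
        - partialDeriv σ i u * ηPartial S Φ j u - ηPartial S Φ i u * partialDeriv σ j u := by
  obtain ⟨G, hG⟩ := exists_variation ((hp.eventually_mem hu).mono fun z hz ↦
    hp.smoothAlong_patchNormal hθ hpr hγ hz)
  have hGu := hG.self_of_nhds
  have hbase := hGu.2.1
  have e1 : (inner ℝ (patchDeriv (𝓡 3) Φ i (partialVec (𝓡 3) Φ j) u) (patchNormal S σ Φ u) : ℝ) =
      inner ℝ (covAlong (𝓡 3) 𝓘(ℝ, Plane × ℝ) G
        (fun z ↦ mfderiv 𝓘(ℝ, Plane × ℝ) (𝓡 3) G z (coordVec j, 0)) (u, 0) (coordVec i, 0))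
        (mfderiv 𝓘(ℝ, Plane × ℝ) (𝓡 3) G (u, 0) (0, 1)) :=
    inner_congr hbase.symm (covAlong_variation hGu.1 (hG.mono fun z hz ↦ ⟨hz.2.1, hz.2.2.1⟩)
      (coordVec i) (coordVec j)) hGu.2.2.2.symm
  have e2 := hpr.inner_covAlong_mfderiv hS hθ hGu.1 (coordVec i, 0) (coordVec j, 0) (0, 1)
    ((ContactMetricStructure.η_congr hbase hGu.2.2.2).trans η_patchNormal)
  have e3 (k : Fin 2) : S.ηComp G (coordVec k, 0) (u, 0) = ηPartial S Φ k u :=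
    ContactMetricStructure.η_congr hbase (hGu.2.2.1 _)
  have e4 (k : Fin 2) : (inner ℝ (mfderiv 𝓘(ℝ, Plane × ℝ) (𝓡 3) G (u, 0) (coordVec k, 0))
      (S.φ (G (u, 0)) (mfderiv 𝓘(ℝ, Plane × ℝ) (𝓡 3) G (u, 0) (0, 1))) : ℝ) =
      -partialDeriv σ k u := by
    have h1 : (inner ℝ (partialVec (𝓡 3) Φ k u) (S.φ (Φ u) (patchNormal S σ Φ u)) : ℝ) =
        -partialDeriv σ k u := by
      rw [hp.φ_patchNormal hθ hpr hγ hu, inner_neg_right,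
        hp.inner_partialVec_patchTangent hθ hpr hγ hu]
    rw [← h1]
    exact inner_congr hbase (hGu.2.2.1 _) (ContactMetricStructure.phi_congr hbase hGu.2.2.2)
  have hprG : ContMDiffAt 𝓘(ℝ, Plane × ℝ) (𝓡 2) ∞ (fun z ↦ pr (G z)) (u, 0) :=
    hpr.smooth.contMDiffAt.comp (u, (0 : ℝ)) hGu.1
  have e5 : (inner ℝ (covAlong (𝓡 2) 𝓘(ℝ, Plane × ℝ) (fun y ↦ pr (G y))
          (fun y ↦ mfderiv 𝓘(ℝ, Plane × ℝ) (𝓡 2) (fun y ↦ pr (G y)) y (coordVec j, 0)) (u, 0)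
          (coordVec i, 0))
        (mfderiv 𝓘(ℝ, Plane × ℝ) (𝓡 2) (fun y ↦ pr (G y)) (u, 0) (0, 1)) : ℝ) =
      partialDeriv σ i u * partialDeriv σ j u * S.signedCurvature pr γ (σ u) := by
    rw [← hp.inner_covAlong_curve hθ hpr hγ hu i j]
    refine inner_congr ((congrArg pr hbase).trans (hp.pr_eq hu)) ?_ ?_
    · refine (covAlong_variation hprG ?_ (coordVec i) (coordVec j)).symm
      filter_upwards [hG, hp.eventually_mem hu] with z hz hzU
      refine ⟨(congrArg pr hz.2.1).trans (hp.pr_eq hzU), fun c ↦ ?_⟩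
      rw [hpr.mfderiv_comp (hz.1.mdifferentiableAt (by simp)), hp.mfderiv_curve_comp hγ hzU,
        ← hp.mfderiv_pr hpr hγ hzU]
      exact mfderiv_cast hz.2.1 (hz.2.2.1 c)
    · rw [hpr.mfderiv_comp (hGu.1.mdifferentiableAt (by simp)), hp.baseJ_velocity hθ hpr hγ hu]
      exact mfderiv_cast hbase hGu.2.2.2
  rw [e1, e2, e3, e3, e4, e4, e5]
  ring

end IsHopfPatch

end Patch

/-! ## The mean curvature and the normal Laplacian of a Hopf cylinder -/

theorem contDiffAt_deriv {f : ℝ → ℝ} {x : ℝ} (hf : ContDiffAt ℝ ∞ f x) :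
    ContDiffAt ℝ ∞ (deriv f) x :=
  (hf.fderiv_right (m := ∞) (by simp)).clm_apply contDiffAt_const

section PatchLaplacian

variable {M : Type*} [TopologicalSpace M] [ChartedSpace R3 M] [IsManifold (𝓡 3) ∞ M]
  [RiemannianBundle (fun x : M ↦ TangentSpace (𝓡 3) x)]
  [IsContMDiffRiemannianBundle (𝓡 3) ∞ R3 (fun x : M ↦ TangentSpace (𝓡 3) x)]
  {B : Type*} [TopologicalSpace B] [ChartedSpace R2 B] [IsManifold (𝓡 2) ∞ B]
  [RiemannianBundle (fun x : B ↦ TangentSpace (𝓡 2) x)]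
  [IsContMDiffRiemannianBundle (𝓡 2) ∞ R2 (fun x : B ↦ TangentSpace (𝓡 2) x)]
  {S : ContactMetricStructure M} {θ : ℝ → M → M} {pr : M → B} {γ : ℝ → B} {J : Set ℝ}
  {U : Set Plane} {σ : Plane → ℝ} {Φ : Plane → M} {u : Plane}

namespace IsHopfPatch

theorem firstForm_apply (hp : IsHopfPatch pr γ J U σ Φ) (hθ : S.IsRegularFlow θ)
    (hpr : S.IsBoothbyWangFibering θ pr) (hγ : IsUnitSpeedCurve (𝓡 2) γ J) (hu : u ∈ U)
    (i j : Fin 2) : firstForm (𝓡 3) Φ u i j =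
      partialDeriv σ i u * partialDeriv σ j u + ηPartial S Φ i u * ηPartial S Φ j u := by
  have h : firstForm (𝓡 3) Φ u i j =
    inner ℝ (partialVec (𝓡 3) Φ i u) (partialVec (𝓡 3) Φ j u) := rfl
  rw [h, hp.partialVec_eq hθ hpr hγ hu i, hp.partialVec_eq hθ hpr hγ hu j]
  simp only [inner_add_left, inner_add_right, real_inner_smul_left, real_inner_smul_right,
    S.inner_ξ, S.inner_ξ_right, map_smul, smul_eq_mul, S.η_ξ, hp.η_patchTangent hθ hpr hγ hu,
    hp.inner_patchTangent hθ hpr hγ hu]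
  ring

theorem firstForm_inv (hp : IsHopfPatch pr γ J U σ Φ) (hθ : S.IsRegularFlow θ)
    (hpr : S.IsBoothbyWangFibering θ pr) (hγ : IsUnitSpeedCurve (𝓡 2) γ J) (hu : u ∈ U) :
    (firstForm (𝓡 3) Φ u)⁻¹ = (frameDet S σ Φ u ^ 2)⁻¹ •
      !![partialDeriv σ 1 u ^ 2 + ηPartial S Φ 1 u ^ 2,
        -(partialDeriv σ 0 u * partialDeriv σ 1 u + ηPartial S Φ 0 u * ηPartial S Φ 1 u);
        -(partialDeriv σ 0 u * partialDeriv σ 1 u + ηPartial S Φ 0 u * ηPartial S Φ 1 u),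
        partialDeriv σ 0 u ^ 2 + ηPartial S Φ 0 u ^ 2] := by
  have hD := hp.frameDet_ne_zero hθ hpr hγ hu
  have h1 : firstForm (𝓡 3) Φ u =
      !![partialDeriv σ 0 u ^ 2 + ηPartial S Φ 0 u ^ 2,
        partialDeriv σ 0 u * partialDeriv σ 1 u + ηPartial S Φ 0 u * ηPartial S Φ 1 u;
        partialDeriv σ 0 u * partialDeriv σ 1 u + ηPartial S Φ 0 u * ηPartial S Φ 1 u,
        partialDeriv σ 1 u ^ 2 + ηPartial S Φ 1 u ^ 2] := by
    ext i j
    rw [hp.firstForm_apply hθ hpr hγ hu]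
    fin_cases i <;> fin_cases j <;> simp <;> ring
  have hdet : (firstForm (𝓡 3) Φ u).det = frameDet S σ Φ u ^ 2 := by
    rw [h1, Matrix.det_fin_two_of, frameDet]; ring
  rw [Matrix.inv_def, hdet, h1, Matrix.adjugate_fin_two_of, Ring.inverse_eq_inv']

/-- The inverse of the induced metric, contracted with the frame coefficients. -/
theorem sum_firstForm_inv (hp : IsHopfPatch pr γ J U σ Φ) (hθ : S.IsRegularFlow θ)
    (hpr : S.IsBoothbyWangFibering θ pr) (hγ : IsUnitSpeedCurve (𝓡 2) γ J) (hu : u ∈ U) :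
    (∑ i, ∑ j, (firstForm (𝓡 3) Φ u)⁻¹ i j * (partialDeriv σ i u * partialDeriv σ j u) = 1) ∧
    (∑ i, ∑ j, (firstForm (𝓡 3) Φ u)⁻¹ i j * (partialDeriv σ i u * ηPartial S Φ j u) = 0) ∧
    (∑ i, ∑ j, (firstForm (𝓡 3) Φ u)⁻¹ i j * (ηPartial S Φ i u * partialDeriv σ j u) = 0) ∧
    (∑ i, ∑ j, (firstForm (𝓡 3) Φ u)⁻¹ i j * (ηPartial S Φ i u * ηPartial S Φ j u) = 1) := by
  have hD := hp.frameDet_ne_zero hθ hpr hγ hu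
  rw [hp.firstForm_inv hθ hpr hγ hu]
  simp only [Fin.sum_univ_two, Matrix.smul_apply, Matrix.of_apply, Matrix.cons_val_zero,
    Matrix.cons_val_one, Matrix.cons_val', Matrix.cons_val_fin_one, smul_eq_mul]
  refine ⟨?_, ?_, ?_, ?_⟩ <;> field_simp <;> unfold frameDet <;> ring

theorem normalPart_eq (hp : IsHopfPatch pr γ J U σ Φ) (hθ : S.IsRegularFlow θ)
    (hpr : S.IsBoothbyWangFibering θ pr) (hγ : IsUnitSpeedCurve (𝓡 2) γ J) (hu : u ∈ U)
    (w : TangentSpace (𝓡 3) (Φ u)) :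
    normalPart (𝓡 3) Φ u w = (inner ℝ w (patchNormal S σ Φ u) : ℝ) • patchNormal S σ Φ u := by
  set T := patchTangent S σ Φ u with hT
  have hw := S.eq_frame_sum (hp.η_patchTangent hθ hpr hγ hu) (hp.inner_patchTangent hθ hpr hγ hu) w
  obtain ⟨h1, h2, h3, h4⟩ := hp.sum_firstForm_inv hθ hpr hγ hu
  have hin (i : Fin 2) : (inner ℝ w (partialVec (𝓡 3) Φ i u) : ℝ) =
      partialDeriv σ i u * inner ℝ w T + ηPartial S Φ i u * S.η (Φ u) w := by
    rw [hp.partialVec_eq hθ hpr hγ hu i, inner_add_right, real_inner_smul_right,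
      real_inner_smul_right, S.inner_ξ_right]
  have hsum : ∑ i, ∑ j, ((firstForm (𝓡 3) Φ u)⁻¹ i j *
      (inner ℝ w (partialVec (𝓡 3) Φ i u) : ℝ)) • partialVec (𝓡 3) Φ j u =
      (inner ℝ w T : ℝ) • T + S.η (Φ u) w • S.ξ (Φ u) := by
    have h5 (i j : Fin 2) : ((firstForm (𝓡 3) Φ u)⁻¹ i j *
        (inner ℝ w (partialVec (𝓡 3) Φ i u) : ℝ)) • partialVec (𝓡 3) Φ j u =
        ((firstForm (𝓡 3) Φ u)⁻¹ i j * (partialDeriv σ i u * partialDeriv σ j u)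
            * inner ℝ w T
          + (firstForm (𝓡 3) Φ u)⁻¹ i j * (ηPartial S Φ i u * partialDeriv σ j u)
            * S.η (Φ u) w) • T
        + ((firstForm (𝓡 3) Φ u)⁻¹ i j * (partialDeriv σ i u * ηPartial S Φ j u)
            * inner ℝ w T
          + (firstForm (𝓡 3) Φ u)⁻¹ i j * (ηPartial S Φ i u * ηPartial S Φ j u)
            * S.η (Φ u) w) • S.ξ (Φ u) := by
      rw [hin, hp.partialVec_eq hθ hpr hγ hu j, smul_add, smul_smul, smul_smul]
      congr 2 <;> ring
    simp only [h5, Finset.sum_add_distrib, ← Finset.sum_smul, ← Finset.sum_mul, h1, h2, h3, h4]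
    simp
  rw [normalPart, hsum]
  nth_rewrite 1 [hw]
  rw [patchNormal]
  abel

theorem covAlong_patchNormal_inner (hp : IsHopfPatch pr γ J U σ Φ) (hθ : S.IsRegularFlow θ)
    (hpr : S.IsBoothbyWangFibering θ pr) (hγ : IsUnitSpeedCurve (𝓡 2) γ J) (hu : u ∈ U)
    (c : Plane) :
    (inner ℝ (covAlong (𝓡 3) 𝓘(ℝ, Plane) Φ (patchNormal S σ Φ) u c)
      (patchNormal S σ Φ u) : ℝ) = 0 := by
  have hd := (hp.smoothAlong_patchNormal hθ hpr hγ hu).diffAlong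
  have h1 := fderiv_inner hd hd c
  have h2 : (fun y ↦ (inner ℝ (patchNormal S σ Φ y) (patchNormal S σ Φ y) : ℝ)) =ᶠ[𝓝 u]
      fun _ ↦ (1 : ℝ) :=
    (hp.eventually_mem hu).mono fun z hz ↦ hp.inner_patchNormal hθ hpr hγ hz
  rw [h2.fderiv_eq, fderiv_fun_const, real_inner_comm (patchNormal S σ Φ u)] at h1
  have h3 : (0 : ℝ) = _ := h1
  rw [real_inner_comm]
  linarith

theorem patchNormalDeriv_smul (hp : IsHopfPatch pr γ J U σ Φ) (hθ : S.IsRegularFlow θ)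
    (hpr : S.IsBoothbyWangFibering θ pr) (hγ : IsUnitSpeedCurve (𝓡 2) γ J) (hu : u ∈ U)
    {V : ∀ u, TangentSpace (𝓡 3) (Φ u)} {f : Plane → ℝ}
    (hV : ∀ z ∈ U, V z = f z • patchNormal S σ Φ z) (hf : DifferentiableAt ℝ f u) (i : Fin 2) :
    patchNormalDeriv (𝓡 3) Φ i V u = partialDeriv f i u • patchNormal S σ Φ u := by
  have h1 : covAlong (𝓡 3) 𝓘(ℝ, Plane) Φ V u (coordVec i) =
      covAlong (𝓡 3) 𝓘(ℝ, Plane) Φ (fun z ↦ f z • patchNormal S σ Φ z) u (coordVec i) :=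
    covAlong_congr ((hp.eventually_mem hu).mono fun z hz ↦ ⟨rfl, hV z hz⟩) _
  have h2 := covAlong_smul hf.mdifferentiableAt
    (hp.smoothAlong_patchNormal hθ hpr hγ hu).diffAlong (coordVec i)
  have h3 : mvfderiv 𝓘(ℝ, Plane) f u (coordVec i) = partialDeriv f i u := mvfderiv_eq_fderiv _ _ _
  rw [patchNormalDeriv, hp.normalPart_eq hθ hpr hγ hu, patchDeriv, h1, h2, inner_add_left,
    real_inner_smul_left, real_inner_smul_left, hp.covAlong_patchNormal_inner hθ hpr hγ hu,
    hp.inner_patchNormal hθ hpr hγ hu, h3]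
  simp

theorem patchMeanCurvature_eq (hp : IsHopfPatch pr γ J U σ Φ) (hS : S.IsSasaki)
    (hθ : S.IsRegularFlow θ)
    (hpr : S.IsBoothbyWangFibering θ pr) (hγ : IsUnitSpeedCurve (𝓡 2) γ J) (hu : u ∈ U) :
    patchMeanCurvature (𝓡 3) Φ u =
      (S.signedCurvature pr γ (σ u) / 2) • patchNormal S σ Φ u := by
  obtain ⟨h1, h2, h3, -⟩ := hp.sum_firstForm_inv hθ hpr hγ hu
  have h5 (i j : Fin 2) : (firstForm (𝓡 3) Φ u)⁻¹ i j •
      patchNormalDeriv (𝓡 3) Φ i (partialVec (𝓡 3) Φ j) u =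
      ((firstForm (𝓡 3) Φ u)⁻¹ i j * (partialDeriv σ i u * partialDeriv σ j u)
          * S.signedCurvature pr γ (σ u)
        - (firstForm (𝓡 3) Φ u)⁻¹ i j * (partialDeriv σ i u * ηPartial S Φ j u)
        - (firstForm (𝓡 3) Φ u)⁻¹ i j * (ηPartial S Φ i u * partialDeriv σ j u))
        • patchNormal S σ Φ u := by
    rw [patchNormalDeriv, hp.normalPart_eq hθ hpr hγ hu,
      hp.inner_patchDeriv_partialVec hS hθ hpr hγ hu, smul_smul]
    congr 1; ring
  simp only [patchMeanCurvature, h5, ← Finset.sum_smul, Finset.sum_sub_distrib, ← Finset.sum_mul,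
    h1, h2, h3, smul_smul]
  congr 1; ring

theorem partialDeriv_partialDeriv_comm (hp : IsHopfPatch pr γ J U σ Φ) (hu : u ∈ U)
    (i j : Fin 2) : partialDeriv (partialDeriv σ j) i u = partialDeriv (partialDeriv σ i) j u := by
  have hd : DifferentiableAt ℝ (fderiv ℝ σ) u :=
    ((hp.contDiffAt hu).fderiv_right (m := 1) (by norm_cast)).differentiableAt (by simp)
  have key (i j : Fin 2) : partialDeriv (partialDeriv σ j) i u =
      fderiv ℝ (fderiv ℝ σ) u (coordVec i) (coordVec j) := by
    change fderiv ℝ (fun z ↦ fderiv ℝ σ z (coordVec j)) u (coordVec i) = _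
    rw [fderiv_clm_apply hd (differentiableAt_const _)]
    simp
  have hs : IsSymmSndFDerivAt ℝ σ u := (hp.contDiffAt hu).isSymmSndFDerivAt
    (by simp only [minSmoothness_of_isRCLikeNormedField]; norm_cast)
  rw [key, key, hs.eq]

/-- The contact form restricts to a closed form on a Hopf cylinder. -/
theorem partialDeriv_ηPartial_comm (hp : IsHopfPatch pr γ J U σ Φ) (hS : S.IsSasaki)
    (hθ : S.IsRegularFlow θ)
    (hpr : S.IsBoothbyWangFibering θ pr) (hγ : IsUnitSpeedCurve (𝓡 2) γ J) (hu : u ∈ U)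
    (i j : Fin 2) :
    partialDeriv (ηPartial S Φ j) i u = partialDeriv (ηPartial S Φ i) j u := by
  have h := S.fderiv_ηComp_sub hS (hp.contMDiffAt hu) (coordVec i) (coordVec j)
  have h2 : (inner ℝ (partialVec (𝓡 3) Φ i u)
      (S.φ (Φ u) (partialVec (𝓡 3) Φ j u)) : ℝ) = 0 := by
    rw [hp.φ_partialVec hθ hpr hγ hu, real_inner_smul_right,
      hp.inner_partialVec_patchNormal hθ hpr hγ hu, mul_zero]
  have h3 : partialDeriv (ηPartial S Φ j) i u - partialDeriv (ηPartial S Φ i) j u =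
    2 * (inner ℝ (partialVec (𝓡 3) Φ i u) (S.φ (Φ u) (partialVec (𝓡 3) Φ j u)) : ℝ) := h
  rw [h2] at h3
  linarith

theorem fderiv_firstForm (hp : IsHopfPatch pr γ J U σ Φ)
    (hθ : S.IsRegularFlow θ)
    (hpr : S.IsBoothbyWangFibering θ pr) (hγ : IsUnitSpeedCurve (𝓡 2) γ J) (hu : u ∈ U)
    (i j k : Fin 2) :
    fderiv ℝ (fun x ↦ firstForm (𝓡 3) Φ x i j) u (coordVec k) =
      partialDeriv σ i u * partialDeriv (partialDeriv σ j) k u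
        + partialDeriv σ j u * partialDeriv (partialDeriv σ i) k u
        + (ηPartial S Φ i u * partialDeriv (ηPartial S Φ j) k u
        + ηPartial S Φ j u * partialDeriv (ηPartial S Φ i) k u) := by
  have hs (i : Fin 2) : DifferentiableAt ℝ (partialDeriv σ i) u :=
    (hp.contDiffAt_partialDeriv hu i).differentiableAt (by simp)
  have ht (i : Fin 2) : DifferentiableAt ℝ (ηPartial S Φ i) u :=
    (hp.contDiffAt_ηPartial hu i).differentiableAt (by simp)
  have h1 : (fun x ↦ firstForm (𝓡 3) Φ x i j) =ᶠ[𝓝 u] fun x ↦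
      partialDeriv σ i x * partialDeriv σ j x + ηPartial S Φ i x * ηPartial S Φ j x :=
    (hp.eventually_mem hu).mono fun z hz ↦ hp.firstForm_apply hθ hpr hγ hz i j
  have hm1 : DifferentiableAt ℝ (fun x ↦ partialDeriv σ i x * partialDeriv σ j x) u :=
    (hs i).mul (hs j)
  have hm2 : DifferentiableAt ℝ (fun x ↦ ηPartial S Φ i x * ηPartial S Φ j x) u :=
    (ht i).mul (ht j)
  rw [h1.fderiv_eq, fderiv_fun_add hm1 hm2, fderiv_fun_mul (hs i) (hs j),
    fderiv_fun_mul (ht i) (ht j)]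
  rfl

theorem inducedChristoffel_eq (hp : IsHopfPatch pr γ J U σ Φ) (hS : S.IsSasaki)
    (hθ : S.IsRegularFlow θ)
    (hpr : S.IsBoothbyWangFibering θ pr) (hγ : IsUnitSpeedCurve (𝓡 2) γ J) (hu : u ∈ U)
    (k i j : Fin 2) : inducedChristoffel (𝓡 3) Φ k i j u =
      ∑ l, (firstForm (𝓡 3) Φ u)⁻¹ k l *
        (partialDeriv (partialDeriv σ j) i u * partialDeriv σ l u
          + partialDeriv (ηPartial S Φ j) i u * ηPartial S Φ l u) := by
  unfold inducedChristoffel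
  refine Finset.sum_congr rfl fun l _ ↦ ?_
  rw [hp.fderiv_firstForm hθ hpr hγ hu, hp.fderiv_firstForm hθ hpr hγ hu,
    hp.fderiv_firstForm hθ hpr hγ hu, hp.partialDeriv_partialDeriv_comm hu j i,
    hp.partialDeriv_partialDeriv_comm hu j l, hp.partialDeriv_partialDeriv_comm hu i l,
    hp.partialDeriv_ηPartial_comm hS hθ hpr hγ hu j i,
    hp.partialDeriv_ηPartial_comm hS hθ hpr hγ hu j l,
    hp.partialDeriv_ηPartial_comm hS hθ hpr hγ hu i l]
  ring

/-- The parameter of the curve is a harmonic function, with vanishing Hessian. -/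
theorem sum_inducedChristoffel (hp : IsHopfPatch pr γ J U σ Φ) (hS : S.IsSasaki)
    (hθ : S.IsRegularFlow θ)
    (hpr : S.IsBoothbyWangFibering θ pr) (hγ : IsUnitSpeedCurve (𝓡 2) γ J) (hu : u ∈ U)
    (i j : Fin 2) : ∑ k, inducedChristoffel (𝓡 3) Φ k i j u * partialDeriv σ k u =
      partialDeriv (partialDeriv σ j) i u := by
  obtain ⟨h1, h2, -, -⟩ := hp.sum_firstForm_inv hθ hpr hγ hu
  calc _ = partialDeriv (partialDeriv σ j) i u * (∑ k, ∑ l, (firstForm (𝓡 3) Φ u)⁻¹ k l *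
          (partialDeriv σ k u * partialDeriv σ l u))
        + partialDeriv (ηPartial S Φ j) i u * (∑ k, ∑ l, (firstForm (𝓡 3) Φ u)⁻¹ k l *
          (partialDeriv σ k u * ηPartial S Φ l u)) := by
        simp only [hp.inducedChristoffel_eq hS hθ hpr hγ hu, Fin.sum_univ_two]
        ring
    _ = _ := by rw [h1, h2]; ring

theorem patchNormalLaplacian_eq (hp : IsHopfPatch pr γ J U σ Φ) (hS : S.IsSasaki)
    (hθ : S.IsRegularFlow θ)
    (hpr : S.IsBoothbyWangFibering θ pr) (hγ : IsUnitSpeedCurve (𝓡 2) γ J)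
    (hκ : ContDiffOn ℝ ∞ (S.signedCurvature pr γ) J) (hu : u ∈ U) :
    patchNormalLaplacian (𝓡 3) Φ (patchMeanCurvature (𝓡 3) Φ) u =
      (-(deriv (deriv (S.signedCurvature pr γ)) (σ u) / 2)) • patchNormal S σ Φ u := by
  set κ := S.signedCurvature pr γ with hκdef
  have hκs (z) (hz : z ∈ U) : ContDiffAt ℝ ∞ κ (σ z) :=
    hκ.contDiffAt (hγ.isOpen.mem_nhds (hp.mapsTo z hz).1)
  have hκd (z) (hz : z ∈ U) : DifferentiableAt ℝ (deriv κ) (σ z) :=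
    (contDiffAt_deriv (hκs z hz)).differentiableAt (by simp)
  have hσd (z) (hz : z ∈ U) : DifferentiableAt ℝ σ z :=
    (hp.contDiffAt hz).differentiableAt (by simp)
  have h1 (z) (hz : z ∈ U) (j : Fin 2) :
      patchNormalDeriv (𝓡 3) Φ j (patchMeanCurvature (𝓡 3) Φ) z =
        (deriv κ (σ z) * partialDeriv σ j z / 2) • patchNormal S σ Φ z := by
    have hd : HasFDerivAt (fun z ↦ κ (σ z) / 2) ((2 : ℝ)⁻¹ • (deriv κ (σ z) • fderiv ℝ σ z)) z := by
      have := (((hκs z hz).differentiableAt (by simp)).hasDerivAt.comp_hasFDerivAt z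
        (hσd z hz).hasFDerivAt).mul_const (2 : ℝ)⁻¹
      simp only [div_eq_mul_inv]; exact this
    rw [hp.patchNormalDeriv_smul hθ hpr hγ hz
      (fun w hw ↦ hp.patchMeanCurvature_eq hS hθ hpr hγ hw) hd.differentiableAt, partialDeriv,
      hd.fderiv]
    congr 1
    change (2 : ℝ)⁻¹ * (deriv κ (σ z) * partialDeriv σ j z) = _
    ring
  have h2 (i j : Fin 2) :
      patchNormalDeriv (𝓡 3) Φ i (patchNormalDeriv (𝓡 3) Φ j (patchMeanCurvature (𝓡 3) Φ)) u =
        (deriv (deriv κ) (σ u) / 2 * (partialDeriv σ i u * partialDeriv σ j u)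
          + deriv κ (σ u) / 2 * partialDeriv (partialDeriv σ j) i u) • patchNormal S σ Φ u := by
    have hd : HasFDerivAt (fun z ↦ deriv κ (σ z) * partialDeriv σ j z / 2)
        ((2 : ℝ)⁻¹ • (deriv κ (σ u) • fderiv ℝ (partialDeriv σ j) u
          + partialDeriv σ j u • (deriv (deriv κ) (σ u) • fderiv ℝ σ u))) u := by
      have := (((hκd u hu).hasDerivAt.comp_hasFDerivAt u (hσd u hu).hasFDerivAt).mul
        ((hp.contDiffAt_partialDeriv hu j).differentiableAt (by simp)).hasFDerivAt).mul_const
          (2 : ℝ)⁻¹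
      simp only [div_eq_mul_inv]; exact this
    rw [hp.patchNormalDeriv_smul hθ hpr hγ hu (fun z hz ↦ h1 z hz j) hd.differentiableAt,
      partialDeriv, hd.fderiv]
    congr 1
    change (2 : ℝ)⁻¹ * (deriv κ (σ u) * partialDeriv (partialDeriv σ j) i u
      + partialDeriv σ j u * (deriv (deriv κ) (σ u) * partialDeriv σ i u)) = _
    ring
  have h3 (i j : Fin 2) : ∑ k, inducedChristoffel (𝓡 3) Φ k i j u •
      patchNormalDeriv (𝓡 3) Φ k (patchMeanCurvature (𝓡 3) Φ) u =
        (deriv κ (σ u) / 2 * partialDeriv (partialDeriv σ j) i u) • patchNormal S σ Φ u := by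
    simp only [h1 u hu, smul_smul, ← Finset.sum_smul]
    congr 1
    rw [← hp.sum_inducedChristoffel hS hθ hpr hγ hu i j, Finset.mul_sum]
    exact Finset.sum_congr rfl fun k _ ↦ by ring
  obtain ⟨h4, -⟩ := hp.sum_firstForm_inv hθ hpr hγ hu
  have h5 (i j : Fin 2) : (firstForm (𝓡 3) Φ u)⁻¹ i j •
      (patchNormalDeriv (𝓡 3) Φ i (patchNormalDeriv (𝓡 3) Φ j (patchMeanCurvature (𝓡 3) Φ)) u
        - ∑ k, inducedChristoffel (𝓡 3) Φ k i j u •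
          patchNormalDeriv (𝓡 3) Φ k (patchMeanCurvature (𝓡 3) Φ) u) =
      ((firstForm (𝓡 3) Φ u)⁻¹ i j * (partialDeriv σ i u * partialDeriv σ j u)
        * (deriv (deriv κ) (σ u) / 2)) • patchNormal S σ Φ u := by
    rw [h2, h3, ← sub_smul, smul_smul]
    congr 1; ring
  simp only [patchNormalLaplacian, h5, ← Finset.sum_smul, ← Finset.sum_mul, h4, one_mul, neg_smul]

end IsHopfPatch

end PatchLaplacian

/-! ## The equation of the harmonic oscillator -/

section Oscillator

variable {κ : ℝ → ℝ} {J : Set ℝ}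

theorem exists_eq_const_of_hasDerivAt_zero {f : ℝ → ℝ} (hJ : IsOpen J) (hJc : J.OrdConnected)
    (hf : ∀ s ∈ J, HasDerivAt f 0 s) : ∃ c, ∀ s ∈ J, f s = c :=
  hJ.exists_is_const_of_deriv_eq_zero hJc.isPreconnected
    (fun s hs ↦ (hf s hs).differentiableAt.differentiableWithinAt) fun s hs ↦ (hf s hs).deriv

theorem deriv_deriv_of_hasDerivAt {f f' f'' : ℝ → ℝ} (hJ : IsOpen J) (hκ : ∀ s ∈ J, κ s = f s)
    (h1 : ∀ s, HasDerivAt f (f' s) s) (h2 : ∀ s, HasDerivAt f' (f'' s) s) {s : ℝ} (hs : s ∈ J) :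
    deriv (deriv κ) s = f'' s := by
  have h3 : κ =ᶠ[𝓝 s] f := eventually_of_mem (hJ.mem_nhds hs) hκ
  have h4 : deriv f = f' := funext fun s ↦ (h1 s).deriv
  rw [h3.deriv.deriv_eq, h4, (h2 s).deriv]

theorem hasDerivAt_comp_const_mul {f : ℝ → ℝ} {f' : ℝ} (m s : ℝ) (hf : HasDerivAt f f' (m * s)) :
    HasDerivAt (fun s ↦ f (m * s)) (m * f') s := by
  have h := hf.comp s ((hasDerivAt_id s).const_mul m)
  rw [mul_one, mul_comm] at h
  exact h

theorem oscillator_iff (hJ : IsOpen J) (hJc : J.OrdConnected) (hκ : ContDiffOn ℝ ∞ κ J) (lam : ℝ) :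
    (∀ s ∈ J, deriv (deriv κ) s + lam * κ s = 0) ↔
      (lam = 0 ∧ ∃ a b : ℝ, ∀ s ∈ J, κ s = a * s + b) ∨
      (0 < lam ∧ ∃ a b : ℝ, ∀ s ∈ J, κ s = a * Real.cos (√lam * s) + b * Real.sin (√lam * s)) ∨
      (lam < 0 ∧ ∃ a b : ℝ, ∀ s ∈ J, κ s =
        a * Real.exp (√(-lam) * s) + b * Real.exp (-√(-lam) * s)) := by
  have hd (s) (hs : s ∈ J) : HasDerivAt κ (deriv κ s) s :=
    ((hκ.contDiffAt (hJ.mem_nhds hs)).differentiableAt (by simp)).hasDerivAt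
  have hdd (s) (hs : s ∈ J) : HasDerivAt (deriv κ) (deriv (deriv κ) s) s :=
    ((contDiffAt_deriv (hκ.contDiffAt (hJ.mem_nhds hs))).differentiableAt (by simp)).hasDerivAt
  have hcos (m s : ℝ) : HasDerivAt (fun s ↦ Real.cos (m * s)) (m * -Real.sin (m * s)) s :=
    hasDerivAt_comp_const_mul m s (Real.hasDerivAt_cos _)
  have hsin (m s : ℝ) : HasDerivAt (fun s ↦ Real.sin (m * s)) (m * Real.cos (m * s)) s :=
    hasDerivAt_comp_const_mul m s (Real.hasDerivAt_sin _)
  have hexp (m s : ℝ) : HasDerivAt (fun s ↦ Real.exp (m * s)) (m * Real.exp (m * s)) s :=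
    hasDerivAt_comp_const_mul m s (Real.hasDerivAt_exp _)
  constructor
  · intro h
    rcases lt_trichotomy lam 0 with hl | hl | hl
    · refine Or.inr (Or.inr ⟨hl, ?_⟩)
      have hm : 0 < √(-lam) := Real.sqrt_pos.2 (by linarith)
      have hm2 : √(-lam) * √(-lam) = -lam := Real.mul_self_sqrt (by linarith)
      set m := √(-lam)
      have key (k : ℝ) (hk : k * k = -lam) :
          ∃ c, ∀ s ∈ J, (deriv κ s + k * κ s) * Real.exp (-k * s) = c := by
        refine exists_eq_const_of_hasDerivAt_zero hJ hJc fun s hs ↦ ?_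
        refine (((hdd s hs).add ((hd s hs).const_mul k)).mul (hexp (-k) s)).congr_deriv ?_
        simp only [Pi.add_apply]
        linear_combination Real.exp (-k * s) * (h s hs) - κ s * Real.exp (-k * s) * hk
      obtain ⟨c, hc⟩ := key m hm2
      obtain ⟨d, hd⟩ := key (-m) (by linarith)
      refine ⟨c / (2 * m), -d / (2 * m), fun s hs ↦ ?_⟩
      have h1 := hc s hs
      have h2 := hd s hs
      have h3 : Real.exp (m * s) * Real.exp (-m * s) = 1 := by
        rw [← Real.exp_add]; simp
      rw [neg_neg] at h2
      rw [← mul_right_inj' (mul_pos two_pos hm).ne']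
      have h4 : 2 * m * (c / (2 * m) * Real.exp (m * s) + -d / (2 * m) * Real.exp (-m * s)) =
          c * Real.exp (m * s) - d * Real.exp (-m * s) := by
        field_simp
        ring
      rw [h4]
      rw [← h1, ← h2]
      linear_combination (-2 * m * κ s) * h3
    · refine Or.inl ⟨hl, ?_⟩
      subst hl
      obtain ⟨a, ha⟩ := exists_eq_const_of_hasDerivAt_zero (f := deriv κ) hJ hJc fun s hs ↦ by
        have := h s hs
        rw [zero_mul, add_zero] at this
        rw [← this]; exact hdd s hs
      obtain ⟨b, hb⟩ := exists_eq_const_of_hasDerivAt_zero (f := fun s ↦ κ s - a * s) hJ hJc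
        fun s hs ↦ ((hd s hs).sub ((hasDerivAt_id s).const_mul a)).congr_deriv (by
          rw [ha s hs]; ring)
      exact ⟨a, b, fun s hs ↦ by linarith [hb s hs]⟩
    · refine Or.inr (Or.inl ⟨hl, ?_⟩)
      have hm : 0 < √lam := Real.sqrt_pos.2 hl
      have hm2 : √lam * √lam = lam := Real.mul_self_sqrt hl.le
      set m := √lam
      obtain ⟨a, ha⟩ := exists_eq_const_of_hasDerivAt_zero
        (f := fun s ↦ m * (κ s * Real.cos (m * s)) - deriv κ s * Real.sin (m * s)) hJ hJc
        fun s hs ↦ ((((hd s hs).mul (hcos m s)).const_mul m).sub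
          ((hdd s hs).mul (hsin m s))).congr_deriv (by
            linear_combination (-Real.sin (m * s)) * (h s hs)
              - κ s * Real.sin (m * s) * hm2)
      obtain ⟨b, hb⟩ := exists_eq_const_of_hasDerivAt_zero
        (f := fun s ↦ m * (κ s * Real.sin (m * s)) + deriv κ s * Real.cos (m * s)) hJ hJc
        fun s hs ↦ ((((hd s hs).mul (hsin m s)).const_mul m).add
          ((hdd s hs).mul (hcos m s))).congr_deriv (by
            linear_combination Real.cos (m * s) * (h s hs)
              + κ s * Real.cos (m * s) * hm2)
      refine ⟨a / m, b / m, fun s hs ↦ ?_⟩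
      field_simp
      rw [← ha s hs, ← hb s hs]
      linear_combination (-m * κ s) * Real.sin_sq_add_cos_sq (m * s)
  · rintro (⟨rfl, a, b, h⟩ | ⟨hl, a, b, h⟩ | ⟨hl, a, b, h⟩) s hs
    · rw [zero_mul, add_zero]
      exact deriv_deriv_of_hasDerivAt (f' := fun _ ↦ a) (f'' := fun _ ↦ 0) hJ h
        (fun s ↦ (((hasDerivAt_id s).const_mul a).add_const b).congr_deriv (mul_one a))
        (fun s ↦ hasDerivAt_const s a) hs
    · have hm2 : √lam * √lam = lam := Real.mul_self_sqrt hl.le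
      rw [deriv_deriv_of_hasDerivAt hJ h
        (fun s ↦ ((hcos _ s).const_mul a).add ((hsin _ s).const_mul b))
        (fun s ↦ ((((hsin _ s).neg.const_mul _).const_mul a).add
          (((hcos _ s).const_mul _).const_mul b))) hs, h s hs]
      linear_combination (-(a * Real.cos (√lam * s) + b * Real.sin (√lam * s))) * hm2
    · have hm2 : √(-lam) * √(-lam) = -lam := Real.mul_self_sqrt (by linarith)
      rw [deriv_deriv_of_hasDerivAt hJ h
        (fun s ↦ ((hexp _ s).const_mul a).add ((hexp _ s).const_mul b))
        (fun s ↦ ((((hexp _ s).const_mul _).const_mul a).add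
          (((hexp _ s).const_mul _).const_mul b))) hs, h s hs]
      linear_combination (a * Real.exp (√(-lam) * s) + b * Real.exp (-√(-lam) * s)) * hm2

end Oscillator

/-! ## Local lifts and the existence of patches -/

section Lift

variable {M : Type*} [TopologicalSpace M] [ChartedSpace R3 M] [IsManifold (𝓡 3) ∞ M]
  {B : Type*} [TopologicalSpace B] [ChartedSpace R2 B] [IsManifold (𝓡 2) ∞ B]

theorem exists_local_right_inverse {V : Type*} [NormedAddCommGroup V] [NormedSpace ℝ V]
    [CompleteSpace V] {k : V → V} {x : V} (hk : ∀ᶠ z in 𝓝 x, ContDiffAt ℝ ∞ k z)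
    (hk' : HasFDerivAt k (ContinuousLinearMap.id ℝ V) x) :
    ∃ L : V → V, L (k x) = x ∧ ∀ᶠ y in 𝓝 (k x), ContDiffAt ℝ ∞ L y ∧ k (L y) = y := by
  have hne : (∞ : WithTop ℕ∞) ≠ 0 := by simp
  have hkx := hk.self_of_nhds
  have hk'' : HasFDerivAt k ((ContinuousLinearEquiv.refl ℝ V : V ≃L[ℝ] V) : V →L[ℝ] V) x := hk'
  let h := hkx.toOpenPartialHomeomorph k hk'' hne
  have hx : h.symm (k x) = x := h.left_inv (hkx.mem_toOpenPartialHomeomorph_source hk'' hne)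
  have hkx' : k x ∈ h.target := hkx.image_mem_toOpenPartialHomeomorph_target hk'' hne
  have hf : ∀ᶠ z in 𝓝 x, fderiv ℝ k z ∈ range ((↑) : (V ≃L[ℝ] V) → V →L[ℝ] V) := by
    refine (hkx.fderiv_right (m := ∞) (by simp)).continuousAt.eventually ?_
    rw [hk''.fderiv]
    exact ContinuousLinearEquiv.nhds _
  have hc : ContinuousAt h.symm (k x) := h.continuousAt_symm hkx'
  refine ⟨h.symm, hx, ?_⟩
  filter_upwards [hc.eventually (by rw [hx]; exact hk), hc.eventually (by rw [hx]; exact hf),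
    h.open_target.mem_nhds hkx'] with y h1 h2 h3
  obtain ⟨e, he⟩ := h2
  refine ⟨h.contDiffAt_symm h3 (f₀' := e) ?_ h1, h.right_inv h3⟩
  rw [he]
  exact (h1.differentiableAt hne).hasFDerivAt

theorem exists_local_lift {pr : M → B} {p : M} (hpr : ContMDiff (𝓡 3) (𝓡 2) ∞ pr)
    (hsub : Function.Surjective (mfderiv (𝓡 3) (𝓡 2) pr p)) {γ : ℝ → B} {s₀ : ℝ}
    (hγ : ∀ᶠ s in 𝓝 s₀, ContMDiffAt 𝓘(ℝ, ℝ) (𝓡 2) ∞ γ s) (hp : pr p = γ s₀) :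
    ∃ q : ℝ → M, ∀ᶠ s in 𝓝 s₀, ContMDiffAt 𝓘(ℝ, ℝ) (𝓡 3) ∞ q s ∧ pr (q s) = γ s := by
  let x₀ : R3 := extChartAt (𝓡 3) p p
  let g : R3 → R2 := extChartAt (𝓡 2) (pr p) ∘ pr ∘ (extChartAt (𝓡 3) p).symm
  let D : R3 →L[ℝ] R2 := mfderiv (𝓡 3) (𝓡 2) pr p
  have hg' : HasFDerivAt g D x₀ := by
    refine hasFDerivWithinAt_univ.1 ?_
    rw [← ModelWithCorners.range_eq_univ (𝓡 3)]
    exact (hpr.contMDiffAt.mdifferentiableAt (by simp)).hasMFDerivAt.2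
  obtain ⟨A₀, hA₀⟩ := LinearMap.exists_rightInverse_of_surjective
    (D : R3 →ₗ[ℝ] R2) (LinearMap.range_eq_top.2 hsub)
  let A : R2 →L[ℝ] R3 := A₀.toContinuousLinearMap
  have hi : ContDiff ℝ ∞ (fun z : R2 ↦ x₀ + A z) := contDiff_const.add A.contDiff
  have hi0 : x₀ + A 0 = x₀ := by simp
  let F : R2 → M := fun z ↦ (extChartAt (𝓡 3) p).symm (x₀ + A z)
  have hF0 : F 0 = p := by simp only [F, hi0]; exact extChartAt_to_inv p
  have hF : ∀ᶠ z in 𝓝 (0 : R2), ContMDiffAt 𝓘(ℝ, R2) (𝓡 3) ∞ F z := by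
    have h1 : ∀ᶠ z in 𝓝 (0 : R2), x₀ + A z ∈ (extChartAt (𝓡 3) p).target :=
      hi.continuous.continuousAt.eventually_mem (by
        simp only [hi0]; exact extChartAt_target_mem_nhds p)
    filter_upwards [h1] with z hz
    exact ContMDiffAt.comp z ((contMDiffOn_extChartAt_symm p).contMDiffAt
      ((isOpen_extChartAt_target p).mem_nhds hz)) hi.contDiffAt.contMDiffAt
  let k : R2 → R2 := extChartAt (𝓡 2) (pr p) ∘ fun z ↦ pr (F z)
  have hprF : ContinuousAt (fun z ↦ pr (F z)) 0 :=
    hpr.continuous.continuousAt.comp hF.self_of_nhds.continuousAt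
  have hprF0 : pr (F 0) = pr p := by rw [hF0]
  have hk : ∀ᶠ z in 𝓝 (0 : R2), ContDiffAt ℝ ∞ k z := by
    filter_upwards [hF, hprF.eventually_mem (by
      rw [hprF0]; exact chart_source_mem_nhds R2 (pr p))] with z h1 h2
    exact contDiffAt_extChartAt_comp (ContMDiffAt.comp z hpr.contMDiffAt h1) h2
  have hk' : HasFDerivAt k (ContinuousLinearMap.id ℝ R2) 0 := by
    have h1 : HasFDerivAt g D (x₀ + A 0) := by rw [hi0]; exact hg'
    refine (HasFDerivAt.comp (0 : R2) h1 (A.hasFDerivAt.const_add x₀)).congr_fderiv ?_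
    ext1 y
    exact DFunLike.congr_fun hA₀ y
  obtain ⟨L, hL0, hL⟩ := exists_local_right_inverse hk hk'
  have hk0 : k 0 = extChartAt (𝓡 2) (pr p) (γ s₀) := by
    rw [← hp]; exact congrArg (extChartAt (𝓡 2) (pr p)) hprF0
  let c : ℝ → R2 := extChartAt (𝓡 2) (pr p) ∘ γ
  have e2 : ∀ᶠ s in 𝓝 s₀, γ s ∈ (chartAt R2 (pr p)).source :=
    hγ.self_of_nhds.continuousAt.eventually_mem (by
      rw [← hp]; exact chart_source_mem_nhds R2 (pr p))
  have hc : ∀ᶠ s in 𝓝 s₀, ContDiffAt ℝ ∞ c s := by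
    filter_upwards [hγ, e2] with s h1 h2
    exact contDiffAt_extChartAt_comp h1 h2
  have hcL : ∀ᶠ s in 𝓝 s₀, ContDiffAt ℝ ∞ L (c s) ∧ k (L (c s)) = c s :=
    hc.self_of_nhds.continuousAt.eventually (by rw [hk0] at hL; exact hL)
  have hLc0 : L (c s₀) = 0 := by rw [← hL0, hk0]; rfl
  have hLc : ContinuousAt (fun s ↦ L (c s)) s₀ :=
    hcL.self_of_nhds.1.continuousAt.comp hc.self_of_nhds.continuousAt
  have e1 : ∀ᶠ s in 𝓝 s₀, ContMDiffAt 𝓘(ℝ, R2) (𝓡 3) ∞ F (L (c s)) :=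
    hLc.eventually (by simp only [hLc0]; exact hF)
  have e3 : ∀ᶠ s in 𝓝 s₀, pr (F (L (c s))) ∈ (chartAt R2 (pr p)).source := by
    have h1 : ∀ᶠ z in 𝓝 (L (c s₀)), pr (F z) ∈ (chartAt R2 (pr p)).source := by
      rw [hLc0]
      exact hprF.eventually_mem (by rw [hprF0]; exact chart_source_mem_nhds R2 (pr p))
    exact hLc.eventually h1
  refine ⟨fun s ↦ F (L (c s)), ?_⟩
  filter_upwards [hc, hcL, e1, e2, e3] with s h1 h2 h3 h4 h5
  refine ⟨ContMDiffAt.comp s (g := F) (f := fun s ↦ L (c s)) h3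
    (h2.1.comp s h1).contMDiffAt, ?_⟩
  rw [← extChartAt_source (𝓡 2)] at h4 h5
  exact (extChartAt (𝓡 2) (pr p)).injOn h5 h4 h2.2

variable [RiemannianBundle (fun x : M ↦ TangentSpace (𝓡 3) x)]
  [IsContMDiffRiemannianBundle (𝓡 3) ∞ R3 (fun x : M ↦ TangentSpace (𝓡 3) x)]
  [RiemannianBundle (fun x : B ↦ TangentSpace (𝓡 2) x)]
  [IsContMDiffRiemannianBundle (𝓡 2) ∞ R2 (fun x : B ↦ TangentSpace (𝓡 2) x)]
  {S : ContactMetricStructure M} {θ : ℝ → M → M} {pr : M → B} {γ : ℝ → B} {J : Set ℝ}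

theorem mfderiv_flow_comp (hθ : S.IsRegularFlow θ) {q : ℝ → M} {u : Plane}
    (hΦ : MDifferentiableAt 𝓘(ℝ, Plane) (𝓡 3) (fun u : Plane ↦ θ (u 1) (q (u 0))) u) :
    (mfderiv 𝓘(ℝ, Plane) (𝓡 3) (fun u : Plane ↦ θ (u 1) (q (u 0))) u (coordVec 1) : R3) =
      S.ξ (θ (u 1) (q (u 0))) := by
  obtain ⟨a, b, rfl⟩ : ∃ a b : ℝ, u = a • coordVec 0 + b • coordVec 1 :=
    ⟨u 0, u 1, by ext i; fin_cases i <;> simp [coordVec]⟩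
  let i : ℝ → Plane := fun t ↦ a • coordVec 0 + t • coordVec 1
  have hi0 (t : ℝ) : i t 0 = a := by simp [i, coordVec]
  have hi1 (t : ℝ) : i t 1 = t := by simp [i, coordVec]
  have hi : HasFDerivAt i ((1 : ℝ →L[ℝ] ℝ).smulRight (coordVec 1)) b :=
    ((hasFDerivAt_id b).smul_const (coordVec 1)).const_add _
  have h1 := HasMFDerivAt.comp b (f := i) hΦ.hasMFDerivAt hi.hasMFDerivAt
  have h2 : (fun u : Plane ↦ θ (u 1) (q (u 0))) ∘ i = fun t ↦ θ t (q a) := by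
    funext t; simp only [Function.comp_apply, hi0, hi1]
  have h3 := congrArg (fun f : ℝ → M ↦ (mfderiv 𝓘(ℝ, ℝ) (𝓡 3) f b (1 : ℝ) : R3)) h2
  have h4 : (mfderiv 𝓘(ℝ, ℝ) (𝓡 3) (fun t ↦ θ t (q a)) b (1 : ℝ) : R3) = S.ξ (θ b (q a)) := by
    rw [(hθ.generates (q a) b).mfderiv]
    exact one_smul ℝ (S.ξ (θ b (q a)))
  have h5 : (mfderiv 𝓘(ℝ, ℝ) (𝓡 3) ((fun u : Plane ↦ θ (u 1) (q (u 0))) ∘ i) b (1 : ℝ) : R3) =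
      mfderiv 𝓘(ℝ, Plane) (𝓡 3) (fun u : Plane ↦ θ (u 1) (q (u 0))) (i b) (coordVec 1) := by
    rw [h1.mfderiv]
    exact congrArg (mfderiv 𝓘(ℝ, Plane) (𝓡 3) (fun u : Plane ↦ θ (u 1) (q (u 0))) (i b))
      (one_smul ℝ (coordVec 1))
  refine h5.symm.trans (h3.trans (h4.trans ?_))
  rw [show (a • coordVec 0 + b • coordVec 1 : Plane) = i b from rfl, hi0, hi1]

/-- Every point of the curve has a neighbourhood over which the Hopf cylinder is parametrised by
the flow of a local lift. -/
theorem exists_isHopfPatch (hθ : S.IsRegularFlow θ) (hpr : S.IsBoothbyWangFibering θ pr)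
    (hγ : IsUnitSpeedCurve (𝓡 2) γ J) {s₀ : ℝ} (hs₀ : s₀ ∈ J) :
    ∃ (U : Set Plane) (Φ : Plane → M), IsHopfPatch pr γ J U (fun u ↦ u 0) Φ ∧
      s₀ • coordVec 0 ∈ U := by
  have hγs (s) (hs : s ∈ J) : ContMDiffAt 𝓘(ℝ, ℝ) (𝓡 2) ∞ γ s :=
    hγ.smooth.contMDiffAt (hγ.isOpen.mem_nhds hs)
  obtain ⟨p, hp⟩ := hpr.surjective (γ s₀)
  have hJ : ∀ᶠ s in 𝓝 s₀, s ∈ J := hγ.isOpen.mem_nhds hs₀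
  obtain ⟨q, hq⟩ := exists_local_lift hpr.smooth (hpr.submersion p) (hJ.mono hγs) hp
  obtain ⟨W, hW, hWo, hsW⟩ := eventually_nhds_iff.1 (hq.and hJ)
  have hσ : ContDiff ℝ ∞ (fun u : Plane ↦ u 0) := by fun_prop
  have hτ : ContDiff ℝ ∞ (fun u : Plane ↦ u 1) := by fun_prop
  have hΦ (u : Plane) (hu : u 0 ∈ W) :
      ContMDiffAt 𝓘(ℝ, Plane) (𝓡 3) ∞ (fun u : Plane ↦ θ (u 1) (q (u 0))) u := by
    have h1 : ContMDiffAt 𝓘(ℝ, Plane) (𝓡 3) ∞ (fun u : Plane ↦ q (u 0)) u :=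
      ContMDiffAt.comp u (hW _ hu).1.1 hσ.contDiffAt.contMDiffAt
    exact ContMDiffAt.comp u (hθ.smooth (u 1, q (u 0)))
      (hτ.contDiffAt.contMDiffAt.prodMk h1)
  refine ⟨{u | u 0 ∈ W}, fun u ↦ θ (u 1) (q (u 0)), ⟨hWo.preimage hσ.continuous,
    hσ.contDiffOn, fun u hu ↦ (hΦ u hu).contMDiffWithinAt, fun u hu ↦
      ⟨(hW _ hu).2, (hpr.pr_flow _ _).trans (hW _ hu).1.2⟩, fun u hu ↦ ?_⟩, ?_⟩
  · refine (injective_iff_map_eq_zero (mfderiv 𝓘(ℝ, Plane) (𝓡 3)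
      (fun u : Plane ↦ θ (u 1) (q (u 0))) u)).2 fun (c : Plane) hc ↦ ?_
    have hc0 : fderiv ℝ (fun u : Plane ↦ u 0) u c = 0 := by
      have h1 := hpr.mfderiv_comp ((hΦ u hu).mdifferentiableAt (by simp)) c
      have h2 := mfderiv_comp_real (γ := γ) (σ := fun u : Plane ↦ u 0) (u := u)
        ((hγs _ (hW _ hu).2).mdifferentiableAt (by simp)) (hσ.differentiable (by simp) u) c
      have h3 : (fun z : Plane ↦ pr (θ (z 1) (q (z 0)))) =ᶠ[𝓝 u] fun z ↦ γ (z 0) :=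
        eventually_of_mem ((hWo.preimage hσ.continuous).mem_nhds hu) fun z hz ↦
          (hpr.pr_flow _ _).trans (hW _ hz).1.2
      rw [hc, map_zero, h3.mfderiv_eq] at h1
      have h4 := h2.symm.trans h1
      refine (smul_eq_zero.1 h4).resolve_right fun h5 ↦ ?_
      have h6 := hγ.unit_speed _ (hW _ hu).2
      rw [h5, inner_zero_left] at h6
      exact zero_ne_one h6
    have hce : c = c 1 • coordVec 1 := by
      have h0 : c 0 = 0 := by
        have h := ((EuclideanSpace.proj (0 : Fin 2) : Plane →L[ℝ] ℝ).hasFDerivAt (x := u)).fderiv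
        exact (DFunLike.congr_fun h c).symm.trans hc0
      ext i; fin_cases i <;> simp [coordVec, h0]
    have hξ := mfderiv_flow_comp hθ ((hΦ u hu).mdifferentiableAt (by simp))
    have hc1 : c 1 • (S.ξ (θ (u 1) (q (u 0))) : R3) = 0 := by
      rw [← hξ]
      refine Eq.trans ?_ hc
      have h7 := map_smul (mfderiv 𝓘(ℝ, Plane) (𝓡 3) (fun u : Plane ↦ θ (u 1) (q (u 0))) u)
        (c 1) (coordVec 1)
      rw [← hce] at h7
      exact h7.symm
    have hξ0 : (S.ξ (θ (u 1) (q (u 0))) : R3) ≠ 0 := fun h ↦ by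
      have h8 := S.η_ξ (θ (u 1) (q (u 0)))
      have h9 : S.η (θ (u 1) (q (u 0))) (S.ξ (θ (u 1) (q (u 0)))) = 0 :=
        (congrArg (S.η (θ (u 1) (q (u 0)))) h).trans (map_zero _)
      exact zero_ne_one (h9.symm.trans h8)
    have hc2 : c 1 = 0 := (smul_eq_zero.1 hc1).resolve_right hξ0
    exact hce.trans (by rw [hc2, zero_smul]; rfl)
  · simpa [coordVec] using hsW

end Lift

/-! ## The geometry of the base curve -/

section BaseCurve

variable {M : Type*} [TopologicalSpace M] [ChartedSpace R3 M] [IsManifold (𝓡 3) ∞ M]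
  [RiemannianBundle (fun x : M ↦ TangentSpace (𝓡 3) x)]
  [IsContMDiffRiemannianBundle (𝓡 3) ∞ R3 (fun x : M ↦ TangentSpace (𝓡 3) x)]
  {B : Type*} [TopologicalSpace B] [ChartedSpace R2 B] [IsManifold (𝓡 2) ∞ B]
  [RiemannianBundle (fun x : B ↦ TangentSpace (𝓡 2) x)]
  [IsContMDiffRiemannianBundle (𝓡 2) ∞ R2 (fun x : B ↦ TangentSpace (𝓡 2) x)]
  {S : ContactMetricStructure M} {θ : ℝ → M → M} {pr : M → B} {γ : ℝ → B} {J : Set ℝ}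

variable (S pr γ) in
/-- The unit normal field `J γ'` of the base curve. -/
noncomputable def baseNormal (s : ℝ) : TangentSpace (𝓡 2) (γ s) :=
  S.baseJ pr (γ s) (velocity (𝓡 2) γ s)

namespace IsUnitSpeedCurve

theorem contMDiffAt (hγ : IsUnitSpeedCurve (𝓡 2) γ J) {s : ℝ} (hs : s ∈ J) :
    ContMDiffAt 𝓘(ℝ, ℝ) (𝓡 2) ∞ γ s :=
  hγ.smooth.contMDiffAt (hγ.isOpen.mem_nhds hs)

theorem eventually_mem (hγ : IsUnitSpeedCurve (𝓡 2) γ J) {s : ℝ} (hs : s ∈ J) :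
    ∀ᶠ t in 𝓝 s, t ∈ J := hγ.isOpen.mem_nhds hs

theorem exists_patch (hγ : IsUnitSpeedCurve (𝓡 2) γ J) (hθ : S.IsRegularFlow θ)
    (hpr : S.IsBoothbyWangFibering θ pr) {s : ℝ} (hs : s ∈ J) :
    ∃ (U : Set Plane) (σ : Plane → ℝ) (Φ : Plane → M) (u : Plane),
      IsHopfPatch pr γ J U σ Φ ∧ u ∈ U ∧ σ u = s := by
  obtain ⟨U, Φ, hp, hu⟩ := exists_isHopfPatch hθ hpr hγ hs
  exact ⟨U, _, Φ, _, hp, hu, by simp [coordVec]⟩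

theorem inner_velocity_baseNormal (hγ : IsUnitSpeedCurve (𝓡 2) γ J) (hθ : S.IsRegularFlow θ)
    (hpr : S.IsBoothbyWangFibering θ pr) {s : ℝ} (hs : s ∈ J) :
    (inner ℝ (velocity (𝓡 2) γ s) (baseNormal S pr γ s) : ℝ) = 0 := by
  obtain ⟨U, σ, Φ, u, hp, hu, rfl⟩ := hγ.exists_patch hθ hpr hs
  exact hp.inner_velocity_baseJ hθ hpr hγ hu

theorem inner_baseNormal (hγ : IsUnitSpeedCurve (𝓡 2) γ J) (hθ : S.IsRegularFlow θ)
    (hpr : S.IsBoothbyWangFibering θ pr) {s : ℝ} (hs : s ∈ J) :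
    (inner ℝ (baseNormal S pr γ s) (baseNormal S pr γ s) : ℝ) = 1 := by
  obtain ⟨U, σ, Φ, u, hp, hu, rfl⟩ := hγ.exists_patch hθ hpr hs
  exact hp.inner_baseJ_baseJ hθ hpr hγ hu

theorem smoothAlong_velocity (hγ : IsUnitSpeedCurve (𝓡 2) γ J) {s : ℝ} (hs : s ∈ J) :
    SmoothAlong (𝓡 2) 𝓘(ℝ, ℝ) γ (velocity (𝓡 2) γ) s :=
  smoothAlong_mfderiv (hγ.contMDiffAt hs) 1

theorem smoothAlong_baseNormal (hγ : IsUnitSpeedCurve (𝓡 2) γ J) (hθ : S.IsRegularFlow θ)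
    (hpr : S.IsBoothbyWangFibering θ pr) {s : ℝ} (hs : s ∈ J) :
    SmoothAlong (𝓡 2) 𝓘(ℝ, ℝ) γ (baseNormal S pr γ) s := by
  obtain ⟨U, Φ, hp, hu⟩ := exists_isHopfPatch hθ hpr hγ hs
  let l : ℝ → Plane := fun t ↦ t • coordVec 0
  have hl : ContDiff ℝ ∞ l := contDiff_id.smul contDiff_const
  have hl0 (t : ℝ) : l t 0 = t := by simp [l, coordVec]
  have h1 : SmoothAlong (𝓡 2) 𝓘(ℝ, Plane) (fun z ↦ pr (Φ z))
      (fun z ↦ mfderiv (𝓡 3) (𝓡 2) pr (Φ z) (patchNormal S (fun u ↦ u 0) Φ z)) (l s) :=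
    (hp.smoothAlong_patchNormal hθ hpr hγ hu).map hpr.smooth
  have h2 : SmoothAlong (𝓡 2) 𝓘(ℝ, ℝ) (fun t ↦ pr (Φ (l t)))
      (fun t ↦ mfderiv (𝓡 3) (𝓡 2) pr (Φ (l t)) (patchNormal S (fun u ↦ u 0) Φ (l t))) s :=
    ContMDiffAt.comp s h1 hl.contDiffAt.contMDiffAt
  refine h2.congr ?_
  filter_upwards [(hp.isOpen.preimage hl.continuous).mem_nhds hu] with t ht
  have h3 := hp.baseJ_velocity hθ hpr hγ ht
  have h4 := hp.pr_eq ht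
  beta_reduce at h3 h4
  rw [hl0] at h3 h4
  exact ⟨h4.symm, h3⟩

theorem contDiffOn_signedCurvature (hγ : IsUnitSpeedCurve (𝓡 2) γ J) (hθ : S.IsRegularFlow θ)
    (hpr : S.IsBoothbyWangFibering θ pr) : ContDiffOn ℝ ∞ (S.signedCurvature pr γ) J := fun _ hs ↦
  ContDiffAt.contDiffWithinAt <| contDiffAt_inner_covAlong
    ((hγ.eventually_mem hs).mono fun _ ht ↦ hγ.smoothAlong_baseNormal hθ hpr ht) (1 : ℝ) (1 : ℝ)

theorem inner_covAlong_self {V : ∀ s, TangentSpace (𝓡 2) (γ s)} {s : ℝ}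
    (hγ : IsUnitSpeedCurve (𝓡 2) γ J) (hs : s ∈ J) (hV : SmoothAlong (𝓡 2) 𝓘(ℝ, ℝ) γ V s)
    (h1 : ∀ s ∈ J, (inner ℝ (V s) (V s) : ℝ) = 1) :
    (inner ℝ (curveDeriv (𝓡 2) γ V s) (V s) : ℝ) = 0 := by
  have h2 := fderiv_inner hV.diffAlong hV.diffAlong (1 : ℝ)
  have h3 : (fun y ↦ (inner ℝ (V y) (V y) : ℝ)) =ᶠ[𝓝 s] fun _ ↦ (1 : ℝ) :=
    (hγ.eventually_mem hs).mono h1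
  rw [h3.fderiv_eq, fderiv_fun_const, real_inner_comm (V s)] at h2
  have h4 : (0 : ℝ) = _ := h2
  rw [curveDeriv, real_inner_comm]
  linarith

theorem curveMeanCurvature_eq (hγ : IsUnitSpeedCurve (𝓡 2) γ J) (hθ : S.IsRegularFlow θ)
    (hpr : S.IsBoothbyWangFibering θ pr) {s : ℝ} (hs : s ∈ J) :
    curveMeanCurvature (𝓡 2) γ s = S.signedCurvature pr γ s • baseNormal S pr γ s := by
  refine (eq_frame_sum₂ (hγ.unit_speed s hs) (hγ.inner_baseNormal hθ hpr hs)
    (hγ.inner_velocity_baseNormal hθ hpr hs) (curveMeanCurvature (𝓡 2) γ s)).trans ?_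
  rw [curveMeanCurvature, hγ.inner_covAlong_self hs (hγ.smoothAlong_velocity hs) hγ.unit_speed,
    zero_smul, zero_add]
  rfl

theorem curveNormalDeriv_smul (hγ : IsUnitSpeedCurve (𝓡 2) γ J) (hθ : S.IsRegularFlow θ)
    (hpr : S.IsBoothbyWangFibering θ pr) {V : ∀ s, TangentSpace (𝓡 2) (γ s)} {f : ℝ → ℝ}
    (hV : ∀ s ∈ J, V s = f s • baseNormal S pr γ s) {s : ℝ} (hs : s ∈ J)
    (hf : DifferentiableAt ℝ f s) :
    curveNormalDeriv (𝓡 2) γ V s = deriv f s • baseNormal S pr γ s := by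
  have h1 : curveDeriv (𝓡 2) γ V s =
      curveDeriv (𝓡 2) γ (fun t ↦ f t • baseNormal S pr γ t) s :=
    covAlong_congr ((hγ.eventually_mem hs).mono fun t ht ↦ ⟨rfl, hV t ht⟩) _
  have hN := hγ.smoothAlong_baseNormal hθ hpr hs
  have h2 : curveDeriv (𝓡 2) γ (fun t ↦ f t • baseNormal S pr γ t) s =
      deriv f s • baseNormal S pr γ s + f s • curveDeriv (𝓡 2) γ (baseNormal S pr γ) s := by
    refine (covAlong_smul hf.mdifferentiableAt hN.diffAlong (1 : ℝ)).trans ?_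
    have h3 : mvfderiv 𝓘(ℝ, ℝ) f s (1 : ℝ) = deriv f s := mvfderiv_eq_fderiv f s (1 : ℝ)
    rw [h3]
    rfl
  have h3 := eq_frame_sum₂ (hγ.unit_speed s hs) (hγ.inner_baseNormal hθ hpr hs)
    (hγ.inner_velocity_baseNormal hθ hpr hs) (curveDeriv (𝓡 2) γ (baseNormal S pr γ) s)
  rw [hγ.inner_covAlong_self hs hN fun t ht ↦ hγ.inner_baseNormal hθ hpr ht, zero_smul,
    add_zero] at h3
  set c := (inner ℝ (curveDeriv (𝓡 2) γ (baseNormal S pr γ) s) (velocity (𝓡 2) γ s) : ℝ)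
  have h4 : (inner ℝ (baseNormal S pr γ s) (velocity (𝓡 2) γ s) : ℝ) = 0 := by
    rw [real_inner_comm]; exact hγ.inner_velocity_baseNormal hθ hpr hs
  rw [curveNormalDeriv, h1, h2, h3, inner_add_left, real_inner_smul_left, real_inner_smul_left,
    real_inner_smul_left, hγ.unit_speed s hs, h4, smul_smul]
  simp

theorem curveNormalLaplacian_eq (hγ : IsUnitSpeedCurve (𝓡 2) γ J) (hθ : S.IsRegularFlow θ)
    (hpr : S.IsBoothbyWangFibering θ pr) {s : ℝ} (hs : s ∈ J) :
    curveNormalLaplacian (𝓡 2) γ (curveMeanCurvature (𝓡 2) γ) s =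
      (-deriv (deriv (S.signedCurvature pr γ)) s) • baseNormal S pr γ s := by
  have hκ (t) (ht : t ∈ J) : ContDiffAt ℝ ∞ (S.signedCurvature pr γ) t :=
    (hγ.contDiffOn_signedCurvature hθ hpr).contDiffAt (hγ.isOpen.mem_nhds ht)
  rw [curveNormalLaplacian, hγ.curveNormalDeriv_smul hθ hpr
    (fun t ht ↦ hγ.curveNormalDeriv_smul hθ hpr
      (fun r hr ↦ hγ.curveMeanCurvature_eq hθ hpr hr) ht ((hκ t ht).differentiableAt (by simp)))
    hs ((contDiffAt_deriv (hκ s hs)).differentiableAt (by simp)), neg_smul]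

theorem curveSatisfies_iff (hγ : IsUnitSpeedCurve (𝓡 2) γ J) (hθ : S.IsRegularFlow θ)
    (hpr : S.IsBoothbyWangFibering θ pr) (lam : ℝ) : CurveSatisfies γ J lam ↔
      ∀ s ∈ J, deriv (deriv (S.signedCurvature pr γ)) s + lam * S.signedCurvature pr γ s = 0 := by
  refine forall₂_congr fun s hs ↦ ?_
  have hN : baseNormal S pr γ s ≠ 0 := fun h ↦ by
    have := hγ.inner_baseNormal hθ hpr hs
    rw [h, inner_zero_left] at this
    exact zero_ne_one this
  rw [hγ.curveNormalLaplacian_eq hθ hpr hs, hγ.curveMeanCurvature_eq hθ hpr hs, smul_smul,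
    (smul_left_injective ℝ hN).eq_iff]
  constructor <;> intro h <;> linarith

theorem hopfCylinderSatisfies_iff (hγ : IsUnitSpeedCurve (𝓡 2) γ J) (hS : S.IsSasaki)
    (hθ : S.IsRegularFlow θ) (hpr : S.IsBoothbyWangFibering θ pr) (lam : ℝ) :
    HopfCylinderSatisfies pr γ J lam ↔
      ∀ s ∈ J, deriv (deriv (S.signedCurvature pr γ)) s + lam * S.signedCurvature pr γ s = 0 := by
  have key {U : Set Plane} {σ : Plane → ℝ} {Φ : Plane → M} (hp : IsHopfPatch pr γ J U σ Φ)
      {u : Plane} (hu : u ∈ U) :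
      patchNormalLaplacian (𝓡 3) Φ (patchMeanCurvature (𝓡 3) Φ) u
        = lam • patchMeanCurvature (𝓡 3) Φ u ↔
      deriv (deriv (S.signedCurvature pr γ)) (σ u) + lam * S.signedCurvature pr γ (σ u) = 0 := by
    have hN : patchNormal S σ Φ u ≠ 0 := fun h ↦ by
      have := hp.inner_patchNormal hθ hpr hγ hu
      rw [h, inner_zero_left] at this
      exact zero_ne_one this
    rw [hp.patchNormalLaplacian_eq hS hθ hpr hγ (hγ.contDiffOn_signedCurvature hθ hpr) hu,
      hp.patchMeanCurvature_eq hS hθ hpr hγ hu, smul_smul, (smul_left_injective ℝ hN).eq_iff]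
    constructor <;> intro h <;> linarith
  constructor
  · intro h s hs
    obtain ⟨U, σ, Φ, u, hp, hu, rfl⟩ := hγ.exists_patch hθ hpr hs
    exact (key hp hu).1 (h U σ Φ hp u hu)
  · intro h U σ Φ hp u hu
    exact (key hp hu).2 (h (σ u) (hp.mapsTo u hu).1)

end IsUnitSpeedCurve

end BaseCurve

end HopfCylinder

theorem mainTheorem6
    {M : Type*} [TopologicalSpace M] [T2Space M] [ChartedSpace HopfCylinder.R3 M]
    [IsManifold (𝓡 3) ∞ M]
    [RiemannianBundle (fun x : M ↦ TangentSpace (𝓡 3) x)]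
    [IsContMDiffRiemannianBundle (𝓡 3) ∞ HopfCylinder.R3 (fun x : M ↦ TangentSpace (𝓡 3) x)]
    {B : Type*} [TopologicalSpace B] [T2Space B] [ChartedSpace HopfCylinder.R2 B]
    [IsManifold (𝓡 2) ∞ B]
    [RiemannianBundle (fun x : B ↦ TangentSpace (𝓡 2) x)]
    [IsContMDiffRiemannianBundle (𝓡 2) ∞ HopfCylinder.R2 (fun x : B ↦ TangentSpace (𝓡 2) x)]
    (S : HopfCylinder.ContactMetricStructure M) (hS : S.IsSasaki)
    (θ : ℝ → M → M) (hθ : S.IsRegularFlow θ)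
    (pr : M → B) (hpr : S.IsBoothbyWangFibering θ pr)
    (γ : ℝ → B) (J : Set ℝ) (hγ : HopfCylinder.IsUnitSpeedCurve (𝓡 2) γ J)
    (lam : ℝ) :
    ContDiffOn ℝ ∞ (S.signedCurvature pr γ) J ∧
    (HopfCylinder.HopfCylinderSatisfies pr γ J lam ↔ HopfCylinder.CurveSatisfies γ J lam) ∧
    (HopfCylinder.HopfCylinderSatisfies pr γ J lam ↔
      ∀ s ∈ J, deriv (deriv (S.signedCurvature pr γ)) s + lam * S.signedCurvature pr γ s = 0) ∧
    (HopfCylinder.HopfCylinderSatisfies pr γ J lam ↔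
      (lam = 0 ∧ ∃ a b : ℝ, ∀ s ∈ J, S.signedCurvature pr γ s = a * s + b) ∨
      (0 < lam ∧ ∃ a b : ℝ, ∀ s ∈ J, S.signedCurvature pr γ s =
        a * Real.cos (√lam * s) + b * Real.sin (√lam * s)) ∨
      (lam < 0 ∧ ∃ a b : ℝ, ∀ s ∈ J, S.signedCurvature pr γ s =
        a * Real.exp (√(-lam) * s) + b * Real.exp (-√(-lam) * s))) := by
  have hκ := hγ.contDiffOn_signedCurvature hθ hpr
  have hac := hγ.hopfCylinderSatisfies_iff hS hθ hpr lam
  exact ⟨hκ, hac.trans (hγ.curveSatisfies_iff hθ hpr lam).symm, hac,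
    hac.trans (HopfCylinder.oscillator_iff hγ.isOpen hγ.ordConnected hκ lam)⟩
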